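/- Let $\alpha\in(0,1)$, $b\in(0,1)$ and $\Omega\in\mathbb R$. For functions on the unit circle $\mathbb T$ write $f'=\frac{df}{dw}=-ie^{-i\eta}\frac{d}{d\eta}f(e^{i\eta})$. Let $$X=C^{2-\alpha}_{ar}(\mathbb T)^2,\qquad C^{2-\alpha}_{ar}(\mathbb T)=\Big\{f\in C^{2-\alpha}(\mathbb T):\ f(w)=\sum_{n\ge1}a_n\overline w^{\,n},\ a_n\in\mathbb R\Big\},$$ $$Y=H^2,\qquad H=\Big\{g\in C^{1-\alpha}(\mathbb T):\ g(w)=\tfrac i2\sum_{n\ge1}a_n(w^n-\overline w^{\,n}),\ a_n\in\mathbb R\Big\},$$ with the usual Hölder norms $\|g\|_{C^{1-\alpha}}=\|g\|_\infty+\sup_{\tau\ne w}\frac{|g(\tau)-g(w)|}{|\tau-w|^{1-\alpha}}$ and $\|f\|_{C^{2-\alpha}}=\|f\|_\infty+\|f'\|_{C^{1-\alpha}}$; the series in the definition of $H$ is the limit of its partial sums. Let $V=B_r\times B_r\subset X$, where $B_r$ is the open ball of $C^{2-\alpha}_{ar}(\mathbb T)$ with centre $0$ and radius $r=\frac14\min\{b,1-b\}$.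 For $(f_1,f_2)\in V$ put $\phi_1=\mathrm{Id}+f_1$, $\phi_2=b\,\mathrm{Id}+f_2$ and, for $j=1,2$ and $w\in\mathbb T$, $$G_j(\Omega,f_1,f_2)(w)=\operatorname{Im}\Big\{\big(\Omega\,\phi_j(w)+S(\phi_2,\phi_j)(w)-S(\phi_1,\phi_j)(w)\big)\,\overline w\,\overline{\phi_j'(w)}\Big\},$$ $$S(\phi_i,\phi_j)(w)=\frac{C_\alpha}{2\pi i}\int_{\mathbb T}\frac{\phi_i'(\tau)}{|\phi_j(w)-\phi_i(\tau)|^\alpha}\,d\tau,\qquad C_\alpha=\frac{\Gamma(\alpha/2)}{2^{1-\alpha}\Gamma(\frac{2-\alpha}2)}.$$ For $n\ge1$ let $$\Lambda_n(b)=\frac1b\int_0^{\infty}\frac{J_n(bt)J_n(t)}{t^{1-\alpha}}\,dt,\qquad \Theta_n=\Lambda_1(1)-\Lambda_n(1),$$ where $J_n$ is the Bessel function of the first kind, and for $n\ge2$ let $$M_n^\alpha=\begin{pmatrix}\Omega-\Theta_n+b^2\Lambda_1(b)&-b^2\Lambda_n(b)\\ b\Lambda_n(b)&b\Omega+b^{1-\alpha}\Theta_n-b\Lambda_1(b)\end{pmatrix}.$$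 Then the integrals defining $\Lambda_n(b)$ and $\Lambda_n(1)$, $n\ge1$, converge absolutely; the functional $G(\Omega,\cdot)=(G_1(\Omega,\cdot),G_2(\Omega,\cdot))$ maps $V$ into $Y$ and is Fréchet differentiable at $(0,0)$; and for all $(h_1,h_2)\in X$ with $h_1(w)=\sum_{n\ge1}a_n\overline w^{\,n}$, $h_2(w)=\sum_{n\ge1}c_n\overline w^{\,n}$ ($a_n,c_n\in\mathbb R$), its differential is $$DG(\Omega,0,0)(h_1,h_2)(w)=\frac i2\sum_{n\ge1}(n+1)\,M^\alpha_{n+1}\begin{pmatrix}a_n\\c_n\end{pmatrix}\big(w^{n+1}-\overline w^{\,n+1}\big),\qquad w\in\mathbb T,$$ where for every $w$ the series converges as the limit of its partial sums. Moreover, for $n\ge2$, $$\det M^\alpha_n=\big(\Omega-\Theta_n+b^2\Lambda_1(b)\big)\big(b\Omega+b^{1-\alpha}\Theta_n-b\Lambda_1(b)\big)+b^3\Lambda_n(b)^2 .$$ -/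

import Mathlib

open Real Set Filter Topology MeasureTheory
open scoped NNReal ENNReal Matrix ComplexConjugate

noncomputable section

namespace VState

/-! ### Functions on the unit circle -/

/-- The function `f` on the circle, written in the angular variable: `η ↦ f (e^{iη})`. -/
def lift (f : Circle → ℂ) (η : ℝ) : ℂ := f (Circle.exp η)

/-- The derivative `f'(w) = df/dw = -i e^{-iη} d/dη f(e^{iη})`, `w = e^{iη}`. -/
def circleDeriv (f : Circle → ℂ) (w : Circle) : ℂ :=
  -Complex.I * conj (w : ℂ) * deriv (lift f) (Complex.arg (w : ℂ))

/-- The normalized contour integral `(1 / (2 π i)) ∫_𝕋 g(τ) dτ` over the positively oriented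
unit circle. -/
def mint (g : Circle → ℂ) : ℂ :=
  (2 * (π : ℂ) * Complex.I)⁻¹ *
    ∫ η in (0 : ℝ)..(2 * π), g (Circle.exp η) * (Complex.I * (Circle.exp η : ℂ))

/-- The Hölder exponent `γ = 1 - α`. -/
def expo (α : ℝ) : ℝ≥0 := (1 - α).toNNReal

/-! ### Elementary facts on the derivative -/

lemma circleDeriv_add {f g : Circle → ℂ} (hf : ContDiff ℝ 1 (lift f))
    (hg : ContDiff ℝ 1 (lift g)) :
    circleDeriv (f + g) = circleDeriv f + circleDeriv g := by
  funext w
  have h : lift (f + g) = lift f + lift g := rfl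
  simp only [circleDeriv, Pi.add_apply, h]
  rw [deriv_add (hf.differentiable one_ne_zero _) (hg.differentiable one_ne_zero _)]
  ring

lemma circleDeriv_smul (c : ℝ) {f : Circle → ℂ} (hf : ContDiff ℝ 1 (lift f)) :
    circleDeriv (c • f) = c • circleDeriv f := by
  funext w
  have h : lift (c • f) = c • lift f := rfl
  simp only [circleDeriv, Pi.smul_apply, h]
  rw [deriv_const_smul _ (hf.differentiable one_ne_zero _)]
  simp only [Complex.real_smul]
  ring

lemma lift_zero : lift (0 : Circle → ℂ) = fun _ => 0 := rfl

lemma circleDeriv_zero : circleDeriv (0 : Circle → ℂ) = 0 := by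
  funext w
  simp [circleDeriv, lift_zero]

lemma bddAbove_circleDeriv {f : Circle → ℂ} (hf : ContDiff ℝ 1 (lift f)) :
    BddAbove (range fun w : Circle => ‖circleDeriv f w‖) := by
  have hc : Continuous (deriv (lift f)) := hf.continuous_deriv le_rfl
  obtain ⟨C, hC⟩ := (isCompact_Icc (a := -π) (b := π)).exists_bound_of_continuousOn hc.continuousOn
  refine ⟨C, ?_⟩
  rintro _ ⟨w, rfl⟩
  have := hC (Complex.arg (w : ℂ)) ⟨(Complex.neg_pi_lt_arg _).le, Complex.arg_le_pi _⟩
  simpa [circleDeriv, Circle.norm_coe] using this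

/-! ### The space of boundary perturbations -/

/-- `f ∈ C^{2-α}(𝕋)` with `f(w) = ∑_{n ≥ 1} a_n w̄^n` and real `a_n`: `f` is of class `C^1`, its
derivative is Hölder continuous of exponent `1 - α`. -/
def arSubmodule (α : ℝ) : Submodule ℝ C(Circle, ℂ) where
  carrier := {f | ContDiff ℝ 1 (lift f) ∧ MemHolder (expo α) (circleDeriv f) ∧
    ∃ a : ℕ → ℝ, ∀ w : Circle,
      HasSum (fun n : ℕ => (a (n + 1) : ℂ) * conj (w : ℂ) ^ (n + 1)) (f w)}
  zero_mem' := by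
    refine ⟨?_, ?_, 0, fun w => ?_⟩
    · exact contDiff_const
    · rw [ContinuousMap.coe_zero, circleDeriv_zero]; exact memHolder_zero
    · simp
  add_mem' := by
    rintro f g ⟨hf, hf', a, ha⟩ ⟨hg, hg', c, hc⟩
    refine ⟨hf.add hg, ?_, a + c, fun w => ?_⟩
    · rw [ContinuousMap.coe_add, circleDeriv_add hf hg]; exact hf'.add hg'
    · simpa [add_mul] using (ha w).add (hc w)
  smul_mem' := by
    rintro r f ⟨hf, hf', a, ha⟩
    refine ⟨contDiff_const.smul hf, ?_, r • a, fun w => ?_⟩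
    · rw [ContinuousMap.coe_smul, circleDeriv_smul r hf]; exact hf'.smul
    · simpa [mul_assoc] using (ha w).mul_left (r : ℂ)

/-- The space `C^{2-α}_{ar}(𝕋)`. -/
def Car (α : ℝ) : Type := arSubmodule α

namespace Car

variable {α : ℝ}

instance : AddCommGroup (Car α) := inferInstanceAs (AddCommGroup (arSubmodule α))
instance : Module ℝ (Car α) := inferInstanceAs (Module ℝ (arSubmodule α))

/-- The underlying continuous function. -/
def toC (f : Car α) : C(Circle, ℂ) := Subtype.val (p := fun f => f ∈ arSubmodule α) f

instance : CoeFun (Car α) (fun _ => Circle → ℂ) := ⟨fun f => f.toC⟩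

/-- `‖f‖_{C^{2-α}} = ‖f‖_∞ + ‖f'‖_∞ + [f']_{1-α}`. -/
instance : Norm (Car α) :=
  ⟨fun f => ‖f.toC‖ +
    ((⨆ w : Circle, ‖circleDeriv f w‖) + (nnHolderNorm (expo α) (circleDeriv f) : ℝ))⟩

lemma norm_def (f : Car α) : ‖f‖ = ‖f.toC‖ +
    ((⨆ w : Circle, ‖circleDeriv f w‖) + (nnHolderNorm (expo α) (circleDeriv f) : ℝ)) := rfl

lemma toC_add (f g : Car α) : (f + g).toC = f.toC + g.toC := rfl
lemma toC_smul (c : ℝ) (f : Car α) : (c • f).toC = c • f.toC := rfl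
lemma toC_zero : (0 : Car α).toC = 0 := rfl

lemma contDiff (f : Car α) : ContDiff ℝ 1 (lift f) :=
  (Subtype.property (p := fun f => f ∈ arSubmodule α) f).1

lemma memHolder (f : Car α) : MemHolder (expo α) (circleDeriv f) :=
  (Subtype.property (p := fun f => f ∈ arSubmodule α) f).2.1

lemma core : NormedSpace.Core ℝ (Car α) where
  norm_nonneg f := by
    rw [norm_def]
    have := Real.iSup_nonneg (f := fun w : Circle => ‖circleDeriv f w‖) fun w => norm_nonneg _
    positivity
  norm_smul c f := by
    rw [norm_def, norm_def, toC_smul, norm_smul, ContinuousMap.coe_smul,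
      circleDeriv_smul c f.contDiff, f.memHolder.nnHolderNorm_smul]
    simp only [Pi.smul_apply, norm_smul]
    rw [← Real.mul_iSup_of_nonneg (norm_nonneg c)]
    push_cast
    ring
  norm_triangle f g := by
    rw [norm_def, norm_def, norm_def, toC_add, ContinuousMap.coe_add,
      circleDeriv_add f.contDiff g.contDiff]
    have h1 := norm_add_le f.toC g.toC
    have h2 : (⨆ w : Circle, ‖(circleDeriv f + circleDeriv g) w‖) ≤
        (⨆ w : Circle, ‖circleDeriv f w‖) + ⨆ w : Circle, ‖circleDeriv g w‖ :=
      ciSup_le fun w => (norm_add_le _ _).trans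
        (add_le_add (le_ciSup (bddAbove_circleDeriv f.contDiff) w)
          (le_ciSup (bddAbove_circleDeriv g.contDiff) w))
    have h3 : (nnHolderNorm (expo α) (circleDeriv f + circleDeriv g) : ℝ) ≤
        nnHolderNorm (expo α) (circleDeriv f) + nnHolderNorm (expo α) (circleDeriv g) := by
      exact_mod_cast f.memHolder.nnHolderNorm_add_le g.memHolder
    linarith
  norm_eq_zero_iff f := by
    constructor
    · intro h
      rw [norm_def] at h
      have h1 := Real.iSup_nonneg (f := fun w : Circle => ‖circleDeriv f w‖) fun w => norm_nonneg _
      have h2 := (nnHolderNorm (expo α) (circleDeriv f)).coe_nonneg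
      have h3 : ‖f.toC‖ = 0 := le_antisymm (by linarith) (norm_nonneg _)
      exact Subtype.ext (norm_eq_zero.mp h3)
    · rintro rfl
      rw [norm_def, toC_zero, ContinuousMap.coe_zero, circleDeriv_zero]
      simp

instance : NormedAddCommGroup (Car α) := NormedAddCommGroup.ofCore core
instance : NormedSpace ℝ (Car α) := NormedSpace.ofCore core

end Car

/-! ### The target space -/

/-- `g ∈ C^{1-α}(𝕋)` with `g(w) = (i/2) ∑_{n ≥ 1} a_n (w^n - w̄^n)` and real `a_n`, where the series
converges as the limit of its partial sums. -/
def HSubmodule (α : ℝ) : Submodule ℝ C(Circle, ℂ) where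
  carrier := {g | MemHolder (expo α) g ∧
    ∃ a : ℕ → ℝ, ∀ w : Circle,
      Tendsto (fun N : ℕ => Complex.I / 2 * ∑ n ∈ Finset.Icc 1 N,
        (a n : ℂ) * ((w : ℂ) ^ n - conj (w : ℂ) ^ n)) atTop (𝓝 (g w))}
  zero_mem' := by
    refine ⟨?_, 0, fun w => ?_⟩
    · rw [ContinuousMap.coe_zero]; exact memHolder_zero
    · simp
  add_mem' := by
    rintro f g ⟨hf, a, ha⟩ ⟨hg, c, hc⟩
    refine ⟨hf.add hg, a + c, fun w => ?_⟩
    simpa [add_mul, Finset.sum_add_distrib, mul_add] using (ha w).add (hc w)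
  smul_mem' := by
    rintro r f ⟨hf, a, ha⟩
    refine ⟨hf.smul, r • a, fun w => ?_⟩
    have h := (ha w).const_mul (r : ℂ)
    simp only [ContinuousMap.coe_smul, Pi.smul_apply, Complex.real_smul, smul_eq_mul,
      Complex.ofReal_mul]
    refine h.congr fun N => ?_
    rw [Finset.mul_sum, Finset.mul_sum, Finset.mul_sum]
    exact Finset.sum_congr rfl fun n _ => by ring

/-- The space `H`. -/
def H (α : ℝ) : Type := HSubmodule α

namespace H

variable {α : ℝ}

instance : AddCommGroup (H α) := inferInstanceAs (AddCommGroup (HSubmodule α))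
instance : Module ℝ (H α) := inferInstanceAs (Module ℝ (HSubmodule α))

/-- The underlying continuous function. -/
def toC (g : H α) : C(Circle, ℂ) := Subtype.val (p := fun g => g ∈ HSubmodule α) g

instance : CoeFun (H α) (fun _ => Circle → ℂ) := ⟨fun g => g.toC⟩

/-- `‖g‖_{C^{1-α}} = ‖g‖_∞ + [g]_{1-α}`. -/
instance : Norm (H α) := ⟨fun g => ‖g.toC‖ + (nnHolderNorm (expo α) g : ℝ)⟩

lemma norm_def (g : H α) : ‖g‖ = ‖g.toC‖ + (nnHolderNorm (expo α) g : ℝ) := rfl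

lemma toC_add (f g : H α) : (f + g).toC = f.toC + g.toC := rfl
lemma toC_smul (c : ℝ) (f : H α) : (c • f).toC = c • f.toC := rfl
lemma toC_zero : (0 : H α).toC = 0 := rfl

lemma memHolder (g : H α) : MemHolder (expo α) g :=
  (Subtype.property (p := fun g => g ∈ HSubmodule α) g).1

lemma core : NormedSpace.Core ℝ (H α) where
  norm_nonneg f := by rw [norm_def]; positivity
  norm_smul c f := by
    rw [norm_def, norm_def, toC_smul, norm_smul, ContinuousMap.coe_smul,
      f.memHolder.nnHolderNorm_smul]
    push_cast
    ring
  norm_triangle f g := by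
    rw [norm_def, norm_def, norm_def, toC_add, ContinuousMap.coe_add]
    have h1 := norm_add_le f.toC g.toC
    have h3 : (nnHolderNorm (expo α) (f.toC + g.toC : Circle → ℂ) : ℝ) ≤
        nnHolderNorm (expo α) f + nnHolderNorm (expo α) g := by
      exact_mod_cast f.memHolder.nnHolderNorm_add_le g.memHolder
    linarith
  norm_eq_zero_iff f := by
    constructor
    · intro h
      rw [norm_def] at h
      have h2 := (nnHolderNorm (expo α) f).coe_nonneg
      have h3 : ‖f.toC‖ = 0 := le_antisymm (by linarith) (norm_nonneg _)
      exact Subtype.ext (norm_eq_zero.mp h3)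
    · rintro rfl
      rw [norm_def, toC_zero, ContinuousMap.coe_zero]
      simp

instance : NormedAddCommGroup (H α) := NormedAddCommGroup.ofCore core
instance : NormedSpace ℝ (H α) := NormedSpace.ofCore core

end H

/-! ### The V-state functional -/

/-- `C_α = Γ(α/2) / (2^{1-α} Γ((2-α)/2))`. -/
def Cα (α : ℝ) : ℝ := Real.Gamma (α / 2) / ((2 : ℝ) ^ (1 - α) * Real.Gamma ((2 - α) / 2))

/-- `S(φ_i, φ_j)(w) = C_α ⨍ φ_i'(τ) / |φ_j(w) - φ_i(τ)|^α dτ`. -/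
def S (α : ℝ) (φi φj : Circle → ℂ) (w : Circle) : ℂ :=
  (Cα α : ℂ) * mint fun τ => circleDeriv φi τ / ((‖φj w - φi τ‖ ^ α : ℝ) : ℂ)

/-- `F_j(Ω, φ₁, φ₂)(w) = Im {(Ω φ_j(w) + S(φ₂, φ_j)(w) - S(φ₁, φ_j)(w)) w̄ conj(φ_j'(w))}`
for `φ_j = φ`. -/
def F (α Ω : ℝ) (φ₁ φ₂ φ : Circle → ℂ) (w : Circle) : ℝ :=
  (((Ω : ℂ) * φ w + S α φ₂ φ w - S α φ₁ φ w) *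
    conj (w : ℂ) * conj (circleDeriv φ w)).im

/-- `φ = r Id + f`. -/
def perturb (r : ℝ) (f : Circle → ℂ) (w : Circle) : ℂ := (r : ℂ) * (w : ℂ) + f w

/-- The function `G₁(Ω, f₁, f₂)` on the circle, with `φ₁ = Id + f₁` and `φ₂ = b Id + f₂`. -/
def G₁ (α b Ω : ℝ) (f₁ f₂ : Circle → ℂ) (w : Circle) : ℝ :=
  F α Ω (perturb 1 f₁) (perturb b f₂) (perturb 1 f₁) w

/-- The function `G₂(Ω, f₁, f₂)` on the circle, with `φ₁ = Id + f₁` and `φ₂ = b Id + f₂`. -/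
def G₂ (α b Ω : ℝ) (f₁ f₂ : Circle → ℂ) (w : Circle) : ℝ :=
  F α Ω (perturb 1 f₁) (perturb b f₂) (perturb b f₂) w

open Classical in
/-- The element of `H` whose underlying function is `g` (and `0` if there is none). -/
def toH (α : ℝ) (g : Circle → ℝ) : H α :=
  if h : ∃ u : H α, ∀ w, u w = (g w : ℂ) then h.choose else 0

/-- The functional `G(Ω, ·) = (G₁(Ω, ·), G₂(Ω, ·))` between the function spaces
`X = C^{2-α}_{ar} × C^{2-α}_{ar}` and `Y = H × H`. -/
def G (α b Ω : ℝ) (f : Car α × Car α) : H α × H α :=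
  (toH α (G₁ α b Ω f.1 f.2), toH α (G₂ α b Ω f.1 f.2))

/-- The radius `r = (1/4) min {b, 1 - b}`. -/
def radius (b : ℝ) : ℝ := 1 / 4 * min b (1 - b)

/-- The neighborhood `V = B_r × B_r` of `0` in `X`. -/
def V (α b : ℝ) : Set (Car α × Car α) :=
  Metric.ball 0 (radius b) ×ˢ Metric.ball 0 (radius b)

/-! ### The Fourier multiplier -/

/-- The Bessel function of the first kind `J_n`, by its power series. -/
def besselJ (n : ℕ) (t : ℝ) : ℝ :=
  ∑' k : ℕ, (-1) ^ k / ((k.factorial : ℝ) * ((n + k).factorial : ℝ)) * (t / 2) ^ (2 * k + n)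

/-- The integrand `J_n(bt) J_n(t) / t^{1-α}`. -/
def besselIntegrand (α : ℝ) (n : ℕ) (b t : ℝ) : ℝ :=
  besselJ n (b * t) * besselJ n t / t ^ (1 - α)

/-- `Λ_n(b) = (1/b) ∫₀^∞ J_n(bt) J_n(t) / t^{1-α} dt`. -/
def Λ (α : ℝ) (n : ℕ) (b : ℝ) : ℝ := 1 / b * ∫ t in Ioi (0 : ℝ), besselIntegrand α n b t

/-- `Θ_n = Λ_1(1) - Λ_n(1)`. -/
def Θ (α : ℝ) (n : ℕ) : ℝ := Λ α 1 1 - Λ α n 1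

/-- The matrix `M_n^α`. -/
def M (α b Ω : ℝ) (n : ℕ) : Matrix (Fin 2) (Fin 2) ℝ :=
  !![Ω - Θ α n + b ^ 2 * Λ α 1 b, -b ^ 2 * Λ α n b;
    b * Λ α n b, b * Ω + b ^ (1 - α) * Θ α n - b * Λ α 1 b]

/-- The partial sum up to `n = N` of the `j`-th component of
`(i/2) ∑_{n ≥ 1} (n+1) M_{n+1}^α (a_n, c_n)ᵀ (w^{n+1} - w̄^{n+1})`. -/
def partialSum (α b Ω : ℝ) (a c : ℕ → ℝ) (j : Fin 2) (w : Circle) (N : ℕ) : ℂ :=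
  Complex.I / 2 * ∑ n ∈ Finset.Icc 1 N,
    ((n : ℂ) + 1) * (((M α b Ω (n + 1) *ᵥ ![a n, c n]) j : ℝ) : ℂ) *
      ((w : ℂ) ^ (n + 1) - conj (w : ℂ) ^ (n + 1))

end VState

end

namespace VState

/-! ### The invariant probability measure on the circle -/

/-! Write `D f = w f'(w) = -i d/dη f`. Each component of `G` is the imaginary part of a `flux`: `Ω φ
conj(Dφ)` plus `C_α` times the interaction of `φ` with `φ₂` minus that with `φ₁`, where the
interaction of `φ` and `ψ` is `conj(Dφ(w)) ∫ Dψ(τ) |φ(w) - ψ(τ)|^{-α} dτ` for the normalized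
measure. Real coefficients mean `f(w̄) = conj f(w)`. The flux inherits this symmetry, so its
imaginary part is odd, and an odd `C^{1-α}` function lies in `H` by the Dini test
(`tendsto_sine_series`, `exists_H`). Everything is thereby reduced to Hölder bounds.

These come from one principle (`IsKernel.holderBound`): if a kernel is `O(d^{-α})` and its
increments over a distance `δ` are of order `min(d^{-α}, δ d^{-1-α})`, then it maps bounded
functions to `C^{1-α}`. To differentiate, factor `φ(w) - ψ(τ) = (γw - βτ)(1 + q)` with `q = (f(w) -
g(τ)) / (γw - βτ)`. The quotient `q` is `O(ε)` for perturbations of size `ε`: distinct circles are a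
positive distance apart, and on coinciding circles `f = g` is Lipschitz. Expanding `|1 + q|^{-α} = 1
- α Re q + O(|q|²)` splits the kernel into a base, a linear and a quadratic part, all weakly
singular. Hence the flux minus its linearization `linFlux` is `O(ε²)` in `C^{1-α}`
(`exists_flux_sub_le`), which is differentiability (`hasFDerivAt_toH_flux`).

For the Fourier coefficients of the differential, rotate by `τ = wσ`; the base kernel becomes the
profile `|γ - βσ|^{-α}`, with cosine coefficients `P_n`. The linear part of the kernel produces `|γ
- βσ|^{-α-2}`, which an integration by parts (`integral_profile_by_parts`) removes. The terms in
`P_n` cancel and `(n+1) β (P_1 a_n - P_{n+1} c_n)` is left (`pairing_linInter`).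

Finally `C_α P_n` is a Weber-Schafheitlin integral (`integral_besselIntegrand`): the addition
formula writes `J_n(at) J_n(bt)` as a circle average of `J_0(|a - bσ| t)`, the Gaussian integral of
`J_0` is a Gaussian in `|a - bσ|`, and a Mellin integral in the Gaussian parameter turns it into `|a
- bσ|^{-α}`. -/

noncomputable instance : MeasurableSpace Circle := borel Circle
instance : BorelSpace Circle := ⟨rfl⟩

instance fact_two_pi_pos : Fact (0 < 2 * π) := ⟨Real.two_pi_pos⟩

/-- The rotation invariant probability measure on the unit circle. -/
noncomputable def circ : Measure Circle :=
  Measure.map AddCircle.homeomorphCircle' (AddCircle.haarAddCircle (T := 2 * π))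

lemma measurePreserving_homeomorphCircle' :
    MeasurePreserving AddCircle.homeomorphCircle' (AddCircle.haarAddCircle (T := 2 * π)) circ :=
  ⟨AddCircle.homeomorphCircle'.continuous.measurable, rfl⟩

lemma measurableEmbedding_homeomorphCircle' :
    MeasurableEmbedding (AddCircle.homeomorphCircle' : AddCircle (2 * π) → Circle) :=
  AddCircle.homeomorphCircle'.measurableEmbedding

instance : IsProbabilityMeasure circ :=
  Measure.isProbabilityMeasure_map AddCircle.homeomorphCircle'.continuous.aemeasurable

lemma homeomorphCircle'_add (x y : AddCircle (2 * π)) :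
    AddCircle.homeomorphCircle' (x + y) =
      AddCircle.homeomorphCircle' x * AddCircle.homeomorphCircle' y := by
  induction x using QuotientAddGroup.induction_on
  induction y using QuotientAddGroup.induction_on
  rw [← AddCircle.coe_add]
  simp only [AddCircle.homeomorphCircle'_apply_mk, Circle.exp_add]

lemma homeomorphCircle'_neg (x : AddCircle (2 * π)) :
    AddCircle.homeomorphCircle' (-x) = (AddCircle.homeomorphCircle' x)⁻¹ := by
  induction x using QuotientAddGroup.induction_on
  rw [← AddCircle.coe_neg]
  simp only [AddCircle.homeomorphCircle'_apply_mk, Circle.exp_neg]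

instance : circ.IsMulLeftInvariant := by
  refine ⟨fun u => ?_⟩
  obtain ⟨x, rfl⟩ := AddCircle.homeomorphCircle'.surjective u
  have hm : Measurable (AddCircle.homeomorphCircle' : AddCircle (2 * π) → Circle) :=
    AddCircle.homeomorphCircle'.continuous.measurable
  have : (fun v => AddCircle.homeomorphCircle' x * v) ∘ AddCircle.homeomorphCircle' =
      AddCircle.homeomorphCircle' ∘ (fun y => x + y) := by
    ext1 y; simp [homeomorphCircle'_add]
  rw [circ, Measure.map_map (measurable_const_mul _) hm, this,
    ← Measure.map_map hm (measurable_const_add _), map_add_left_eq_self]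

instance : circ.IsInvInvariant := by
  refine ⟨?_⟩
  have hm : Measurable (AddCircle.homeomorphCircle' : AddCircle (2 * π) → Circle) :=
    AddCircle.homeomorphCircle'.continuous.measurable
  have : Inv.inv ∘ AddCircle.homeomorphCircle' =
      (AddCircle.homeomorphCircle' : AddCircle (2 * π) → Circle) ∘ Neg.neg := by
    ext1 y; simp [homeomorphCircle'_neg]
  rw [Measure.inv, circ, Measure.map_map measurable_inv hm, this,
    ← Measure.map_map hm measurable_neg, Measure.map_neg_eq_self]

lemma integral_circ_eq {E : Type*} [NormedAddCommGroup E] [NormedSpace ℝ E] (t : ℝ)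
    (g : Circle → E) :
    ∫ τ, g τ ∂circ = (2 * π)⁻¹ • ∫ η in t..(t + 2 * π), g (Circle.exp η) := by
  rw [← measurePreserving_homeomorphCircle'.integral_comp measurableEmbedding_homeomorphCircle',
    AddCircle.integral_haarAddCircle, ← AddCircle.intervalIntegral_preimage (2 * π) t]
  simp only [AddCircle.homeomorphCircle'_apply_mk]

lemma integral_circ {E : Type*} [NormedAddCommGroup E] [NormedSpace ℝ E] (g : Circle → E) :
    ∫ τ, g τ ∂circ = (2 * π)⁻¹ • ∫ η in (0 : ℝ)..(2 * π), g (Circle.exp η) := by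
  simpa using integral_circ_eq 0 g

lemma integrable_circ_iff {E : Type*} [NormedAddCommGroup E] (t : ℝ) {g : Circle → E}
    (hg : AEStronglyMeasurable g circ) :
    Integrable g circ ↔ IntegrableOn (fun η => g (Circle.exp η)) (Ioc t (t + 2 * π)) := by
  have hg' : AEStronglyMeasurable
      (g ∘ (AddCircle.homeomorphCircle' : AddCircle (2 * π) → Circle)) volume := by
    rw [AddCircle.volume_eq_smul_haarAddCircle]
    exact (hg.comp_measurePreserving measurePreserving_homeomorphCircle').smul_measure _
  rw [← measurePreserving_homeomorphCircle'.integrable_comp hg]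
  have h : Integrable (g ∘ (AddCircle.homeomorphCircle' : AddCircle (2 * π) → Circle))
      AddCircle.haarAddCircle ↔
      Integrable (g ∘ (AddCircle.homeomorphCircle' : AddCircle (2 * π) → Circle)) volume := by
    rw [AddCircle.volume_eq_smul_haarAddCircle,
      integrable_smul_measure (by simp [Real.pi_pos]) ENNReal.ofReal_ne_top]
  rw [h, ← (AddCircle.measurePreserving_mk (2 * π) t).integrable_comp hg']
  rfl

/-- Kernels are controlled only off the diagonal `τ = w`; this makes the diagonal negligible. -/
instance : NullSingletonClass circ := by
  refine ⟨fun w => ?_⟩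
  obtain ⟨x, rfl⟩ := AddCircle.homeomorphCircle'.surjective w
  rw [circ, measurableEmbedding_homeomorphCircle'.map_apply]
  have h1 : AddCircle.homeomorphCircle' ⁻¹' {AddCircle.homeomorphCircle' x} =
      ({x} : Set (AddCircle (2 * π))) := by
    ext y; simp
  have h2 : volume ({x} : Set (AddCircle (2 * π))) = 0 := by
    rw [← Metric.closedBall_zero, AddCircle.volume_closedBall]
    simp [Real.pi_pos.le]
  rw [AddCircle.volume_eq_smul_haarAddCircle] at h2
  rw [h1]
  simpa [Real.pi_pos.not_ge] using h2

lemma ae_ne_circ (w : Circle) : ∀ᵐ τ ∂circ, w ≠ τ := by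
  filter_upwards [compl_mem_ae_iff.mpr (measure_singleton w)] with τ hτ
  exact fun h => hτ h.symm

/-- Since `dτ = iτ dη`, a factor `τ` remains; it will turn `φ'(τ)` into the tangential derivative `τ
φ'(τ)`. -/
lemma mint_eq (g : Circle → ℂ) : mint g = ∫ τ, g τ * (τ : ℂ) ∂circ := by
  rw [mint, integral_circ, Complex.real_smul]
  have : ∀ η : ℝ, g (Circle.exp η) * (Complex.I * (Circle.exp η : ℂ)) =
      Complex.I * (g (Circle.exp η) * (Circle.exp η : ℂ)) := fun η => by ring
  simp only [this]
  rw [intervalIntegral.integral_const_mul]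
  push_cast
  have hI := Complex.I_ne_zero
  have hp : (π : ℂ) ≠ 0 := by exact_mod_cast Real.pi_ne_zero
  field_simp

/-! ### The metric of the circle -/

lemma dist_eq_norm_coe (w τ : Circle) : dist w τ = ‖(w : ℂ) - τ‖ := dist_eq_norm (w : ℂ) τ

lemma dist_mul_left_circle (u w τ : Circle) : dist (u * w) (u * τ) = dist w τ := by
  rw [dist_eq_norm_coe, dist_eq_norm_coe, Circle.coe_mul, Circle.coe_mul, ← mul_sub, norm_mul,
    Circle.norm_coe, one_mul]

lemma dist_circle_le_two (w τ : Circle) : dist w τ ≤ 2 := by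
  rw [dist_eq_norm_coe]
  refine (norm_sub_le _ _).trans ?_
  rw [Circle.norm_coe, Circle.norm_coe]; norm_num

lemma dist_one_exp (η : ℝ) : dist 1 (Circle.exp η) = 2 * |Real.sin (η / 2)| := by
  rw [dist_comm, dist_eq_norm_coe, Circle.coe_exp, Circle.coe_one, mul_comm,
    Complex.norm_exp_I_mul_ofReal_sub_one, norm_mul, Real.norm_eq_abs, Real.norm_eq_abs]
  norm_num

lemma le_dist_one_exp {η : ℝ} (h : |η| ≤ π) : 2 / π * |η| ≤ dist 1 (Circle.exp η) := by
  have h2 : |η / 2| ≤ π / 2 := by rw [abs_div, abs_two]; linarith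
  have := Real.mul_abs_le_abs_sin h2
  rw [dist_one_exp]
  rw [abs_div, abs_two] at this
  linarith

/-- By Jordan's inequality an arc is at most `π/2` times its chord. This converts bounds in the
angle into bounds in the distance of the circle. -/
lemma exists_exp_mul_eq (w τ : Circle) :
    ∃ η : ℝ, |η| ≤ π / 2 * dist w τ ∧ τ = w * Circle.exp η := by
  refine ⟨Complex.arg ((w⁻¹ * τ : Circle) : ℂ), ?_, ?_⟩
  · have h := le_dist_one_exp (Complex.abs_arg_le_pi ((w⁻¹ * τ : Circle) : ℂ))
    rw [Circle.exp_arg, ← dist_mul_left_circle w, mul_one, mul_inv_cancel_left] at h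
    have hp := Real.pi_pos
    calc |Complex.arg ((w⁻¹ * τ : Circle) : ℂ)|
        = π / 2 * (2 / π * |Complex.arg ((w⁻¹ * τ : Circle) : ℂ)|) := by field_simp
      _ ≤ _ := by gcongr
  · rw [Circle.exp_arg, mul_inv_cancel_left]

end VState

namespace VState

/-! ### Weakly singular kernels -/

/-- The modulus `δ / (d^α (d + δ))`, comparable to `min (d^{-α}) (δ d^{-1-α})`. -/
noncomputable def bump (α δ d : ℝ) : ℝ := δ / (d ^ α * (d + δ))

lemma bump_nonneg {α δ d : ℝ} (hδ : 0 ≤ δ) (hd : 0 ≤ d) : 0 ≤ bump α δ d := by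
  unfold bump; positivity

lemma bump_anti {α δ d d' : ℝ} (hα : 0 ≤ α) (hδ : 0 ≤ δ) (hd : 0 < d) (h : d ≤ d') :
    bump α δ d' ≤ bump α δ d := by
  have := Real.rpow_nonneg (hd.trans_le h).le α
  unfold bump
  gcongr

/-- The modulus is homogeneous of degree `-α` in `(d, δ)`. This reduces every `δ` to `1` and is the
source of the power `δ ^ (1 - α)`. -/
lemma bump_scale {α δ c x : ℝ} (hδ : 0 < δ) (hc : 0 < c) (hx : 0 < x) :
    bump α δ (c * x) = δ ^ (-α) * bump α 1 (c / δ * x) := by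
  unfold bump
  have h1 : (c / δ * x) ^ α = (c * x) ^ α * δ ^ (-α) := by
    rw [show c / δ * x = (c * x) * δ⁻¹ by field_simp, Real.mul_rpow (by positivity) (by positivity),
      Real.inv_rpow hδ.le, Real.rpow_neg hδ.le]
  rw [h1]
  have := Real.rpow_pos_of_pos hδ (-α)
  have := Real.rpow_pos_of_pos (mul_pos hc hx) α
  field_simp

lemma measurable_bump {α δ : ℝ} : Measurable (bump α δ) := by
  unfold bump; fun_prop

/-- The modulus behaves like `x^{-α}` at `0` and like `x^{-α-1}` at infinity, and both are
integrable for `0 < α < 1`. -/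
lemma integrableOn_bump_one {α : ℝ} (hα : α ∈ Ioo (0 : ℝ) 1) : IntegrableOn (bump α 1) (Ioi 0) := by
  rw [← Ioc_union_Ioi_eq_Ioi (zero_le_one (α := ℝ)), integrableOn_union]
  have h0 := hα.1
  constructor
  · have h : IntegrableOn (fun x : ℝ => x ^ (-α)) (Ioc 0 1) :=
      (intervalIntegrable_iff_integrableOn_Ioc_of_le zero_le_one).mp
        (intervalIntegral.intervalIntegrable_rpow' (by linarith [hα.2]))
    refine Integrable.mono' h measurable_bump.aestronglyMeasurable ?_
    filter_upwards [ae_restrict_mem measurableSet_Ioc] with x hx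
    have hx0 : 0 < x := hx.1
    rw [Real.norm_of_nonneg (bump_nonneg zero_le_one hx0.le), Real.rpow_neg hx0.le, bump, ← one_div]
    have := Real.rpow_pos_of_pos hx0 α
    gcongr
    nlinarith
  · have h : IntegrableOn (fun x : ℝ => x ^ (-α - 1)) (Ioi 1) :=
      integrableOn_Ioi_rpow_of_lt (by linarith) zero_lt_one
    refine Integrable.mono' h measurable_bump.aestronglyMeasurable ?_
    filter_upwards [ae_restrict_mem measurableSet_Ioi] with x hx
    have hx0 : (0 : ℝ) < x := zero_lt_one.trans hx
    rw [Real.norm_of_nonneg (bump_nonneg zero_le_one hx0.le), Real.rpow_sub_one hx0.ne',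
      Real.rpow_neg hx0.le, bump, ← one_div, div_div]
    have := Real.rpow_pos_of_pos hx0 α
    gcongr
    linarith

/-- The constant in the estimate of the integral of the modulus over the circle. -/
noncomputable def bumpConst (α : ℝ) : ℝ := ∫ x in Ioi 0, bump α 1 x

lemma bumpConst_nonneg (α : ℝ) : 0 ≤ bumpConst α :=
  setIntegral_nonneg measurableSet_Ioi fun _ hx => bump_nonneg zero_le_one (le_of_lt hx)

lemma integrableOn_bump_mul {α δ c : ℝ} (hα : α ∈ Ioo (0 : ℝ) 1) (hδ : 0 < δ) (hc : 0 < c) :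
    IntegrableOn (fun x => bump α δ (c * x)) (Ioi 0) ∧
      ∫ x in Ioi 0, bump α δ (c * x) = δ ^ (1 - α) / c * bumpConst α := by
  have hcd : 0 < c / δ := by positivity
  have e : EqOn (fun x => bump α δ (c * x)) (fun x => δ ^ (-α) * bump α 1 (c / δ * x)) (Ioi 0) :=
    fun x hx => bump_scale hδ hc hx
  constructor
  · rw [integrableOn_congr_fun e measurableSet_Ioi]
    refine Integrable.const_mul ?_ _
    have := (integrableOn_Ioi_comp_mul_left_iff (bump α 1) 0 hcd).mpr
      (by simpa using integrableOn_bump_one hα)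
    exact this
  · rw [setIntegral_congr_fun measurableSet_Ioi e, integral_const_mul,
      integral_comp_mul_left_Ioi (bump α 1) 0 hcd, mul_zero, ← bumpConst, smul_eq_mul,
      Real.rpow_sub hδ, Real.rpow_neg hδ.le, Real.rpow_one]
    have := Real.rpow_pos_of_pos hδ α
    field_simp

lemma measurable_dist_circle (w : Circle) : Measurable fun τ : Circle => dist w τ :=
  (continuous_const.dist continuous_id).measurable

lemma _root_.MeasureTheory.IntegrableOn.integrable_comp_abs {f : ℝ → ℝ}
    (hf : IntegrableOn f (Ioi 0)) : Integrable fun x => f |x| := by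
  have h1 : IntegrableOn (fun x => f |x|) (Ioi 0) :=
    hf.congr_fun (fun x hx => by rw [abs_of_pos hx]) measurableSet_Ioi
  have h2 : IntegrableOn (fun x => f |x|) (Iio 0) := by
    have h3 : IntegrableOn (fun x => f (-x)) (Iio 0) := by
      have := (Measure.measurePreserving_neg (volume : Measure ℝ)).integrableOn_comp_preimage
        (Homeomorph.neg ℝ).measurableEmbedding (f := f) (s := Ioi 0)
      simpa [Function.comp_def] using this.mpr hf
    exact h3.congr_fun (fun x hx => by rw [abs_of_neg hx]) measurableSet_Iio
  rw [← integrableOn_univ, ← Iio_union_Ici (a := (0 : ℝ)), integrableOn_union,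
    integrableOn_Ici_iff_integrableOn_Ioi]
  exact ⟨h2, h1⟩

/-- The modulus decreases with the distance and the chord is at least `2/π` times the angle, so the
integral is dominated by one over the whole line, where scaling is exact. -/
lemma integrable_bump_dist_one {α δ : ℝ} (hα : α ∈ Ioo (0 : ℝ) 1) (hδ : 0 < δ) :
    Integrable (fun τ : Circle => bump α δ (dist 1 τ)) circ ∧
      ∫ τ : Circle, bump α δ (dist 1 τ) ∂circ ≤ bumpConst α * δ ^ (1 - α) := by
  have hp := Real.pi_pos
  have hc : 0 < 2 / π := by positivity
  obtain ⟨h1, h2⟩ := integrableOn_bump_mul hα hδ hc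
  have h1' : Integrable (fun η : ℝ => bump α δ (2 / π * |η|)) :=
    h1.integrable_comp_abs
  have hle : ∀ᵐ η ∂(volume.restrict (Ioc (-π) (-π + 2 * π))),
      ‖bump α δ (dist 1 (Circle.exp η))‖ ≤ bump α δ (2 / π * |η|) := by
    have : ∀ᵐ η : ℝ ∂(volume.restrict (Ioc (-π) (-π + 2 * π))), η ≠ 0 := by
      filter_upwards [compl_mem_ae_iff.mpr (measure_singleton (0 : ℝ))] with η hη using hη
    filter_upwards [ae_restrict_mem measurableSet_Ioc, this] with η hη hη0
    have : |η| ≤ π := abs_le.mpr ⟨hη.1.le, by linarith [hη.2]⟩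
    rw [Real.norm_of_nonneg (bump_nonneg hδ.le dist_nonneg)]
    exact bump_anti hα.1.le hδ.le (by positivity) (le_dist_one_exp this)
  have hm : AEStronglyMeasurable (fun τ : Circle => bump α δ (dist 1 τ)) circ :=
    (measurable_bump.comp (measurable_dist_circle 1)).aestronglyMeasurable
  have hI : Integrable (fun τ : Circle => bump α δ (dist 1 τ)) circ := by
    rw [integrable_circ_iff (-π) hm]
    refine Integrable.mono' h1'.integrableOn ?_ hle
    exact (measurable_bump.comp ((measurable_dist_circle 1).comp
      Circle.exp.continuous.measurable)).aestronglyMeasurable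
  refine ⟨hI, ?_⟩
  rw [integral_circ_eq (-π), smul_eq_mul, intervalIntegral.integral_of_le (by linarith)]
  calc (2 * π)⁻¹ * ∫ η in Ioc (-π) (-π + 2 * π), bump α δ (dist 1 (Circle.exp η))
      ≤ (2 * π)⁻¹ * ∫ η in Ioc (-π) (-π + 2 * π), bump α δ (2 / π * |η|) := by
        gcongr ?_ * ?_
        refine integral_mono_ae ((integrable_circ_iff (-π) hm).mp hI) h1'.integrableOn ?_
        filter_upwards [hle] with η hη using (le_abs_self _).trans hη
    _ ≤ (2 * π)⁻¹ * ∫ η, bump α δ (2 / π * |η|) := by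
        gcongr ?_ * ?_
        exact setIntegral_le_integral h1' (ae_of_all _ fun η => bump_nonneg hδ.le (by positivity))
    _ = (2 * π)⁻¹ * (2 * (δ ^ (1 - α) / (2 / π) * bumpConst α)) := by
        rw [integral_comp_abs (f := fun x => bump α δ (2 / π * x)), h2]
    _ = 1 / 2 * (bumpConst α * δ ^ (1 - α)) := by field_simp
    _ ≤ _ := by
        have := mul_nonneg (bumpConst_nonneg α) (Real.rpow_nonneg hδ.le (1 - α))
        linarith

lemma dist_eq_dist_one (w τ : Circle) : dist w τ = dist 1 (w⁻¹ * τ) := by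
  rw [← dist_mul_left_circle w 1, mul_one, mul_inv_cancel_left]

lemma integrable_bump_dist {α δ : ℝ} (hα : α ∈ Ioo (0 : ℝ) 1) (hδ : 0 < δ) (w : Circle) :
    Integrable (fun τ : Circle => bump α δ (dist w τ)) circ := by
  simp_rw [dist_eq_dist_one w]
  exact (integrable_bump_dist_one hα hδ).1.comp_mul_left w⁻¹

lemma integral_bump_dist_le {α δ : ℝ} (hα : α ∈ Ioo (0 : ℝ) 1) (hδ : 0 < δ) (w : Circle) :
    ∫ τ : Circle, bump α δ (dist w τ) ∂circ ≤ bumpConst α * δ ^ (1 - α) := by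
  simp_rw [dist_eq_dist_one w]
  rw [integral_mul_left_eq_self (fun τ => bump α δ (dist 1 τ))]
  exact (integrable_bump_dist_one hα hδ).2

/-- With `δ = 2`, the diameter of the circle, `d + δ ≤ 2δ`; thus bounds for integrals of `d ^ (-α)`
are a special case of those for the modulus. -/
lemma rpow_neg_le_bump {α d : ℝ} (hd : 0 ≤ d) (hd2 : d ≤ 2) :
    d ^ (-α) ≤ 2 * bump α 2 d := by
  rw [Real.rpow_neg hd, bump, ← one_div]
  rcases hd.eq_or_lt with rfl | hd
  · rcases eq_or_ne ((0 : ℝ) ^ α) 0 with h | h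
    · simp [h]
    · rw [show (2:ℝ) * (2 / (0 ^ α * (0 + 2))) = 2 * (1 / 0 ^ α) by field_simp; ring]
      have : 0 ≤ 1 / (0 : ℝ) ^ α := by positivity
      linarith
  · have := Real.rpow_pos_of_pos hd α
    rw [← mul_div_assoc, div_le_div_iff₀ (by positivity) (by positivity)]
    nlinarith

lemma integrable_dist_rpow {α : ℝ} (hα : α ∈ Ioo (0 : ℝ) 1) (w : Circle) :
    Integrable (fun τ : Circle => dist w τ ^ (-α)) circ := by
  refine Integrable.mono' ((integrable_bump_dist hα two_pos w).const_mul 2) ?_ ?_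
  · exact ((measurable_dist_circle w).pow_const _).aestronglyMeasurable
  · refine ae_of_all _ fun τ => ?_
    rw [Real.norm_of_nonneg (by positivity)]
    exact rpow_neg_le_bump dist_nonneg (dist_circle_le_two w τ)

lemma integral_dist_rpow_le {α : ℝ} (hα : α ∈ Ioo (0 : ℝ) 1) (w : Circle) :
    ∫ τ : Circle, dist w τ ^ (-α) ∂circ ≤ 4 * bumpConst α := by
  calc ∫ τ : Circle, dist w τ ^ (-α) ∂circ ≤ ∫ τ : Circle, 2 * bump α 2 (dist w τ) ∂circ :=
        integral_mono (integrable_dist_rpow hα w) ((integrable_bump_dist hα two_pos w).const_mul 2)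
          fun τ => rpow_neg_le_bump dist_nonneg (dist_circle_le_two w τ)
    _ ≤ 2 * (bumpConst α * 2 ^ (1 - α)) := by
        rw [integral_const_mul]
        gcongr
        exact integral_bump_dist_le hα two_pos w
    _ ≤ 2 * (bumpConst α * 2 ^ (1 : ℝ)) := by
        have := bumpConst_nonneg α
        gcongr
        · norm_num
        · linarith [hα.1]
    _ = _ := by rw [Real.rpow_one]; ring

/-- A weakly singular kernel on the circle, of order `α` and size `A`. -/
structure IsKernel (α A : ℝ) (K : Circle → Circle → ℂ) : Prop where
  measurable : ∀ w, Measurable (K w)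
  bound : ∀ w τ, w ≠ τ → ‖K w τ‖ ≤ A * dist w τ ^ (-α)
  diff : ∀ w w' τ, w ≠ τ → w' ≠ τ →
    ‖K w τ - K w' τ‖ ≤ A * (bump α (dist w w') (dist w τ) + bump α (dist w w') (dist w' τ))

/-- A function of size and of Hölder seminorm of exponent `1 - α` at most `A`. -/
structure HolderBound (α A : ℝ) (u : Circle → ℂ) : Prop where
  bound : ∀ w, ‖u w‖ ≤ A
  diff : ∀ w w', ‖u w - u w'‖ ≤ A * dist w w' ^ (1 - α)

/-- The integral operator with kernel `K`. -/
noncomputable def kint (K : Circle → Circle → ℂ) (g : Circle → ℂ) (w : Circle) : ℂ :=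
  ∫ τ, K w τ * g τ ∂circ

variable {α A B : ℝ} {K : Circle → Circle → ℂ} {g : Circle → ℂ}

lemma IsKernel.integrable (hα : α ∈ Ioo (0 : ℝ) 1) (hK : IsKernel α A K) (hg : Measurable g)
    (hB : ∀ w, ‖g w‖ ≤ B) (w : Circle) : Integrable (fun τ => K w τ * g τ) circ := by
  refine Integrable.mono' (((integrable_dist_rpow hα w).const_mul A).mul_const B)
    ((hK.measurable w).mul hg).aestronglyMeasurable ?_
  filter_upwards [ae_ne_circ w] with τ hτ
  rw [norm_mul]
  have := hK.bound w τ hτ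
  gcongr
  · exact (norm_nonneg _).trans this
  · exact hB τ

/-- No cancellation is used: the size follows from `∫ d^{-α} < ∞`, and the increments from the fact
that the modulus with `δ = dist w w'` has integral `O(δ ^ (1 - α))`. The size needs the constant
`4`, the increments only `2`. -/
lemma IsKernel.holderBound (hα : α ∈ Ioo (0 : ℝ) 1) (hA : 0 ≤ A) (hK : IsKernel α A K)
    (hg : Measurable g) (hB : ∀ w, ‖g w‖ ≤ B) :
    HolderBound α (4 * bumpConst α * A * B) (kint K g) := by
  have hB0 : 0 ≤ B := (norm_nonneg _).trans (hB 1)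
  have hc := bumpConst_nonneg α
  constructor
  · intro w
    calc ‖kint K g w‖ ≤ ∫ τ, A * dist w τ ^ (-α) * B ∂circ := by
          refine norm_integral_le_of_norm_le
            (((integrable_dist_rpow hα w).const_mul A).mul_const B) ?_
          filter_upwards [ae_ne_circ w] with τ hτ
          rw [norm_mul]
          have := hK.bound w τ hτ
          gcongr
          exact hB τ
      _ = A * (∫ τ, dist w τ ^ (-α) ∂circ) * B := by
          rw [integral_mul_const, integral_const_mul]
      _ ≤ A * (4 * bumpConst α) * B := by
          gcongr
          exact integral_dist_rpow_le hα w
      _ = _ := by ring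
  · intro w w'
    rcases eq_or_ne w w' with rfl | hne
    · simp only [sub_self, norm_zero]; positivity
    have hδ : 0 < dist w w' := dist_pos.mpr hne
    set δ := dist w w' with hδ_def
    have hi := (integrable_bump_dist hα hδ w).add (integrable_bump_dist hα hδ w')
    calc ‖kint K g w - kint K g w'‖
        = ‖∫ τ, (K w τ - K w' τ) * g τ ∂circ‖ := by
          rw [kint, kint, ← integral_sub (hK.integrable hα hg hB w) (hK.integrable hα hg hB w')]
          simp only [sub_mul]
      _ ≤ ∫ τ, A * (bump α δ (dist w τ) + bump α δ (dist w' τ)) * B ∂circ := by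
          refine norm_integral_le_of_norm_le ((hi.const_mul A).mul_const B) ?_
          filter_upwards [ae_ne_circ w, ae_ne_circ w'] with τ hτ hτ'
          rw [norm_mul]
          have := hK.diff w w' τ hτ hτ'
          gcongr
          · exact (norm_nonneg _).trans this
          · exact hB τ
      _ = A * ((∫ τ, bump α δ (dist w τ) ∂circ) + ∫ τ, bump α δ (dist w' τ) ∂circ) * B := by
          rw [integral_mul_const, integral_const_mul, integral_add
            (integrable_bump_dist hα hδ w) (integrable_bump_dist hα hδ w')]
      _ ≤ A * (bumpConst α * δ ^ (1 - α) + bumpConst α * δ ^ (1 - α)) * B := by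
          gcongr
          · exact integral_bump_dist_le hα hδ w
          · exact integral_bump_dist_le hα hδ w'
      _ = 2 * bumpConst α * A * B * δ ^ (1 - α) := by ring
      _ ≤ _ := by
          gcongr
          norm_num

end VState

namespace VState

/-! ### Fourier coefficients on the circle -/

/-- Rotation by `e^{iπ/k}` preserves the integral and changes the sign of the integrand. -/
lemma integral_circ_zpow (k : ℤ) (hk : k ≠ 0) : ∫ τ : Circle, (τ : ℂ) ^ k ∂circ = 0 := by
  have h := integral_mul_left_eq_self (μ := circ) (fun τ : Circle => (τ : ℂ) ^ k)
    (Circle.exp (π / k))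
  have hk' : (k : ℂ) ≠ 0 := by exact_mod_cast hk
  have h1 : ((Circle.exp (π / k) : Circle) : ℂ) ^ k = -1 := by
    rw [Circle.coe_exp, ← Complex.exp_int_mul]
    push_cast
    rw [show (k : ℂ) * ((π : ℂ) / k * Complex.I) = π * Complex.I by field_simp, Complex.exp_pi_mul_I]
  simp only [Circle.coe_mul, mul_zpow, h1, integral_const_mul] at h
  linear_combination (-1 / 2 : ℂ) * h

lemma continuous_circle_coe : Continuous fun τ : Circle => (τ : ℂ) := continuous_induced_dom

lemma continuous_circle_zpow (k : ℤ) : Continuous fun τ : Circle => (τ : ℂ) ^ k := by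
  simp_rw [← Circle.coe_zpow]
  exact continuous_circle_coe.comp (continuous_zpow k)

lemma norm_circle_zpow (τ : Circle) (k : ℤ) : ‖(τ : ℂ) ^ k‖ = 1 := by
  rw [norm_zpow, Circle.norm_coe, one_zpow]

lemma integrable_mul_zpow {q : Circle → ℂ} (hq : Integrable q circ) (k : ℤ) :
    Integrable (fun τ => q τ * (τ : ℂ) ^ k) circ :=
  hq.mul_bdd (c := 1) (continuous_circle_zpow k).aestronglyMeasurable
    (ae_of_all _ fun τ => (norm_circle_zpow τ k).le)

/-- The Riemann-Lebesgue lemma, transferred from the line by extending one period by zero. -/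
lemma tendsto_integral_zpow (q : Circle → ℂ) :
    Tendsto (fun k : ℤ => ∫ τ, q τ * (τ : ℂ) ^ k ∂circ) cofinite (𝓝 0) := by
  have hp := Real.pi_pos
  have h0 := Real.tendsto_integral_exp_smul_cocompact
    ((Ioc (0 : ℝ) (2 * π)).indicator fun η => q (Circle.exp η))
  have h1 : Tendsto (fun k : ℤ => -(k : ℝ) * (2 * π)⁻¹) cofinite (cocompact ℝ) := by
    have e : (-(2 * π)⁻¹ : ℝ) ≠ 0 := by simp [hp.ne']
    have := (Homeomorph.mulRight₀ _ e).isClosedEmbedding.tendsto_cocompact.comp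
      Int.tendsto_coe_cofinite
    refine this.congr fun k => ?_
    simp
  have h2 := (h0.comp h1).const_smul ((2 * π)⁻¹ : ℝ)
  rw [smul_zero] at h2
  refine h2.congr fun k => ?_
  rw [integral_circ, intervalIntegral.integral_of_le (by positivity),
    ← integral_indicator measurableSet_Ioc]
  congr 1
  refine integral_congr_ae (ae_of_all _ fun η => ?_)
  simp only [indicator]
  split_ifs
  · rw [Circle.smul_def, fourierChar_apply, smul_eq_mul, mul_comm, Circle.coe_exp,
      ← Complex.exp_int_mul]
    congr 2
    have : (π : ℂ) ≠ 0 := by exact_mod_cast hp.ne'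
    push_cast
    field_simp
  · simp

lemma HolderBound.continuous {α A : ℝ} (hα : α ∈ Ioo (0 : ℝ) 1) {u : Circle → ℂ}
    (hu : HolderBound α A u) : Continuous u := by
  rw [continuous_iff_continuousAt]
  intro w
  rw [ContinuousAt, tendsto_iff_norm_sub_tendsto_zero]
  refine squeeze_zero (fun _ => norm_nonneg _) (fun w' => hu.diff w' w) ?_
  have h : Continuous fun w' : Circle => A * dist w' w ^ (1 - α) := by
    refine continuous_const.mul ((continuous_id.dist continuous_const).rpow_const fun _ => ?_)
    exact Or.inr (by linarith [hα.2])
  have := h.tendsto w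
  simpa [Real.zero_rpow (by linarith [hα.2] : 1 - α ≠ 0)] using this

lemma integrable_circ_of_continuous {u : Circle → ℂ} (hu : Continuous u) : Integrable u circ :=
  hu.integrable_of_hasCompactSupport (HasCompactSupport.of_compactSpace u)

lemma integral_circ_inv {E : Type*} [NormedAddCommGroup E] [NormedSpace ℝ E] (u : Circle → E) :
    ∫ τ, u τ⁻¹ ∂circ = ∫ τ, u τ ∂circ := integral_inv_eq_self u circ

/-- The coefficients of the sine series of an odd function on the circle. -/
noncomputable def sineCoeff (g : Circle → ℝ) (n : ℕ) : ℝ := -2 * ∫ τ, g τ * ((τ : ℂ) ^ n).im ∂circ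

lemma integral_odd_mul_zpow {f : Circle → ℂ} (hodd : ∀ w, f w⁻¹ = -f w) (n : ℤ) :
    ∫ τ, f τ * (τ : ℂ) ^ (-n) ∂circ = -∫ τ, f τ * (τ : ℂ) ^ n ∂circ := by
  rw [← integral_circ_inv, ← integral_neg]
  refine integral_congr_ae (ae_of_all _ fun τ => ?_)
  simp [hodd]

lemma sineCoeff_eq {g : Circle → ℝ} (hg : Continuous g) (hodd : ∀ w, g w⁻¹ = -g w) (n : ℕ) :
    (sineCoeff g n : ℂ) = -2 * Complex.I * ∫ τ, (g τ : ℂ) * (τ : ℂ) ^ (-(n : ℤ)) ∂circ := by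
  have hodd' : ∀ w, (g w⁻¹ : ℂ) = -(g w : ℂ) := fun w => by rw [hodd]; push_cast; rfl
  have h1 := integral_odd_mul_zpow (f := fun w => (g w : ℂ)) hodd' n
  have hc : Continuous fun τ => (g τ : ℂ) := Complex.continuous_ofReal.comp hg
  have hi : ∀ k : ℤ, Integrable (fun τ => (g τ : ℂ) * (τ : ℂ) ^ k) circ := fun k =>
    integrable_circ_of_continuous (hc.mul (continuous_circle_zpow k))
  have h2 : ∀ τ : Circle, ((g τ * ((τ : ℂ) ^ n).im : ℝ) : ℂ) = (2 * Complex.I)⁻¹ *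
      ((g τ : ℂ) * (τ : ℂ) ^ (n : ℤ) - (g τ : ℂ) * (τ : ℂ) ^ (-(n : ℤ))) := by
    intro τ
    have h3 : (τ : ℂ) ^ (-(n : ℤ)) = conj ((τ : ℂ) ^ n) := by
      rw [zpow_neg, ← inv_zpow, ← Circle.coe_inv, Circle.coe_inv_eq_conj, zpow_natCast, map_pow]
    rw [h3, zpow_natCast, ← mul_sub, Complex.sub_conj]
    push_cast
    have := Complex.I_ne_zero
    field_simp
  rw [sineCoeff, Complex.ofReal_mul, ← integral_complex_ofReal]
  simp only [h2]
  rw [integral_const_mul, integral_sub (hi _) (hi _), ← neg_eq_iff_eq_neg.mpr h1]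
  have := Complex.I_ne_zero
  field_simp
  push_cast
  rw [Complex.I_sq]
  ring

/-- The Dini test: the sine series of an odd Hölder function converges to the function. -/
lemma tendsto_sine_series {α A : ℝ} (hα : α ∈ Ioo (0 : ℝ) 1) {g : Circle → ℝ}
    (hg : HolderBound α A fun w => (g w : ℂ)) (hodd : ∀ w, g w⁻¹ = -g w) (w : Circle) :
    Tendsto (fun N : ℕ => Complex.I / 2 * ∑ n ∈ Finset.Icc 1 N,
      (sineCoeff g n : ℂ) * ((w : ℂ) ^ n - conj (w : ℂ) ^ n)) atTop (𝓝 (g w)) := by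
  have hodd' : ∀ w, (g w⁻¹ : ℂ) = -(g w : ℂ) := fun w => by rw [hodd]; push_cast; rfl
  have hcont := hg.continuous hα
  have hgc : Continuous g := by
    simpa [Function.comp_def] using Complex.continuous_re.comp hcont
  have hw0 : (w : ℂ) ≠ 0 := Circle.coe_ne_zero w
  set F : ℤ → ℂ := fun k => ∫ τ, (g τ : ℂ) * (τ : ℂ) ^ k ∂circ with hF
  have hFneg : ∀ k, F (-k) = -F k := integral_odd_mul_zpow hodd'
  -- The Hölder bound makes this difference quotient `O(d^{-α})`, hence integrable: this is Dini's
  -- condition.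
  set q : Circle → ℂ := fun τ => ((g τ : ℂ) - g w) / ((τ : ℂ) - w) with hq
  have hqi : Integrable q circ := by
    refine Integrable.mono' ((integrable_dist_rpow hα w).const_mul A) ?_ ?_
    · exact ((hcont.sub continuous_const).measurable.div
        (continuous_circle_coe.sub continuous_const).measurable).aestronglyMeasurable
    · filter_upwards [ae_ne_circ w] with τ hτ
      have hd : 0 < dist τ w := dist_pos.mpr hτ.symm
      rw [hq, norm_div, ← dist_eq_norm_coe, div_le_iff₀ hd, dist_comm w τ, mul_assoc]
      refine (hg.diff τ w).trans_eq ?_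
      congr 1
      nth_rewrite 3 [← Real.rpow_one (dist τ w)]
      rw [← Real.rpow_add hd]
      congr 1
      ring
  set c : ℤ → ℂ := fun k => ∫ τ, q τ * (τ : ℂ) ^ k ∂circ with hc
  -- Multiply `g(τ) - g(w) = q(τ)(τ - w)` by `τ ^ k` and integrate.
  have hkey : ∀ k : ℤ, F k - g w * ∫ τ : Circle, (τ : ℂ) ^ k ∂circ = c (k + 1) - w * c k := by
    intro k
    rw [hF, hc]
    simp only
    rw [← integral_const_mul, ← integral_const_mul]
    refine (integral_sub (integrable_circ_of_continuous (hcont.mul (continuous_circle_zpow k)))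
      (integrable_circ_of_continuous (continuous_const.mul (continuous_circle_zpow k)))).symm.trans
      (Eq.trans ?_ (integral_sub (integrable_mul_zpow hqi _)
        ((integrable_mul_zpow hqi _).const_mul _)))
    refine integral_congr_ae ?_
    filter_upwards [ae_ne_circ w] with τ hτ
    have h1 : (τ : ℂ) - w ≠ 0 := sub_ne_zero.mpr fun h => hτ (Circle.ext h.symm)
    rw [zpow_add_one₀ (Circle.coe_ne_zero τ), hq]
    simp only [Pi.mul_apply]
    field_simp
  have hkey' : ∀ k : ℤ, k ≠ 0 → F k = c (k + 1) - w * c k := fun k hk => by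
    rw [← hkey, integral_circ_zpow k hk]; simp
  have hF0 : F 0 = 0 := by
    have := hFneg 0
    rw [neg_zero] at this
    linear_combination (1 / 2 : ℂ) * this
  -- The index `k = 0` is special: `τ ^ 0` has integral `1` while `g` has mean zero, which recovers
  -- the value `g w`.
  have hgw : (g w : ℂ) = w * c 0 - c 1 := by
    have := hkey 0
    simp only [zpow_zero, integral_const, probReal_univ, one_smul, hF0, zero_add] at this
    linear_combination -this
  -- The partial sums telescope to `g w` and two extreme coefficients of `q`, which tend to zero by
  -- the Riemann-Lebesgue lemma.
  have hsum : ∀ N : ℕ, Complex.I / 2 * ∑ n ∈ Finset.Icc 1 N,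
      (sineCoeff g n : ℂ) * ((w : ℂ) ^ n - conj (w : ℂ) ^ n) =
      g w + (c (N + 1) * (w : ℂ)⁻¹ ^ N - w * c (-N) * (w : ℂ) ^ N) := by
    intro N
    induction N with
    | zero => rw [hgw]; simp
    | succ N ih =>
      rw [Finset.sum_Icc_succ_top (by omega), mul_add, ih, sineCoeff_eq hgc hodd]
      change _ + Complex.I / 2 * (-2 * Complex.I * F (-((N + 1 : ℕ) : ℤ)) * _) = _
      have e1 := hkey' (-((N + 1 : ℕ) : ℤ)) (by omega)
      have e2 := hkey' ((N + 1 : ℕ) : ℤ) (by omega)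
      have e3 := hFneg ((N + 1 : ℕ) : ℤ)
      rw [← Circle.coe_inv_eq_conj, Circle.coe_inv]
      have e4 : (-((N + 1 : ℕ) : ℤ)) + 1 = -(N : ℤ) := by push_cast; ring
      rw [e4] at e1
      have e5 : Complex.I / 2 * (-2 * Complex.I * F (-((N + 1 : ℕ) : ℤ)) *
          ((w : ℂ) ^ (N + 1) - (w : ℂ)⁻¹ ^ (N + 1))) = F (-((N + 1 : ℕ) : ℤ)) * (w : ℂ) ^ (N + 1) +
          F ((N + 1 : ℕ) : ℤ) * (w : ℂ)⁻¹ ^ (N + 1) := by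
        rw [e3]
        linear_combination (-F ((N + 1 : ℕ) : ℤ) * (w : ℂ)⁻¹ ^ (N + 1) +
          F ((N + 1 : ℕ) : ℤ) * (w : ℂ) ^ (N + 1)) * Complex.I_sq
      rw [e5, e1, e2]
      push_cast
      have e6 : (w : ℂ) * (w : ℂ)⁻¹ ^ (N + 1) = (w : ℂ)⁻¹ ^ N := by
        rw [pow_succ]; field_simp
      linear_combination (-c (N + 1)) * e6
  have hlim1 : Tendsto (fun N : ℕ => c (N + 1) * (w : ℂ)⁻¹ ^ N) atTop (𝓝 0) := by
    have h1 : Tendsto (fun N : ℕ => c ((N : ℤ) + 1)) atTop (𝓝 0) := by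
      refine (tendsto_integral_zpow q).comp ?_
      rw [← Nat.cofinite_eq_atTop]
      exact Function.Injective.tendsto_cofinite fun a b h => by simpa using h
    rw [tendsto_zero_iff_norm_tendsto_zero] at h1 ⊢
    simpa [Circle.norm_coe] using h1
  have hlim2 : Tendsto (fun N : ℕ => w * c (-N) * (w : ℂ) ^ N) atTop (𝓝 0) := by
    have h1 : Tendsto (fun N : ℕ => c (-(N : ℤ))) atTop (𝓝 0) := by
      refine (tendsto_integral_zpow q).comp ?_
      rw [← Nat.cofinite_eq_atTop]
      exact Function.Injective.tendsto_cofinite fun a b h => by simpa using h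
    rw [tendsto_zero_iff_norm_tendsto_zero] at h1 ⊢
    simpa [Circle.norm_coe] using h1
  simp only [hsum]
  simpa using (hlim1.sub hlim2).const_add (g w : ℂ)

/-! ### From Hölder bounds to elements of `H` -/

lemma coe_expo {α : ℝ} (hα : α ∈ Ioo (0 : ℝ) 1) : (expo α : ℝ) = 1 - α :=
  Real.coe_toNNReal _ (by linarith [hα.2])

lemma HolderBound.nonneg {α A : ℝ} {u : Circle → ℂ} (hu : HolderBound α A u) : 0 ≤ A :=
  (norm_nonneg _).trans (hu.bound 1)

lemma HolderBound.holderWith {α A : ℝ} (hα : α ∈ Ioo (0 : ℝ) 1) {u : Circle → ℂ}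
    (hu : HolderBound α A u) : HolderWith A.toNNReal (expo α) u := by
  intro w w'
  simp only [edist_nndist]
  rw [← ENNReal.coe_rpow_of_nonneg _ (NNReal.coe_nonneg _),
    ← ENNReal.coe_mul, ENNReal.coe_le_coe, ← NNReal.coe_le_coe]
  push_cast
  rw [coe_expo hα, Real.coe_toNNReal _ hu.nonneg, dist_eq_norm]
  exact hu.diff w w'

/-- An odd real Hölder function is the function of an element of `H`. -/
lemma exists_H {α A : ℝ} (hα : α ∈ Ioo (0 : ℝ) 1) {g : Circle → ℝ}
    (hg : HolderBound α A fun w => (g w : ℂ)) (hodd : ∀ w, g w⁻¹ = -g w) :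
    ∃ u : H α, ∀ w, u w = (g w : ℂ) :=
  ⟨⟨⟨fun w => (g w : ℂ), hg.continuous hα⟩, (hg.holderWith hα).memHolder, sineCoeff g,
    tendsto_sine_series hα hg hodd⟩, fun _ => rfl⟩

/-- Since `toH` takes the default value `0` when no element represents `g`, its values are known
only once existence has been shown. -/
lemma toH_apply {α : ℝ} {g : Circle → ℝ} (h : ∃ u : H α, ∀ w, u w = (g w : ℂ)) (w : Circle) :
    toH α g w = g w := by
  rw [toH, dif_pos h]
  exact h.choose_spec w

lemma H.ext {α : ℝ} {u v : H α} (h : ∀ w, u w = v w) : u = v :=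
  Subtype.ext (ContinuousMap.ext h)

lemma H.norm_le {α A : ℝ} (hα : α ∈ Ioo (0 : ℝ) 1) {u : H α} (hu : HolderBound α A u) :
    ‖u‖ ≤ 2 * A := by
  have h1 : ‖u.toC‖ ≤ A := (ContinuousMap.norm_le _ hu.nonneg).mpr hu.bound
  have h2 : (nnHolderNorm (expo α) u : ℝ) ≤ A := by
    have := NNReal.coe_le_coe.mpr (hu.holderWith hα).nnholderNorm_le
    rwa [Real.coe_toNNReal _ hu.nonneg] at this
  rw [H.norm_def]
  linarith

end VState

namespace VState

/-! ### Bessel functions -/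

lemma two_mul_I_mul_im (z : ℂ) : Complex.I * (z.im : ℂ) = z / 2 - conj z / 2 := by
  have := Complex.sub_conj z
  push_cast at this
  linear_combination (-1 / 2 : ℂ) * this

/-- The generating function: `exp(it Im τ) = exp(tτ/2) exp(-tτ⁻¹/2)`. Expanding both exponentials
and integrating termwise, only the terms whose total power of `τ` is zero survive. -/
lemma hasSum_besselJ_prod (n : ℕ) (t : ℝ) :
    HasSum (fun i : ℕ × ℕ => if i.1 = i.2 + n then
      ((t / 2 : ℝ) : ℂ) ^ i.1 / i.1.factorial * ((-(t / 2) : ℝ) : ℂ) ^ i.2 / i.2.factorial else 0)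
      (∫ τ : Circle, Complex.exp (Complex.I * ((t * (τ : ℂ).im : ℝ) : ℂ)) *
        (τ : ℂ) ^ (-(n : ℤ)) ∂circ) := by
  set s : ℝ := t / 2 with hs
  set F : ℕ × ℕ → Circle → ℂ := fun i τ =>
    ((s : ℂ) ^ i.1 / i.1.factorial * ((-s : ℝ) : ℂ) ^ i.2 / i.2.factorial) *
      (τ : ℂ) ^ ((i.1 : ℤ) - i.2 - n) with hF
  have hnorm : ∀ i τ, ‖F i τ‖ = |s| ^ i.1 / i.1.factorial * (|s| ^ i.2 / i.2.factorial) := by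
    intro i τ
    simp only [hF, norm_mul, norm_div, norm_pow, norm_circle_zpow, Complex.norm_real, norm_neg,
      Complex.norm_natCast, Real.norm_eq_abs, mul_one]
    ring
  have hsum0 : Summable fun i : ℕ × ℕ =>
      |s| ^ i.1 / i.1.factorial * (|s| ^ i.2 / i.2.factorial) :=
    summable_mul_of_summable_norm (f := fun j : ℕ => |s| ^ j / j.factorial)
      (g := fun j : ℕ => |s| ^ j / j.factorial)
      (by simpa using Real.summable_pow_div_factorial |s|)
      (by simpa using Real.summable_pow_div_factorial |s|)
  have hint : ∀ i, Integrable (F i) circ := fun i =>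
    integrable_circ_of_continuous (continuous_const.mul (continuous_circle_zpow _))
  have h := hasSum_integral_of_summable_integral_norm hint (by simpa [hnorm] using hsum0)
  have h1 : ∀ τ : Circle, ∑' i, F i τ = Complex.exp (Complex.I * ((t * (τ : ℂ).im : ℝ) : ℂ)) *
      (τ : ℂ) ^ (-(n : ℤ)) := by
    intro τ
    have e1 := NormedSpace.expSeries_div_hasSum_exp ((s : ℂ) * τ)
    have e2 := NormedSpace.expSeries_div_hasSum_exp (((-s : ℝ) : ℂ) * (τ : ℂ)⁻¹)
    have hs1 : Summable fun i : ℕ × ℕ => ((s : ℂ) * τ) ^ i.1 / (i.1.factorial : ℂ) *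
        ((((-s : ℝ) : ℂ) * (τ : ℂ)⁻¹) ^ i.2 / (i.2.factorial : ℂ)) := by
      refine Summable.of_norm (hsum0.congr fun i => ?_)
      simp [Circle.norm_coe]
    have e3 := (e1.mul e2 hs1).mul_right ((τ : ℂ) ^ (-(n : ℤ)))
    have e4 : NormedSpace.exp ((s : ℂ) * τ) * NormedSpace.exp (((-s : ℝ) : ℂ) * (τ : ℂ)⁻¹) =
        Complex.exp (Complex.I * ((t * (τ : ℂ).im : ℝ) : ℂ)) := by
      rw [← Complex.exp_eq_exp_ℂ, ← Complex.exp_add]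
      congr 1
      have := two_mul_I_mul_im (τ : ℂ)
      rw [← Circle.coe_inv_eq_conj, Circle.coe_inv] at this
      rw [hs]
      push_cast
      linear_combination (-t : ℂ) * this
    rw [e4] at e3
    rw [← e3.tsum_eq]
    refine tsum_congr fun i => ?_
    have hτ := Circle.coe_ne_zero τ
    simp only [hF]
    rw [mul_pow, mul_pow, zpow_sub₀ hτ, zpow_sub₀ hτ, zpow_neg, zpow_natCast, zpow_natCast, inv_pow,
      zpow_natCast]
    field_simp
  simp only [h1] at h
  refine h.congr_fun fun i => ?_
  simp only [hF]
  rw [integral_const_mul]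
  split_ifs with hi
  · rw [hi]; simp
  · rw [integral_circ_zpow _ (by omega), mul_zero]

/-- Bessel's integral: the surviving indices `(k + n, k)` run through the power series. It yields
continuity and `|J_n| ≤ 1`. -/
lemma besselJ_eq (n : ℕ) (t : ℝ) :
    (besselJ n t : ℂ) = ∫ τ : Circle, Complex.exp (Complex.I * ((t * (τ : ℂ).im : ℝ) : ℂ)) *
        (τ : ℂ) ^ (-(n : ℤ)) ∂circ := by
  have h := hasSum_besselJ_prod n t
  have hg : Function.Injective fun k : ℕ => (k + n, k) := fun a b h => by simpa using h
  rw [← hg.hasSum_iff] at h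
  · rw [← h.tsum_eq, besselJ, Complex.ofReal_tsum]
    refine tsum_congr fun k => ?_
    simp only [Function.comp_apply, if_true]
    push_cast
    rw [neg_pow ((t : ℂ) / 2), show 2 * k + n = (k + n) + k by ring, pow_add _ (k + n) k, add_comm n k]
    field_simp
  · rintro ⟨j, k⟩ hjk
    rw [if_neg]
    intro hj
    exact hjk ⟨k, Prod.ext hj.symm rfl⟩

lemma norm_exp_I_mul_ofReal' (x : ℝ) : ‖Complex.exp (Complex.I * (x : ℂ))‖ = 1 := by
  rw [mul_comm, Complex.norm_exp_ofReal_mul_I]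

lemma continuous_exp_im : Continuous fun p : ℝ × Circle =>
    Complex.exp (Complex.I * ((p.1 * (p.2 : ℂ).im : ℝ) : ℂ)) := by
  have h := continuous_circle_coe.comp (continuous_snd (X := ℝ) (Y := Circle))
  have h2 : Continuous fun p : ℝ × Circle => p.1 * (p.2 : ℂ).im :=
    continuous_fst.mul (Complex.continuous_im.comp h)
  exact Complex.continuous_exp.comp
    (continuous_const.mul (Complex.continuous_ofReal.comp h2))

lemma continuous_besselJ (n : ℕ) : Continuous (besselJ n) := by
  have h : Continuous fun t : ℝ => (besselJ n t : ℂ) := by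
    simp_rw [besselJ_eq]
    refine continuous_of_dominated (bound := fun _ => 1) (fun t => ?_) (fun t => ?_)
      (integrable_const _) ?_
    · exact ((continuous_exp_im.comp (Continuous.prodMk_right t)).mul
        (continuous_circle_zpow _)).aestronglyMeasurable
    · exact ae_of_all _ fun τ => by rw [norm_mul, norm_exp_I_mul_ofReal', norm_circle_zpow, mul_one]
    · exact ae_of_all _ fun τ => (continuous_exp_im.comp (Continuous.prodMk_left τ)).mul
        continuous_const
  simpa [Function.comp_def] using Complex.continuous_re.comp h

lemma abs_besselJ_le_one (n : ℕ) (t : ℝ) : |besselJ n t| ≤ 1 := by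
  rw [← Real.norm_eq_abs, ← Complex.norm_real, besselJ_eq]
  refine (norm_integral_le_of_norm_le (integrable_const (1 : ℝ)) (ae_of_all _ fun τ => ?_)).trans ?_
  · rw [norm_mul, norm_exp_I_mul_ofReal', norm_circle_zpow, mul_one]
  · simp

/-- The circle average of a plane wave depends only on the modulus of its wave vector, by rotation
invariance. -/
lemma besselJ_zero_norm (z : ℂ) :
    (besselJ 0 ‖z‖ : ℂ) = ∫ τ : Circle, Complex.exp (Complex.I * ((z * τ).im : ℂ)) ∂circ := by
  obtain ⟨u, hu⟩ : ∃ u : Circle, z = ‖z‖ * u := by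
    refine ⟨Circle.exp (Complex.arg z), ?_⟩
    rw [Circle.coe_exp, Complex.norm_mul_exp_arg_mul_I]
  rw [besselJ_eq, ← integral_mul_left_eq_self _ u]
  refine integral_congr_ae (ae_of_all _ fun τ => ?_)
  simp only [Nat.cast_zero, neg_zero, zpow_zero, mul_one, Circle.coe_mul]
  nth_rewrite 2 [hu]
  rw [mul_assoc, Complex.im_ofReal_mul]

/-- A form of the addition theorem of the Bessel functions. -/
lemma besselJ_mul_besselJ (n : ℕ) (a b t : ℝ) :
    ((besselJ n (a * t) * besselJ n (b * t) : ℝ) : ℂ) =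
      ∫ σ : Circle, (σ : ℂ) ^ n * (besselJ 0 (‖(a : ℂ) - b * σ‖ * |t|) : ℂ) ∂circ := by
  -- `J_n` is real, so its integral may be conjugated; the two phases then have opposite signs.
  have hconj : (besselJ n (b * t) : ℂ) = ∫ τ : Circle,
      Complex.exp (-(Complex.I * ((b * t * (τ : ℂ).im : ℝ) : ℂ))) * (τ : ℂ) ^ n ∂circ := by
    rw [← Complex.conj_ofReal, besselJ_eq, ← integral_conj]
    refine integral_congr_ae (ae_of_all _ fun τ => ?_)
    simp only [map_mul, ← Complex.exp_conj, Complex.conj_I, Complex.conj_ofReal, neg_mul]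
    rw [zpow_neg, zpow_natCast, ← inv_pow, map_pow, ← Circle.coe_inv, Circle.coe_inv_eq_conj,
      Complex.conj_conj]
  have hcont : Continuous (Function.uncurry fun (τ σ : Circle) =>
      Complex.exp (Complex.I * ((((a : ℂ) - b * σ) * t * τ).im : ℂ)) * (σ : ℂ) ^ n) := by
    have h1 := continuous_circle_coe.comp (continuous_fst (X := Circle) (Y := Circle))
    have h2 := continuous_circle_coe.comp (continuous_snd (X := Circle) (Y := Circle))
    have h3 : Continuous fun p : Circle × Circle => ((a : ℂ) - b * (p.2 : ℂ)) * t * (p.1 : ℂ) :=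
      ((continuous_const.sub (continuous_const.mul h2)).mul continuous_const).mul h1
    exact (Complex.continuous_exp.comp (continuous_const.mul
      (Complex.continuous_ofReal.comp (Complex.continuous_im.comp h3)))).mul (h2.pow n)
  push_cast
  rw [hconj, besselJ_eq, ← integral_mul_const]
  -- Replace the second variable by `τσ`: the powers of `τ` cancel, the phases combine to `Im((a -
  -- bσ)tτ)`, and integrating in `τ` first produces `J_0`.
  calc _ = ∫ τ : Circle, ∫ σ : Circle,
        Complex.exp (Complex.I * ((((a : ℂ) - b * σ) * t * τ).im : ℂ)) * (σ : ℂ) ^ n ∂circ ∂circ := by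
        refine integral_congr_ae (ae_of_all _ fun τ => ?_)
        simp only
        rw [← integral_mul_left_eq_self _ τ, ← integral_const_mul]
        refine integral_congr_ae (ae_of_all _ fun σ => ?_)
        simp only
        rw [Circle.coe_mul, mul_pow, mul_mul_mul_comm, ← Complex.exp_add, zpow_neg, zpow_natCast,
          inv_mul_cancel_left₀ (pow_ne_zero _ (Circle.coe_ne_zero τ))]
        congr 2
        rw [← sub_eq_add_neg, ← mul_sub, ← Complex.ofReal_sub]
        congr 2
        rw [show ((a : ℂ) - b * σ) * t * τ = ((a * t : ℝ) : ℂ) * τ - ((b * t : ℝ) : ℂ) * (τ * σ) by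
          push_cast; ring, Complex.sub_im, Complex.im_ofReal_mul, Complex.im_ofReal_mul]
    _ = ∫ σ : Circle, ∫ τ : Circle,
        Complex.exp (Complex.I * ((((a : ℂ) - b * σ) * t * τ).im : ℂ)) * (σ : ℂ) ^ n ∂circ ∂circ :=
        integral_integral_swap
          (hcont.integrable_of_hasCompactSupport (HasCompactSupport.of_compactSpace _))
    _ = _ := by
        refine integral_congr_ae (ae_of_all _ fun σ => ?_)
        simp only
        rw [integral_mul_const, mul_comm, ← besselJ_zero_norm, norm_mul, Complex.norm_real,
          Real.norm_eq_abs]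

end VState

/-! ### Gaussian integrals of Bessel functions -/

namespace VState

lemma integral_pow_mul_exp_neg_mul_sq {p : ℝ} (hp : 0 < p) (k : ℕ) :
    IntegrableOn (fun t : ℝ => t ^ (2 * k + 1) * Real.exp (-(p * t ^ 2))) (Ioi 0) ∧
    ∫ t in Ioi (0 : ℝ), t ^ (2 * k + 1) * Real.exp (-(p * t ^ 2)) =
      k.factorial / (2 * p ^ (k + 1)) := by
  have e : (fun t : ℝ => t ^ (2 * k + 1) * Real.exp (-(p * t ^ 2))) =
      fun t : ℝ => t ^ ((2 * k + 1 : ℕ) : ℝ) * Real.exp (-p * t ^ (2 : ℝ)) := by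
    funext t
    rw [Real.rpow_natCast, Real.rpow_two, neg_mul]
  have hq : (-1 : ℝ) < ((2 * k + 1 : ℕ) : ℝ) := by
    have : (0 : ℝ) ≤ ((2 * k + 1 : ℕ) : ℝ) := Nat.cast_nonneg _
    linarith
  rw [e]
  refine ⟨integrableOn_rpow_mul_exp_neg_mul_rpow hq two_pos hp, ?_⟩
  rw [integral_rpow_mul_exp_neg_mul_rpow two_pos hq hp]
  have h1 : (((2 * k + 1 : ℕ) : ℝ) + 1) / 2 = (k : ℝ) + 1 := by push_cast; ring
  have h2 : -(((2 * k + 1 : ℕ) : ℝ) + 1) / 2 = -((k + 1 : ℕ) : ℝ) := by push_cast; ring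
  rw [h1, h2, Real.Gamma_nat_eq_factorial, Real.rpow_neg hp.le, Real.rpow_natCast]
  field_simp

lemma integrableOn_mul_exp_neg_mul_sq {p : ℝ} (hp : 0 < p) :
    IntegrableOn (fun t : ℝ => t * Real.exp (-(p * t ^ 2))) (Ioi 0) := by
  simpa using (integral_pow_mul_exp_neg_mul_sq hp 0).1

/-- Integrate the power series termwise: the Gaussian moment `k! / (2 p ^ (k+1))` cancels one of the
two factorials and leaves the exponential series of `-ρ² / (4p)`. -/
lemma integral_besselJ_zero_mul_exp {p : ℝ} (hp : 0 < p) (ρ : ℝ) :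
    ∫ t in Ioi (0 : ℝ), besselJ 0 (ρ * t) * (t * Real.exp (-(p * t ^ 2))) =
      Real.exp (-(ρ ^ 2 / (4 * p))) / (2 * p) := by
  set F : ℕ → ℝ → ℝ := fun k t => ((-1) ^ k / ((k.factorial : ℝ) * k.factorial) * (ρ / 2) ^ (2 * k)) *
    (t ^ (2 * k + 1) * Real.exp (-(p * t ^ 2))) with hF
  have hint : ∀ k, Integrable (F k) (volume.restrict (Ioi 0)) := fun k =>
    (integral_pow_mul_exp_neg_mul_sq hp k).1.const_mul _
  have hval : ∀ k, ∫ t in Ioi (0 : ℝ), F k t =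
      (-(ρ ^ 2 / (4 * p))) ^ k / k.factorial * (1 / (2 * p)) := by
    intro k
    simp only [hF]
    rw [integral_const_mul, (integral_pow_mul_exp_neg_mul_sq hp k).2,
      neg_pow (ρ ^ 2 / (4 * p)), div_pow, div_pow, pow_mul, mul_pow, pow_mul]
    have := k.factorial_ne_zero
    norm_num
    field_simp
    ring
  -- Absolute values only remove the alternating sign, leaving the convergent series of `exp(ρ² /
  -- (4p))`; this justifies the exchange.
  have hnorm : ∀ k, ∫ t in Ioi (0 : ℝ), ‖F k t‖ =
      (ρ ^ 2 / (4 * p)) ^ k / k.factorial * (1 / (2 * p)) := by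
    intro k
    have : ∀ t ∈ Ioi (0 : ℝ), ‖F k t‖ = (-1) ^ k * F k t := by
      intro t ht
      have ht : (0 : ℝ) < t := ht
      simp only [hF]
      rw [norm_mul, norm_mul, norm_div, norm_pow, norm_neg, norm_one, one_pow, pow_mul (ρ / 2),
        Real.norm_of_nonneg (by positivity : (0 : ℝ) ≤ ((ρ / 2) ^ 2) ^ k),
        Real.norm_of_nonneg (by positivity : (0 : ℝ) ≤ (k.factorial : ℝ) * k.factorial),
        Real.norm_of_nonneg (by positivity : (0 : ℝ) ≤ t ^ (2 * k + 1) * Real.exp (-(p * t ^ 2)))]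
      have : ((-1 : ℝ) ^ k) * (-1) ^ k = 1 := by rw [← mul_pow]; norm_num
      linear_combination (-1 / ((k.factorial : ℝ) * k.factorial) * ((ρ / 2) ^ 2) ^ k *
        (t ^ (2 * k + 1) * Real.exp (-(p * t ^ 2)))) * this
    rw [setIntegral_congr_fun measurableSet_Ioi this, integral_const_mul, hval,
      neg_pow (ρ ^ 2 / (4 * p))]
    have : ((-1 : ℝ) ^ k) * (-1) ^ k = 1 := by rw [← mul_pow]; norm_num
    linear_combination ((ρ ^ 2 / (4 * p)) ^ k / k.factorial * (1 / (2 * p))) * this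
  have hs : Summable fun k => ∫ t in Ioi (0 : ℝ), ‖F k t‖ := by
    simp_rw [hnorm]
    exact (Real.summable_pow_div_factorial _).mul_right _
  have h := hasSum_integral_of_summable_integral_norm hint hs
  have h2 : ∀ t, ∑' k, F k t = besselJ 0 (ρ * t) * (t * Real.exp (-(p * t ^ 2))) := by
    intro t
    rw [besselJ, ← tsum_mul_right]
    refine tsum_congr fun k => ?_
    simp only [hF, zero_add, add_zero]
    rw [mul_div_right_comm, mul_pow]
    ring
  simp only [h2, hval] at h
  have h3 := (NormedSpace.expSeries_div_hasSum_exp (-(ρ ^ 2 / (4 * p)))).mul_right (1 / (2 * p))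
  rw [h.unique h3, ← Real.exp_eq_exp_ℝ]
  ring

lemma continuous_norm_sub_mul (a b : ℝ) : Continuous fun σ : Circle => ‖(a : ℂ) - b * σ‖ :=
  (continuous_const.sub (continuous_const.mul continuous_circle_coe)).norm

/-- Weber's second exponential integral. -/
lemma integral_besselJ_mul_besselJ_mul_exp (n : ℕ) (a b : ℝ) {p : ℝ} (hp : 0 < p) :
    ∫ t in Ioi (0 : ℝ), besselJ n (a * t) * besselJ n (b * t) * (t * Real.exp (-(p * t ^ 2))) =
      ∫ σ : Circle, ((σ : ℂ) ^ n).re *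
        (Real.exp (-(‖(a : ℂ) - b * σ‖ ^ 2 / (4 * p))) / (2 * p)) ∂circ := by
  -- The addition formula reduces the product to `J_0`, whose Gaussian integral is explicit.
  have hJ : ∀ t : ℝ, besselJ n (a * t) * besselJ n (b * t) =
      ∫ σ : Circle, ((σ : ℂ) ^ n).re * besselJ 0 (‖(a : ℂ) - b * σ‖ * |t|) ∂circ := by
    intro t
    have hi : Integrable (fun σ : Circle => (σ : ℂ) ^ n *
        (besselJ 0 (‖(a : ℂ) - b * σ‖ * |t|) : ℂ)) circ :=
      integrable_circ_of_continuous ((continuous_circle_coe.pow n).mul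
        (Complex.continuous_ofReal.comp ((continuous_besselJ 0).comp
          ((continuous_norm_sub_mul a b).mul continuous_const))))
    have h := congrArg Complex.re (besselJ_mul_besselJ n a b t)
    rw [Complex.ofReal_re] at h
    rw [h]
    refine (integral_re hi).symm.trans (integral_congr_ae (ae_of_all _ fun σ => ?_))
    exact Complex.re_mul_ofReal _ _
  set G : ℝ → Circle → ℝ := fun t σ => ((σ : ℂ) ^ n).re * besselJ 0 (‖(a : ℂ) - b * σ‖ * t) *
    (t * Real.exp (-(p * t ^ 2))) with hG
  have hGc : Continuous (Function.uncurry G) := by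
    have h1 := continuous_circle_coe.comp (continuous_snd (X := ℝ) (Y := Circle))
    have h2 := (continuous_norm_sub_mul a b).comp (continuous_snd (X := ℝ) (Y := Circle))
    have h3 : Continuous fun q : ℝ × Circle => q.1 * Real.exp (-(p * q.1 ^ 2)) := by fun_prop
    exact ((Complex.continuous_re.comp (h1.pow n)).mul
      ((continuous_besselJ 0).comp (h2.mul continuous_fst))).mul h3
  -- The bound `|J_0| ≤ 1` and the Gaussian weight make Fubini legitimate, without any decay of
  -- Bessel functions.
  have hGi : Integrable (Function.uncurry G) ((volume.restrict (Ioi 0)).prod circ) := by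
    refine Integrable.mono ((integrableOn_mul_exp_neg_mul_sq hp).mul_prod
      (integrable_const (1 : ℝ))) hGc.aestronglyMeasurable (ae_of_all _ fun q => ?_)
    simp only [hG, Function.uncurry, norm_mul, Real.norm_eq_abs]
    have h1 : |((q.2 : ℂ) ^ n).re| ≤ 1 := by
      refine (Complex.abs_re_le_norm _).trans_eq ?_
      rw [norm_pow, Circle.norm_coe, one_pow]
    have h2 := abs_besselJ_le_one 0 (‖(a : ℂ) - b * q.2‖ * q.1)
    rw [abs_one, mul_one]
    calc _ ≤ 1 * 1 * (|q.1| * |Real.exp (-(p * q.1 ^ 2))|) := by gcongr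
      _ = _ := by ring
  calc _ = ∫ t in Ioi (0 : ℝ), ∫ σ, G t σ ∂circ := by
        refine setIntegral_congr_fun measurableSet_Ioi fun t ht => ?_
        simp only [hG]
        rw [hJ, integral_mul_const, abs_of_pos ht]
    _ = ∫ σ, (∫ t in Ioi (0 : ℝ), G t σ) ∂circ := integral_integral_swap hGi
    _ = _ := by
        refine integral_congr_ae (ae_of_all _ fun σ => ?_)
        simp only [hG, mul_assoc]
        rw [integral_const_mul, integral_besselJ_zero_mul_exp hp]

lemma integrableOn_rpow_mul_exp_neg_mul {s r : ℝ} (hs : -1 < s) (hr : 0 < r) :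
    IntegrableOn (fun p : ℝ => p ^ s * Real.exp (-(r * p))) (Ioi 0) := by
  have := integrableOn_rpow_mul_exp_neg_mul_rpow hs one_pos hr
  simpa using this

/-- The substitution `p ↦ 1/p` turns this into the Gamma integral. -/
lemma integrableOn_rpow_mul_exp_neg_div {a r : ℝ} (ha : 0 < a) (hr : 0 < r) :
    IntegrableOn (fun p : ℝ => p ^ (-a - 1) * Real.exp (-(r / p))) (Ioi 0) ∧
      ∫ p in Ioi (0 : ℝ), p ^ (-a - 1) * Real.exp (-(r / p)) = r ^ (-a) * Real.Gamma a := by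
  set g : ℝ → ℝ := fun p => p ^ (a - 1) * Real.exp (-(r * p)) with hg
  have e : EqOn (fun p : ℝ => (|(-1 : ℝ)| * p ^ ((-1 : ℝ) - 1)) • g (p ^ (-1 : ℝ)))
      (fun p : ℝ => p ^ (-a - 1) * Real.exp (-(r / p))) (Ioi 0) := by
    intro p hp
    have hp : (0 : ℝ) < p := hp
    simp only [hg, smul_eq_mul, abs_neg, abs_one, one_mul]
    rw [← Real.rpow_mul hp.le, ← mul_assoc, ← Real.rpow_add hp, Real.rpow_neg_one, div_eq_mul_inv]
    congr 2
    ring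
  constructor
  · rw [← integrableOn_congr_fun e measurableSet_Ioi,
      integrableOn_Ioi_comp_rpow_iff g (by norm_num : (-1 : ℝ) ≠ 0)]
    exact integrableOn_rpow_mul_exp_neg_mul (by linarith) hr
  · rw [← setIntegral_congr_fun measurableSet_Ioi e,
      integral_comp_rpow_Ioi g (by norm_num : (-1 : ℝ) ≠ 0), hg,
      Real.integral_rpow_mul_exp_neg_mul_Ioi ha hr, one_div, Real.inv_rpow hr.le,
      Real.rpow_neg hr.le]

end VState

/-! ### The Weber-Schafheitlin integral as a Fourier coefficient of a Riesz kernel -/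

namespace VState

/-- The law of cosines with the radial gap split off. It bounds the distance of points on two
circles below by the chord, even when the circles coincide. -/
lemma norm_sub_sq_circle (β γ : ℝ) (w τ : Circle) :
    ‖(β : ℂ) * w - γ * τ‖ ^ 2 = (β - γ) ^ 2 + β * γ * dist w τ ^ 2 := by
  have hw : Complex.normSq (w : ℂ) = 1 := Circle.normSq_coe w
  have hτ : Complex.normSq (τ : ℂ) = 1 := Circle.normSq_coe τ
  rw [dist_eq_norm_coe, ← Complex.normSq_eq_norm_sq, ← Complex.normSq_eq_norm_sq]
  rw [Complex.normSq_apply] at hw hτ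
  simp only [Complex.normSq_apply, Complex.sub_re, Complex.sub_im, Complex.re_ofReal_mul,
    Complex.im_ofReal_mul]
  linear_combination (β ^ 2 - β * γ) * hw + (γ ^ 2 - β * γ) * hτ

lemma sqrt_mul_dist_le {β γ : ℝ} (hβ : 0 < β) (hγ : 0 < γ) (w τ : Circle) :
    √(β * γ) * dist w τ ≤ ‖(β : ℂ) * w - γ * τ‖ := by
  refine abs_le_of_sq_le_sq' ?_ (norm_nonneg _) |>.2
  rw [mul_pow, Real.sq_sqrt (by positivity), norm_sub_sq_circle]
  nlinarith [sq_nonneg (β - γ)]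

lemma integrable_norm_sub_rpow {α a b : ℝ} (hα : α ∈ Ioo (0 : ℝ) 1) (ha : 0 < a) (hb : 0 < b) :
    Integrable (fun σ : Circle => ‖(a : ℂ) - b * σ‖ ^ (-α)) circ := by
  refine Integrable.mono' ((integrable_dist_rpow hα 1).const_mul (√(a * b) ^ (-α))) ?_ ?_
  · exact ((continuous_norm_sub_mul a b).measurable.pow_const _).aestronglyMeasurable
  · filter_upwards [ae_ne_circ 1] with σ hσ
    have hd : 0 < dist 1 σ := dist_pos.mpr hσ
    have h := sqrt_mul_dist_le ha hb 1 σ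
    rw [Circle.coe_one, mul_one] at h
    rw [Real.norm_of_nonneg (by positivity), ← Real.mul_rpow (by positivity) hd.le]
    exact Real.rpow_le_rpow_of_nonpos (by positivity) h (by linarith [hα.1])

lemma norm_sub_mul_pos {a b : ℝ} (ha : 0 < a) (hb : 0 < b) {σ : Circle} (hσ : 1 ≠ σ) :
    0 < ‖(a : ℂ) - b * σ‖ := by
  have h := sqrt_mul_dist_le ha hb 1 σ
  rw [Circle.coe_one, mul_one] at h
  have : 0 < dist 1 σ := dist_pos.mpr hσ
  exact lt_of_lt_of_le (by positivity) h

/-- A Mellin integral in the Gaussian parameter: by homogeneity a Gaussian in `ρ` becomes a multiple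
of `ρ ^ (-α)`. -/
lemma integral_heat_kernel {α ρ : ℝ} (hα : 0 < α) (hρ : 0 < ρ) :
    IntegrableOn (fun p : ℝ => p ^ (-(α / 2)) * (Real.exp (-(ρ ^ 2 / (4 * p))) / (2 * p)))
      (Ioi 0) ∧
    ∫ p in Ioi (0 : ℝ), p ^ (-(α / 2)) * (Real.exp (-(ρ ^ 2 / (4 * p))) / (2 * p)) =
      2 ^ α / 2 * Real.Gamma (α / 2) * ρ ^ (-α) := by
  have e : EqOn (fun p : ℝ => p ^ (-(α / 2)) * (Real.exp (-(ρ ^ 2 / (4 * p))) / (2 * p)))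
      (fun p : ℝ => 1 / 2 * (p ^ (-(α / 2) - 1) * Real.exp (-(ρ ^ 2 / 4 / p)))) (Ioi 0) := by
    intro p hp
    have hp : (0 : ℝ) < p := hp
    simp only
    rw [Real.rpow_sub_one hp.ne', div_div]
    field_simp
  obtain ⟨h1, h2⟩ := integrableOn_rpow_mul_exp_neg_div (a := α / 2) (r := ρ ^ 2 / 4)
    (by positivity) (by positivity)
  constructor
  · rw [integrableOn_congr_fun e measurableSet_Ioi]
    exact h1.const_mul _
  · rw [setIntegral_congr_fun measurableSet_Ioi e, integral_const_mul, h2]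
    have : (ρ ^ 2 / 4) ^ (-(α / 2)) = 2 ^ α * ρ ^ (-α) := by
      rw [show ρ ^ 2 / 4 = (ρ / 2) ^ (2 : ℝ) by rw [Real.rpow_two]; ring,
        ← Real.rpow_mul (by positivity), Real.div_rpow hρ.le zero_le_two,
        show (2 : ℝ) * -(α / 2) = -α by ring, Real.rpow_neg zero_le_two, div_inv_eq_mul, mul_comm]
    rw [this]
    ring

/-- The heat kernel on the circle, as a function of the time and of the angle. -/
noncomputable def heat (α a b p : ℝ) (σ : Circle) : ℝ :=
  p ^ (-(α / 2)) * (Real.exp (-(‖(a : ℂ) - b * σ‖ ^ 2 / (4 * p))) / (2 * p))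

/-- The integrand is nonnegative, and its integral in `p` is a multiple of `|a - bσ|^{-α}`, which is
integrable on the circle even for `a = b`; so Tonelli applies. -/
lemma integrable_heat {α a b : ℝ} (hα : α ∈ Ioo (0 : ℝ) 1) (ha : 0 < a) (hb : 0 < b) :
    Integrable (Function.uncurry (heat α a b)) ((volume.restrict (Ioi 0)).prod circ) := by
  have hm : Measurable (Function.uncurry (heat α a b)) := by
    have h1 : Measurable fun q : ℝ × Circle => ‖(a : ℂ) - b * q.2‖ :=
      (continuous_norm_sub_mul a b).measurable.comp measurable_snd
    unfold heat Function.uncurry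
    fun_prop
  rw [integrable_prod_iff' hm.aestronglyMeasurable]
  constructor
  · filter_upwards [ae_ne_circ 1] with σ hσ
    exact (integral_heat_kernel hα.1 (norm_sub_mul_pos ha hb hσ)).1
  · refine Integrable.congr ((integrable_norm_sub_rpow hα ha hb).const_mul
      (2 ^ α / 2 * Real.Gamma (α / 2))) ?_
    filter_upwards [ae_ne_circ 1] with σ hσ
    rw [← (integral_heat_kernel hα.1 (norm_sub_mul_pos ha hb hσ)).2]
    refine setIntegral_congr_fun measurableSet_Ioi fun p hp => ?_
    have hp : (0 : ℝ) < p := hp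
    simp only [Function.uncurry, heat]
    rw [Real.norm_of_nonneg (by positivity)]

lemma abs_re_circle_pow_le (σ : Circle) (n : ℕ) : |((σ : ℂ) ^ n).re| ≤ 1 := by
  refine (Complex.abs_re_le_norm _).trans_eq ?_
  rw [norm_pow, Circle.norm_coe, one_pow]

lemma continuous_re_circle_pow (n : ℕ) : Continuous fun σ : Circle => ((σ : ℂ) ^ n).re :=
  Complex.continuous_re.comp (continuous_circle_coe.pow n)

lemma integrable_re_mul_heat {α a b : ℝ} (hα : α ∈ Ioo (0 : ℝ) 1) (ha : 0 < a) (hb : 0 < b)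
    (n : ℕ) : Integrable (Function.uncurry fun (p : ℝ) (σ : Circle) => ((σ : ℂ) ^ n).re * heat α a b p σ)
      ((volume.restrict (Ioi 0)).prod circ) :=
  (integrable_heat hα ha hb).bdd_mul (c := 1)
    ((continuous_re_circle_pow n).comp continuous_snd).aestronglyMeasurable
    (ae_of_all _ fun q => abs_re_circle_pow_le q.2 n)

/-- The integrand of the Fubini argument for the Weber-Schafheitlin integral. -/
noncomputable def weber (α : ℝ) (n : ℕ) (a b t p : ℝ) : ℝ :=
  besselJ n (a * t) * besselJ n (b * t) * (t * Real.exp (-(p * t ^ 2))) * p ^ (-(α / 2))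

/-- The two orders of integration of `weber` are the two sides of the final identity: `t` first
gives a circle average, `p` first gives the Bessel integrand. -/
lemma integral_weber_right {α : ℝ} (n : ℕ) (a b : ℝ) {p : ℝ} (hp : 0 < p) :
    ∫ t in Ioi (0 : ℝ), weber α n a b t p =
      ∫ σ : Circle, ((σ : ℂ) ^ n).re * heat α a b p σ ∂circ := by
  unfold weber
  rw [integral_mul_const, integral_besselJ_mul_besselJ_mul_exp n a b hp, ← integral_mul_const]
  refine integral_congr_ae (ae_of_all _ fun σ => ?_)
  simp only [heat]
  ring

/-- In `p` this is a Gamma integral: `∫ p^{-α/2} t e^{-pt²} dp = Γ(1 - α/2) t^{α-1}`. -/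
lemma integral_weber_left {α : ℝ} (hα : α ∈ Ioo (0 : ℝ) 1) (n : ℕ) (a b : ℝ) {t : ℝ} (ht : 0 < t) :
    IntegrableOn (fun p => weber α n a b t p) (Ioi 0) ∧
    ∫ p in Ioi (0 : ℝ), weber α n a b t p = Real.Gamma (1 - α / 2) *
      (besselJ n (a * t) * besselJ n (b * t) / t ^ (1 - α)) := by
  have e : (fun p => weber α n a b t p) = fun p => (besselJ n (a * t) * besselJ n (b * t) * t) *
      (p ^ ((1 - α / 2) - 1) * Real.exp (-(t ^ 2 * p))) := by
    funext p
    rw [weber, show (1 - α / 2) - 1 = -(α / 2) by ring, mul_comm p]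
    ring
  rw [e]
  constructor
  · exact (integrableOn_rpow_mul_exp_neg_mul (by linarith [hα.2]) (by positivity)).const_mul _
  · rw [integral_const_mul, Real.integral_rpow_mul_exp_neg_mul_Ioi (by linarith [hα.2])
      (by positivity)]
    have : (1 / t ^ 2) ^ (1 - α / 2) = (t * t ^ (1 - α))⁻¹ := by
      rw [one_div, Real.inv_rpow (by positivity), ← Real.rpow_two, ← Real.rpow_mul ht.le]
      congr 1
      nth_rewrite 2 [← Real.rpow_one t]
      rw [← Real.rpow_add ht]
      congr 1
      ring
    have h1 := Real.rpow_pos_of_pos ht (1 - α)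
    rw [this]
    field_simp

lemma measurable_weber (α : ℝ) (n : ℕ) (a b : ℝ) :
    Measurable (Function.uncurry (weber α n a b)) := by
  have h := (continuous_besselJ n).measurable
  unfold weber Function.uncurry
  have h1 : Measurable fun q : ℝ × ℝ => besselJ n (a * q.1) := h.comp (by fun_prop)
  have h2 : Measurable fun q : ℝ × ℝ => besselJ n (b * q.1) := h.comp (by fun_prop)
  fun_prop

/-- For equal radii the integrand is a square times positive factors, so Tonelli derives convergence
from the finiteness of the circle integral, with no asymptotics of `J_n`. -/
lemma integrableOn_besselJ_sq {α : ℝ} (hα : α ∈ Ioo (0 : ℝ) 1) (n : ℕ) :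
    IntegrableOn (fun t => besselJ n t ^ 2 / t ^ (1 - α)) (Ioi 0) := by
  have hI : Integrable (Function.uncurry (weber α n 1 1))
      ((volume.restrict (Ioi 0)).prod (volume.restrict (Ioi 0))) := by
    rw [integrable_prod_iff' (measurable_weber α n 1 1).aestronglyMeasurable]
    constructor
    · filter_upwards [ae_restrict_mem measurableSet_Ioi] with p hp
      refine Integrable.mono' ((integrableOn_mul_exp_neg_mul_sq hp).mul_const (p ^ (-(α / 2))))
        (((measurable_weber α n 1 1).comp (measurable_id.prodMk
          measurable_const)).aestronglyMeasurable) ?_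
      filter_upwards [ae_restrict_mem measurableSet_Ioi] with t ht
      have ht : (0 : ℝ) < t := ht
      have hp : (0 : ℝ) < p := hp
      simp only [Function.uncurry, weber, norm_mul, Real.norm_eq_abs]
      rw [abs_of_pos ht, abs_of_pos (Real.exp_pos _), abs_of_pos (Real.rpow_pos_of_pos hp _)]
      have h1 := abs_besselJ_le_one n (1 * t)
      have h2 : |besselJ n (1 * t)| * |besselJ n (1 * t)| ≤ 1 := by nlinarith [abs_nonneg (besselJ n (1 * t))]
      calc _ ≤ 1 * (t * Real.exp (-(p * t ^ 2))) * p ^ (-(α / 2)) := by gcongr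
        _ = _ := by ring
    · refine Integrable.congr (integrable_re_mul_heat hα one_pos one_pos n).integral_prod_left ?_
      filter_upwards [ae_restrict_mem measurableSet_Ioi] with p hp
      have hp : (0 : ℝ) < p := hp
      refine (integral_weber_right n 1 1 hp).symm.trans
        (setIntegral_congr_fun measurableSet_Ioi fun t ht => ?_)
      have ht : (0 : ℝ) < t := ht
      simp only [Function.uncurry, weber]
      rw [Real.norm_of_nonneg]
      have := mul_self_nonneg (besselJ n (1 * t))
      positivity
  have h := hI.integral_prod_left
  have hG : Real.Gamma (1 - α / 2) ≠ 0 := (Real.Gamma_pos_of_pos (by linarith [hα.2])).ne'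
  refine Integrable.congr (h.const_mul (Real.Gamma (1 - α / 2))⁻¹) ?_
  filter_upwards [ae_restrict_mem measurableSet_Ioi] with t ht
  have := (integral_weber_left hα n 1 1 ht).2
  simp only [Function.uncurry]
  rw [this, one_mul, inv_mul_cancel_left₀ hG]
  ring

/-- By `|xy| ≤ x² + y²` the product is dominated by the squares at `bt` and at `t`. -/
lemma integrableOn_besselIntegrand {α b : ℝ} (hα : α ∈ Ioo (0 : ℝ) 1) (hb : 0 < b) (n : ℕ) :
    IntegrableOn (besselIntegrand α n b) (Ioi 0) := by
  have h1 := integrableOn_besselJ_sq hα n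
  have h2 : IntegrableOn (fun t => besselJ n (b * t) ^ 2 / (b * t) ^ (1 - α)) (Ioi 0) :=
    (integrableOn_Ioi_comp_mul_left_iff (fun t => besselJ n t ^ 2 / t ^ (1 - α)) 0 hb).mpr
      (by simpa using h1)
  have hm : Measurable (besselIntegrand α n b) := by
    have h := (continuous_besselJ n).measurable
    unfold besselIntegrand
    have h3 : Measurable fun t : ℝ => besselJ n (b * t) := h.comp (by fun_prop)
    fun_prop
  refine Integrable.mono' ((h2.const_mul (b ^ (1 - α))).add h1) hm.aestronglyMeasurable ?_
  filter_upwards [ae_restrict_mem measurableSet_Ioi] with t ht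
  have ht : (0 : ℝ) < t := ht
  simp only [besselIntegrand, Pi.add_apply, norm_div, norm_mul, Real.norm_eq_abs]
  rw [Real.mul_rpow hb.le ht.le, abs_of_pos (Real.rpow_pos_of_pos ht _)]
  have hb1 := Real.rpow_pos_of_pos hb (1 - α)
  have ht1 := Real.rpow_pos_of_pos ht (1 - α)
  have e : b ^ (1 - α) * (besselJ n (b * t) ^ 2 / (b ^ (1 - α) * t ^ (1 - α))) +
      besselJ n t ^ 2 / t ^ (1 - α) =
      (besselJ n (b * t) ^ 2 + besselJ n t ^ 2) / t ^ (1 - α) := by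
    field_simp
  rw [e]
  gcongr
  rw [← sq_abs (besselJ n (b * t)), ← sq_abs (besselJ n t)]
  nlinarith [sq_nonneg (|besselJ n (b * t)| - |besselJ n t|), abs_nonneg (besselJ n (b * t)),
    abs_nonneg (besselJ n t)]

/-- The Fourier coefficients of `σ ↦ C_α |γ - β σ|^{-α}`. -/
noncomputable def kappa (α γ β : ℝ) (n : ℕ) : ℝ :=
  Cα α * ∫ σ : Circle, ((σ : ℂ) ^ n).re * ‖(γ : ℂ) - β * σ‖ ^ (-α) ∂circ

/-- The Weber-Schafheitlin integral as a Fourier coefficient. -/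
lemma integral_besselIntegrand {α b : ℝ} (hα : α ∈ Ioo (0 : ℝ) 1) (hb : 0 < b) (n : ℕ) :
    ∫ t in Ioi (0 : ℝ), besselIntegrand α n b t = kappa α b 1 n := by
  have hG : 0 < Real.Gamma (1 - α / 2) := Real.Gamma_pos_of_pos (by linarith [hα.2])
  have hI : Integrable (Function.uncurry (weber α n b 1))
      ((volume.restrict (Ioi 0)).prod (volume.restrict (Ioi 0))) := by
    rw [integrable_prod_iff (measurable_weber α n b 1).aestronglyMeasurable]
    constructor
    · filter_upwards [ae_restrict_mem measurableSet_Ioi] with t ht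
      exact (integral_weber_left hα n b 1 ht).1
    · refine Integrable.congr
        ((integrableOn_besselIntegrand hα hb n).norm.const_mul (Real.Gamma (1 - α / 2))) ?_
      filter_upwards [ae_restrict_mem measurableSet_Ioi] with t ht
      have ht : (0 : ℝ) < t := ht
      have h := (integral_weber_left hα n b 1 ht).2
      -- For fixed `t` the sign does not depend on `p`, so the integral of the absolute value is the
      -- absolute value of the integral; the integrand of `Λ` already converges absolutely.
      have hs : ∃ s : ℝ, |s| = 1 ∧ ∀ p ∈ Ioi (0 : ℝ), ‖weber α n b 1 t p‖ = s * weber α n b 1 t p := by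
        obtain ⟨s, hs, hsJ⟩ : ∃ s : ℝ, |s| = 1 ∧ |besselJ n (b * t) * besselJ n (1 * t)| =
            s * (besselJ n (b * t) * besselJ n (1 * t)) := by
          rcases abs_choice (besselJ n (b * t) * besselJ n (1 * t)) with h | h
          · exact ⟨1, by simp, by rw [h]; ring⟩
          · exact ⟨-1, by simp, by rw [h]; ring⟩
        refine ⟨s, hs, fun p hp => ?_⟩
        have hp : (0 : ℝ) < p := hp
        rw [weber, Real.norm_eq_abs, abs_mul, abs_mul, hsJ, abs_of_pos (by positivity),
          abs_of_pos (by positivity)]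
        ring
      obtain ⟨s, hs, hsp⟩ := hs
      have e : ∫ p in Ioi (0 : ℝ), ‖weber α n b 1 t p‖ = s * (Real.Gamma (1 - α / 2) *
          (besselJ n (b * t) * besselJ n (1 * t) / t ^ (1 - α))) := by
        rw [setIntegral_congr_fun measurableSet_Ioi hsp, integral_const_mul, h]
      have e0 : 0 ≤ ∫ p in Ioi (0 : ℝ), ‖weber α n b 1 t p‖ := integral_nonneg fun _ => norm_nonneg _
      simp only [Function.uncurry, besselIntegrand]
      rw [← abs_of_nonneg e0, e, abs_mul, abs_mul, hs, abs_of_pos hG, one_mul, one_mul,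
        Real.norm_eq_abs]
  have h := integral_integral_swap hI
  have hL : ∫ t in Ioi (0 : ℝ), ∫ p in Ioi (0 : ℝ), weber α n b 1 t p =
      Real.Gamma (1 - α / 2) * ∫ t in Ioi (0 : ℝ), besselIntegrand α n b t := by
    rw [← integral_const_mul]
    refine setIntegral_congr_fun measurableSet_Ioi fun t ht => ?_
    simp only [(integral_weber_left hα n b 1 ht).2, one_mul, besselIntegrand]
  have hR : ∫ p in Ioi (0 : ℝ), ∫ t in Ioi (0 : ℝ), weber α n b 1 t p =
      2 ^ α / 2 * Real.Gamma (α / 2) *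
        ∫ σ : Circle, ((σ : ℂ) ^ n).re * ‖(b : ℂ) - (1 : ℝ) * σ‖ ^ (-α) ∂circ := by
    calc _ = ∫ p in Ioi (0 : ℝ), ∫ σ : Circle, ((σ : ℂ) ^ n).re * heat α b 1 p σ ∂circ :=
          setIntegral_congr_fun measurableSet_Ioi fun p hp => integral_weber_right n b 1 hp
      _ = ∫ σ : Circle, (∫ p in Ioi (0 : ℝ), ((σ : ℂ) ^ n).re * heat α b 1 p σ) ∂circ :=
          integral_integral_swap (integrable_re_mul_heat hα hb one_pos n)
      _ = _ := by
          rw [← integral_const_mul]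
          refine integral_congr_ae ?_
          filter_upwards [ae_ne_circ 1] with σ hσ
          rw [integral_const_mul]
          unfold heat
          rw [(integral_heat_kernel hα.1 (norm_sub_mul_pos hb one_pos hσ)).2]
          ring
  rw [hL, hR] at h
  -- The constants match: `C_α = 2^{α-1} Γ(α/2) / Γ(1 - α/2)`.
  rw [kappa, Cα, show (2 - α) / 2 = 1 - α / 2 by ring, Real.rpow_sub two_pos, Real.rpow_one]
  have h2 := Real.rpow_pos_of_pos two_pos α
  generalize Real.Gamma (1 - α / 2) = c at h hG ⊢
  field_simp
  field_simp at h
  linear_combination h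

end VState

namespace VState

/-! ### The tangential derivative -/

/-- The tangential derivative `w f'(w) = -i d/dη f(e^{iη})`. -/
noncomputable def tder (f : Circle → ℂ) (w : Circle) : ℂ := (w : ℂ) * circleDeriv f w

lemma lift_periodic (f : Circle → ℂ) : Function.Periodic (lift f) (2 * π) := fun η => by
  simp only [lift]
  rw [Circle.periodic_exp η]

/-- The definition of `circleDeriv` fixes the principal argument; periodicity permits any angle. -/
lemma deriv_lift_arg (f : Circle → ℂ) (η : ℝ) :
    deriv (lift f) (Complex.arg (Circle.exp η : ℂ)) = deriv (lift f) η := by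
  obtain ⟨k, hk⟩ := Circle.exp_eq_exp.mp (Circle.exp_arg (Circle.exp η))
  rw [hk]
  have h := (lift_periodic f).int_mul k
  have h2 : (fun x => lift f (x + k * (2 * π))) = lift f := funext fun x => h x
  nth_rewrite 2 [← h2]
  rw [deriv_comp_add_const]

lemma tder_exp (f : Circle → ℂ) (η : ℝ) :
    tder f (Circle.exp η) = -Complex.I * deriv (lift f) η := by
  rw [tder, circleDeriv, deriv_lift_arg, ← Circle.coe_inv_eq_conj, Circle.coe_inv]
  have := Circle.coe_ne_zero (Circle.exp η)
  field_simp

lemma hasDerivAt_lift {f : Circle → ℂ} (hf : ContDiff ℝ 1 (lift f)) (η : ℝ) :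
    HasDerivAt (lift f) (Complex.I * tder f (Circle.exp η)) η := by
  have h := (hf.differentiable one_ne_zero η).hasDerivAt
  rw [tder_exp, ← mul_assoc, mul_neg, Complex.I_mul_I, neg_neg, one_mul]
  exact h

/-- The mean value inequality along the shorter arc; the constant `2` absorbs the ratio `π/2` of arc
and chord. -/
lemma norm_sub_le_of_norm_tder_le {f : Circle → ℂ} (hf : ContDiff ℝ 1 (lift f)) {B : ℝ}
    (hB : ∀ w, ‖tder f w‖ ≤ B) (w τ : Circle) : ‖f w - f τ‖ ≤ 2 * B * dist w τ := by
  have hB0 : 0 ≤ B := (norm_nonneg _).trans (hB 1)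
  obtain ⟨η, hη, rfl⟩ := exists_exp_mul_eq w τ
  set τ := w * Circle.exp η
  have h := Convex.norm_image_sub_le_of_norm_hasDerivWithin_le (f := lift f) (s := univ) (C := B)
    (fun x _ => (hasDerivAt_lift hf x).hasDerivWithinAt)
    (fun x _ => by rw [norm_mul, Complex.norm_I, one_mul]; exact hB _) convex_univ
    (mem_univ (Complex.arg (w : ℂ) + η)) (mem_univ (Complex.arg (w : ℂ)))
  have h1 : lift f (Complex.arg (w : ℂ)) = f w := by rw [lift, Circle.exp_arg]
  have h2 : lift f (Complex.arg (w : ℂ) + η) = f τ := by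
    rw [lift, Circle.exp_add, Circle.exp_arg]
  rw [h1, h2] at h
  refine h.trans ?_
  have h3 : ‖Complex.arg (w : ℂ) - (Complex.arg (w : ℂ) + η)‖ = |η| := by
    rw [Real.norm_eq_abs, sub_add_cancel_left, abs_neg]
  rw [h3]
  have := Real.pi_le_four
  have hd := dist_nonneg (x := w) (y := τ)
  calc B * |η| ≤ B * (π / 2 * dist w τ) := by gcongr
    _ ≤ B * (2 * dist w τ) := by gcongr; linarith
    _ = _ := by ring

lemma tder_inv {f : Circle → ℂ} (hf : ContDiff ℝ 1 (lift f)) (h : ∀ w, f w⁻¹ = conj (f w))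
    (w : Circle) : tder f w⁻¹ = conj (tder f w) := by
  obtain ⟨η, rfl⟩ : ∃ η, w = Circle.exp η := ⟨_, (Circle.exp_arg w).symm⟩
  rw [← Circle.exp_neg, tder_exp, tder_exp, map_mul, map_neg, Complex.conj_I]
  have h1 : (fun x => lift f (-x)) = fun x => conj (lift f x) := by
    funext x
    rw [lift, Circle.exp_neg, h, lift]
  have h2 : HasDerivAt (fun x => conj (lift f x)) (conj (deriv (lift f) η)) η :=
    (hf.differentiable one_ne_zero η).hasDerivAt.star
  rw [← h2.deriv, ← h1, deriv_comp_neg]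
  ring

/-- Integration by parts over a full period, where the boundary terms cancel. -/
lemma integral_tder_mul_zpow {f : Circle → ℂ} (hf : ContDiff ℝ 1 (lift f)) (k : ℤ) :
    ∫ τ, tder f τ * (τ : ℂ) ^ k ∂circ = -k * ∫ τ, f τ * (τ : ℂ) ^ k ∂circ := by
  have hc : Continuous (lift f) := hf.continuous
  have hd : Continuous fun η => tder f (Circle.exp η) := by
    simp_rw [tder_exp]
    exact continuous_const.mul (hf.continuous_deriv le_rfl)
  have hk : Continuous fun η : ℝ => (Circle.exp η : ℂ) ^ k :=
    (continuous_circle_zpow k).comp Circle.exp.continuous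
  have hkd : ∀ η : ℝ, HasDerivAt (fun η : ℝ => (Circle.exp η : ℂ) ^ k)
      (k * Complex.I * (Circle.exp η : ℂ) ^ k) η := by
    intro η
    have e : (fun η : ℝ => (Circle.exp η : ℂ) ^ k) =
        fun η : ℝ => Complex.exp (k * ((η : ℂ) * Complex.I)) := by
      funext η; rw [Circle.coe_exp, ← Complex.exp_int_mul]
    have := (((hasDerivAt_id η).ofReal_comp.mul_const Complex.I).const_mul (k : ℂ)).cexp
    rw [e, Circle.coe_exp, ← Complex.exp_int_mul]
    convert! this using 1
    simp only [id, Complex.ofReal_one]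
    ring
  have h := intervalIntegral.integral_eq_sub_of_hasDerivAt (a := 0) (b := 2 * π)
    (fun η _ => (hasDerivAt_lift hf η).mul (hkd η)) (Continuous.intervalIntegrable (by fun_prop) _ _)
  have hp : ((lift f) * fun η : ℝ => (Circle.exp η : ℂ) ^ k) (2 * π) -
      ((lift f) * fun η : ℝ => (Circle.exp η : ℂ) ^ k) 0 = 0 := by
    have h1 := lift_periodic f 0
    have h2 := Circle.periodic_exp 0
    rw [zero_add] at h1 h2
    simp only [Pi.mul_apply]
    rw [h1, h2, sub_self]
  rw [hp, intervalIntegral.integral_add (Continuous.intervalIntegrable (by fun_prop) _ _)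
    (Continuous.intervalIntegrable (by fun_prop) _ _)] at h
  have e1 : ∀ η : ℝ, Complex.I * tder f (Circle.exp η) * (Circle.exp η : ℂ) ^ k =
      Complex.I * (tder f (Circle.exp η) * (Circle.exp η : ℂ) ^ k) := fun η => by ring
  have e2 : ∀ η : ℝ, lift f η * (k * Complex.I * (Circle.exp η : ℂ) ^ k) =
      Complex.I * k * (lift f η * (Circle.exp η : ℂ) ^ k) := fun η => by ring
  simp only [e1, e2, intervalIntegral.integral_const_mul] at h
  have h3 : (∫ η in (0 : ℝ)..(2 * π), tder f (Circle.exp η) * (Circle.exp η : ℂ) ^ k) =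
      -k * ∫ η in (0 : ℝ)..(2 * π), lift f η * (Circle.exp η : ℂ) ^ k := by
    refine mul_left_cancel₀ Complex.I_ne_zero ?_
    linear_combination h
  rw [integral_circ, integral_circ, h3, mul_smul_comm]
  rfl

lemma tder_perturb {f : Circle → ℂ} (hf : ContDiff ℝ 1 (lift f)) (r : ℝ) (w : Circle) :
    tder (perturb r f) w = r * w + tder f w := by
  obtain ⟨η, rfl⟩ : ∃ η, w = Circle.exp η := ⟨_, (Circle.exp_arg w).symm⟩
  have h : HasDerivAt (lift (perturb r f)) (r * (Complex.I * (Circle.exp η : ℂ)) +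
      Complex.I * tder f (Circle.exp η)) η := by
    have h1 : HasDerivAt (fun η : ℝ => (Circle.exp η : ℂ)) (Complex.I * (Circle.exp η : ℂ)) η := by
      have := ((hasDerivAt_id η).ofReal_comp.mul_const Complex.I).cexp
      simp only [Circle.coe_exp]
      convert! this using 1
      simp only [id, Complex.ofReal_one]
      ring
    exact (h1.const_mul (r : ℂ)).add (hasDerivAt_lift hf η)
  rw [tder_exp, h.deriv]
  linear_combination (-(r * (Circle.exp η : ℂ) + tder f (Circle.exp η))) * Complex.I_sq

/-! ### Elements of the space of perturbations -/

namespace Car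

variable {α : ℝ}

lemma norm_apply_le (f : Car α) (w : Circle) : ‖f w‖ ≤ ‖f‖ := by
  rw [norm_def]
  have h1 := f.toC.norm_coe_le_norm w
  have h2 := Real.iSup_nonneg (f := fun w : Circle => ‖circleDeriv f w‖) fun w => norm_nonneg _
  have h3 := (nnHolderNorm (expo α) (circleDeriv f)).coe_nonneg
  linarith

lemma norm_tder_le (f : Car α) (w : Circle) : ‖tder f w‖ ≤ ‖f‖ := by
  rw [norm_def, tder, norm_mul, Circle.norm_coe, one_mul]
  have h2 := le_ciSup (bddAbove_circleDeriv f.contDiff) w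
  have h3 := (nnHolderNorm (expo α) (circleDeriv f)).coe_nonneg
  have h4 := norm_nonneg f.toC
  linarith

lemma norm_sub_le (f : Car α) (w τ : Circle) : ‖f w - f τ‖ ≤ 2 * ‖f‖ * dist w τ :=
  norm_sub_le_of_norm_tder_le f.contDiff f.norm_tder_le w τ

end Car

lemma dist_le_rpow {α : ℝ} (hα : α ∈ Ioo (0 : ℝ) 1) (w τ : Circle) :
    dist w τ ≤ 2 * dist w τ ^ (1 - α) := by
  rcases eq_or_ne w τ with rfl | h
  · rw [dist_self]; positivity
  · have hd : 0 < dist w τ := dist_pos.mpr h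
    calc dist w τ = dist w τ ^ α * dist w τ ^ (1 - α) := by
          rw [← Real.rpow_add hd, add_sub_cancel, Real.rpow_one]
      _ ≤ 2 ^ α * dist w τ ^ (1 - α) := by
          gcongr
          · exact hα.1.le
          · exact dist_circle_le_two w τ
      _ ≤ 2 ^ (1 : ℝ) * dist w τ ^ (1 - α) := by
          gcongr
          · norm_num
          · exact hα.2.le
      _ = _ := by rw [Real.rpow_one]

lemma HolderBound.of_lipschitz {α A : ℝ} (hα : α ∈ Ioo (0 : ℝ) 1) {u : Circle → ℂ}
    (hA : 0 ≤ A) (h1 : ∀ w, ‖u w‖ ≤ A) (h2 : ∀ w τ, ‖u w - u τ‖ ≤ A * dist w τ) :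
    HolderBound α (2 * A) u := by
  refine ⟨fun w => (h1 w).trans (by linarith), fun w τ => (h2 w τ).trans ?_⟩
  have := dist_le_rpow hα w τ
  calc A * dist w τ ≤ A * (2 * dist w τ ^ (1 - α)) := by gcongr
    _ = _ := by ring

namespace Car

variable {α : ℝ}

lemma holderBound (hα : α ∈ Ioo (0 : ℝ) 1) (f : Car α) : HolderBound α (4 * ‖f‖) f := by
  have h := HolderBound.of_lipschitz hα (u := f) (A := 2 * ‖f‖) (by positivity)
    (fun w => (f.norm_apply_le w).trans (by linarith [norm_nonneg f])) f.norm_sub_le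
  rwa [show 2 * (2 * ‖f‖) = 4 * ‖f‖ by ring] at h

lemma holderBound_tder (hα : α ∈ Ioo (0 : ℝ) 1) (f : Car α) : HolderBound α (4 * ‖f‖) (tder f) := by
  refine ⟨fun w => (f.norm_tder_le w).trans (by linarith [norm_nonneg f]), fun w τ => ?_⟩
  have h1 : ‖circleDeriv f w - circleDeriv f τ‖ ≤ ‖f‖ * dist w τ ^ (1 - α) := by
    have h := f.memHolder.holderWith.dist_le w τ
    rw [coe_expo hα, dist_eq_norm] at h
    refine h.trans ?_
    gcongr
    rw [norm_def]
    have h2 := Real.iSup_nonneg (f := fun w : Circle => ‖circleDeriv f w‖) fun w => norm_nonneg _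
    have h4 := norm_nonneg f.toC
    linarith
  have h2 : ‖circleDeriv f τ‖ ≤ ‖f‖ := by
    have := f.norm_tder_le τ
    rwa [tder, norm_mul, Circle.norm_coe, one_mul] at this
  have h3 := dist_le_rpow hα w τ
  have h4 : 0 ≤ dist w τ ^ (1 - α) := by positivity
  calc ‖tder f w - tder f τ‖
      = ‖(w : ℂ) * (circleDeriv f w - circleDeriv f τ) + ((w : ℂ) - τ) * circleDeriv f τ‖ := by
        rw [tder, tder]; congr 1; ring
    _ ≤ ‖f‖ * dist w τ ^ (1 - α) + dist w τ * ‖f‖ := by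
        refine (norm_add_le _ _).trans ?_
        rw [norm_mul, norm_mul, Circle.norm_coe, one_mul, ← dist_eq_norm_coe]
        gcongr
    _ ≤ ‖f‖ * dist w τ ^ (1 - α) + 2 * dist w τ ^ (1 - α) * ‖f‖ := by gcongr
    _ ≤ _ := by nlinarith [mul_nonneg (norm_nonneg f) h4]

lemma continuous_tder (hα : α ∈ Ioo (0 : ℝ) 1) (f : Car α) : Continuous (tder f) :=
  (f.holderBound_tder hα).continuous hα

lemma exists_hasSum (f : Car α) : ∃ a : ℕ → ℝ, ∀ w : Circle,
    HasSum (fun n : ℕ => (a (n + 1) : ℂ) * conj (w : ℂ) ^ (n + 1)) (f w) :=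
  (Subtype.property (p := fun f => f ∈ arSubmodule α) f).2.2

/-- Here the real coefficients enter. This reflection symmetry is what makes the imaginary parts of
the fluxes odd. -/
lemma apply_inv (f : Car α) (w : Circle) : f w⁻¹ = conj (f w) := by
  obtain ⟨a, ha⟩ := f.exists_hasSum
  refine (ha w⁻¹).unique ?_
  have h := (ha w).star
  refine h.congr_fun fun n => ?_
  have e : star ((a (n + 1) : ℂ) * conj (w : ℂ) ^ (n + 1)) =
      (a (n + 1) : ℂ) * (w : ℂ) ^ (n + 1) := by simp
  rw [e, Circle.coe_inv_eq_conj, Complex.conj_conj]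

lemma tder_inv (f : Car α) (w : Circle) : tder f w⁻¹ = conj (tder f w) :=
  VState.tder_inv f.contDiff f.apply_inv w

lemma tder_add (f g : Car α) : tder (f + g : Car α) = tder f + tder g := by
  funext w
  simp only [tder, toC_add, ContinuousMap.coe_add, Pi.add_apply,
    circleDeriv_add f.contDiff g.contDiff, mul_add]

lemma tder_smul (c : ℝ) (f : Car α) : tder (c • f : Car α) = c • tder f := by
  funext w
  simp only [tder, toC_smul, ContinuousMap.coe_smul, Pi.smul_apply, circleDeriv_smul c f.contDiff,
    mul_smul_comm]

end Car

/-- The coefficients of a function with a pointwise convergent expansion in negative powers. -/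
lemma integral_mul_zpow_of_hasSum {f : Circle → ℂ} {a : ℕ → ℝ}
    (ha : ∀ w : Circle, HasSum (fun n : ℕ => (a (n + 1) : ℂ) * conj (w : ℂ) ^ (n + 1)) (f w))
    (k : ℤ) : ∫ τ, f τ * (τ : ℂ) ^ k ∂circ = if 0 < k then (a k.toNat : ℂ) else 0 := by
  -- At `w = 1` all powers equal `1`, so unconditional convergence there gives absolute summability
  -- of the coefficients.
  have hs : Summable fun n : ℕ => ‖(a (n + 1) : ℂ)‖ := by
    have := (ha 1).summable.norm
    simpa using this
  have hc : ∀ (τ : Circle) (n : ℕ), conj (τ : ℂ) ^ (n + 1) = (τ : ℂ) ^ (-((n : ℤ) + 1)) := by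
    intro τ n
    rw [zpow_neg, ← inv_zpow, ← Circle.coe_inv, Circle.coe_inv_eq_conj]
    norm_cast
  set F : ℕ → Circle → ℂ := fun n τ => (a (n + 1) : ℂ) * (τ : ℂ) ^ (k - ((n : ℤ) + 1)) with hF
  have hint : ∀ n, Integrable (F n) circ := fun n =>
    integrable_circ_of_continuous (continuous_const.mul (continuous_circle_zpow _))
  have h := hasSum_integral_of_summable_integral_norm hint
    (by simpa [hF, norm_mul, norm_circle_zpow, -norm_zpow] using hs)
  have h1 : ∀ τ, ∑' n, F n τ = f τ * (τ : ℂ) ^ k := by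
    intro τ
    rw [← ((ha τ).mul_right ((τ : ℂ) ^ k)).tsum_eq]
    refine tsum_congr fun n => ?_
    rw [hc, hF, mul_assoc, ← zpow_add₀ (Circle.coe_ne_zero τ)]
    simp only
    congr 2
    ring
  simp only [h1] at h
  have h2 : ∀ n : ℕ, ∫ τ, F n τ ∂circ = if (n : ℤ) + 1 = k then (a (n + 1) : ℂ) else 0 := by
    intro n
    simp only [hF]
    rw [integral_const_mul]
    split_ifs with hk
    · rw [← hk]; simp
    · rw [integral_circ_zpow _ (by omega), mul_zero]
  simp only [h2] at h
  refine h.unique ?_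
  split_ifs with hk
  · obtain ⟨m, rfl⟩ : ∃ m : ℕ, k = (m : ℤ) + 1 := ⟨(k - 1).toNat, by omega⟩
    have e : ((m : ℤ) + 1).toNat = m + 1 := by omega
    rw [e]
    convert! hasSum_ite_eq m (a (m + 1) : ℂ) using 2 with n
    by_cases hn : n = m
    · simp [hn]
    · rw [if_neg (by omega), if_neg hn]
  · have : ∀ n : ℕ, (if (n : ℤ) + 1 = k then (a (n + 1) : ℂ) else 0) = 0 := fun n =>
      if_neg (by omega)
    simp only [this]
    exact hasSum_zero

end VState

namespace VState

/-! ### Algebra of Hölder functions, kernels and multipliers -/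

namespace HolderBound

variable {α A B : ℝ} {u v : Circle → ℂ}

lemma mono (hu : HolderBound α A u) (h : A ≤ B) : HolderBound α B u :=
  ⟨fun w => (hu.bound w).trans h, fun w w' => (hu.diff w w').trans (by gcongr)⟩

lemma add (hu : HolderBound α A u) (hv : HolderBound α B v) :
    HolderBound α (A + B) fun w => u w + v w := by
  refine ⟨fun w => (norm_add_le _ _).trans (add_le_add (hu.bound w) (hv.bound w)), fun w w' => ?_⟩
  rw [add_sub_add_comm, add_mul]
  exact (norm_add_le _ _).trans (add_le_add (hu.diff w w') (hv.diff w w'))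

lemma const_mul (c : ℂ) (hu : HolderBound α A u) : HolderBound α (‖c‖ * A) fun w => c * u w := by
  refine ⟨fun w => ?_, fun w w' => ?_⟩
  · rw [norm_mul]; gcongr; exact hu.bound w
  · rw [← mul_sub, norm_mul, mul_assoc]; gcongr; exact hu.diff w w'

lemma sub (hu : HolderBound α A u) (hv : HolderBound α B v) :
    HolderBound α (A + B) fun w => u w - v w := by
  simpa [sub_eq_add_neg] using hu.add (hv.const_mul (-1))

lemma mul (hu : HolderBound α A u) (hv : HolderBound α B v) :
    HolderBound α (2 * A * B) fun w => u w * v w := by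
  have hA := hu.nonneg
  have hB := hv.nonneg
  refine ⟨fun w => ?_, fun w w' => ?_⟩
  · rw [norm_mul]
    calc ‖u w‖ * ‖v w‖ ≤ A * B := by gcongr; exacts [hu.bound w, hv.bound w]
      _ ≤ _ := by nlinarith [mul_nonneg hA hB]
  · calc ‖u w * v w - u w' * v w'‖ = ‖u w * (v w - v w') + (u w - u w') * v w'‖ := by
          congr 1; ring
      _ ≤ ‖u w‖ * ‖v w - v w'‖ + ‖u w - u w'‖ * ‖v w'‖ := by
          refine (norm_add_le _ _).trans_eq ?_
          rw [norm_mul, norm_mul]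
      _ ≤ A * (B * dist w w' ^ (1 - α)) + A * dist w w' ^ (1 - α) * B := by
          gcongr
          exacts [hu.bound w, hv.diff w w', hu.diff w w', hv.bound w']
      _ = _ := by ring

lemma star (hu : HolderBound α A u) : HolderBound α A fun w => (starRingEnd ℂ) (u w) := by
  refine ⟨fun w => ?_, fun w w' => ?_⟩
  · rw [Complex.norm_conj]; exact hu.bound w
  · rw [← map_sub, Complex.norm_conj]; exact hu.diff w w'

lemma im (hu : HolderBound α A u) : HolderBound α A fun w => ((u w).im : ℂ) := by
  refine ⟨fun w => ?_, fun w w' => ?_⟩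
  · rw [Complex.norm_real]; exact (Complex.abs_im_le_norm _).trans (hu.bound w)
  · rw [← Complex.ofReal_sub, ← Complex.sub_im, Complex.norm_real]
    exact (Complex.abs_im_le_norm _).trans (hu.diff w w')

lemma const_coe (hα : α ∈ Ioo (0 : ℝ) 1) {c : ℝ} (hc : 0 ≤ c) :
    HolderBound α (2 * c) fun w : Circle => (c : ℂ) * w := by
  refine of_lipschitz hα hc (fun w => ?_) fun w τ => ?_
  · rw [norm_mul, Circle.norm_coe, Complex.norm_real, Real.norm_of_nonneg hc, mul_one]
  · rw [← mul_sub, norm_mul, Complex.norm_real, Real.norm_of_nonneg hc, dist_eq_norm_coe]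

end HolderBound

/-- As `t ≤ t ^ α` on `[0, 1]`, `y^{-α} ≥ x^{-α} (x/y)`. The difference is therefore at most `x^{-α}
(1 - x/y)`, which increases with `y ≤ x + e`. -/
lemma abs_rpow_neg_sub_le_of_le {α x y e : ℝ} (hα : α ∈ Ioo (0 : ℝ) 1) (hx : 0 < x)
    (hxy : x ≤ y) (he : y - x ≤ e) : |x ^ (-α) - y ^ (-α)| ≤ bump α e x := by
  have hy := hx.trans_le hxy
  have he0 : 0 ≤ e := (sub_nonneg.mpr hxy).trans he
  have h1 : y ^ (-α) ≤ x ^ (-α) := Real.rpow_le_rpow_of_nonpos hx hxy (by linarith [hα.1])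
  have hxa := Real.rpow_pos_of_pos hx α
  have h2 : x ^ (-α) * (x / y) ≤ y ^ (-α) := by
    have h3 : (x / y) ^ (1 : ℝ) ≤ (x / y) ^ α :=
      Real.rpow_le_rpow_of_exponent_ge (by positivity) ((div_le_one hy).mpr hxy) hα.2.le
    rw [Real.rpow_one] at h3
    calc x ^ (-α) * (x / y) ≤ x ^ (-α) * (x / y) ^ α := by gcongr
      _ = y ^ (-α) := by
        rw [Real.div_rpow hx.le hy.le, Real.rpow_neg hx.le, Real.rpow_neg hy.le]
        field_simp
  rw [abs_of_nonneg (sub_nonneg.mpr h1), bump]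
  calc x ^ (-α) - y ^ (-α) ≤ x ^ (-α) - x ^ (-α) * (x / y) := by linarith
    _ = (y - x) / (x ^ α * y) := by
        rw [Real.rpow_neg hx.le]
        field_simp
    _ ≤ e / (x ^ α * (x + e)) := by
        rw [div_le_div_iff₀ (by positivity) (by positivity)]
        have : (y - x) * (x + e) ≤ e * y := by nlinarith
        calc (y - x) * (x ^ α * (x + e)) = x ^ α * ((y - x) * (x + e)) := by ring
          _ ≤ x ^ α * (e * y) := by gcongr
          _ = _ := by ring

lemma abs_rpow_neg_sub_le {α x y e : ℝ} (hα : α ∈ Ioo (0 : ℝ) 1) (hx : 0 < x) (hy : 0 < y)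
    (he : |x - y| ≤ e) : |x ^ (-α) - y ^ (-α)| ≤ bump α e x + bump α e y := by
  have he0 : 0 ≤ e := (abs_nonneg _).trans he
  rcases le_total x y with h | h
  · have := abs_rpow_neg_sub_le_of_le hα hx h (by rw [abs_le] at he; linarith : y - x ≤ e)
    linarith [bump_nonneg (α := α) he0 hy.le]
  · have := abs_rpow_neg_sub_le_of_le hα hy h (by rw [abs_le] at he; linarith : x - y ≤ e)
    rw [abs_sub_comm] at this
    linarith [bump_nonneg (α := α) he0 hx.le]

lemma bump_mul_le {α c C δ d : ℝ} (hα : 0 ≤ α) (hc : 0 < c) (hcC : c ≤ C) (hδ : 0 ≤ δ) (hd : 0 < d)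
    {x : ℝ} (hx : c * d ≤ x) : bump α (C * δ) x ≤ C / c * c ^ (-α) * bump α δ d := by
  have hC := hc.trans_le hcC
  refine (bump_anti hα (by positivity) (by positivity) hx).trans ?_
  have h1 := Real.rpow_pos_of_pos hc α
  have h2 := Real.rpow_pos_of_pos hd α
  unfold bump
  rw [Real.mul_rpow hc.le hd.le, Real.rpow_neg hc.le]
  have e : C / c * (c ^ α)⁻¹ * (δ / (d ^ α * (d + δ))) =
      C * δ / (c ^ α * d ^ α * (c * (d + δ))) := by
    field_simp
  rw [e]
  gcongr
  nlinarith

/-- The kernel `|Z|^{-α}`. -/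
noncomputable def rieszKernel (α : ℝ) (Z : Circle → Circle → ℂ) (w τ : Circle) : ℂ :=
  ((‖Z w τ‖ ^ (-α) : ℝ) : ℂ)

/-- Only a lower bound of `Z` by the chord and a Lipschitz bound in `w` matter, so the lemma covers
unperturbed and perturbed boundaries alike. -/
lemma isKernel_riesz {α c C : ℝ} (hα : α ∈ Ioo (0 : ℝ) 1) (hc : 0 < c) (hcC : c ≤ C)
    {Z : Circle → Circle → ℂ} (hm : ∀ w, Measurable (Z w)) (h1 : ∀ w τ, c * dist w τ ≤ ‖Z w τ‖)
    (h2 : ∀ w w' τ, ‖Z w τ - Z w' τ‖ ≤ C * dist w w') :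
    IsKernel α (C / c * c ^ (-α)) (rieszKernel α Z) := by
  have hC := hc.trans_le hcC
  have hca := Real.rpow_pos_of_pos hc (-α)
  refine ⟨fun w => ?_, fun w τ hw => ?_, fun w w' τ hw hw' => ?_⟩
  · exact Complex.measurable_ofReal.comp ((hm w).norm.pow_const _)
  · have hd : 0 < dist w τ := dist_pos.mpr hw
    rw [rieszKernel, Complex.norm_real, Real.norm_of_nonneg (by positivity)]
    calc ‖Z w τ‖ ^ (-α) ≤ (c * dist w τ) ^ (-α) :=
          Real.rpow_le_rpow_of_nonpos (by positivity) (h1 w τ) (by linarith [hα.1])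
      _ = 1 * c ^ (-α) * dist w τ ^ (-α) := by rw [Real.mul_rpow hc.le hd.le, one_mul]
      _ ≤ _ := by
          gcongr
          rwa [one_le_div hc]
  · have hd : 0 < dist w τ := dist_pos.mpr hw
    have hd' : 0 < dist w' τ := dist_pos.mpr hw'
    have hZ : 0 < ‖Z w τ‖ := (by positivity : 0 < c * dist w τ).trans_le (h1 w τ)
    have hZ' : 0 < ‖Z w' τ‖ := (by positivity : 0 < c * dist w' τ).trans_le (h1 w' τ)
    rw [rieszKernel, rieszKernel, ← Complex.ofReal_sub, Complex.norm_real, Real.norm_eq_abs]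
    refine (abs_rpow_neg_sub_le hα hZ hZ'
      ((abs_norm_sub_norm_le _ _).trans (h2 w w' τ))).trans ?_
    rw [mul_add]
    exact add_le_add (bump_mul_le hα.1.le hc hcC dist_nonneg hd (h1 w τ))
      (bump_mul_le hα.1.le hc hcC dist_nonneg hd' (h1 w' τ))

/-- A bounded multiplier of weakly singular kernels. -/
structure IsMult (B : ℝ) (m : Circle → Circle → ℂ) : Prop where
  measurable : ∀ w, Measurable (m w)
  bound : ∀ w τ, w ≠ τ → ‖m w τ‖ ≤ B
  diff : ∀ w w' τ, w ≠ τ → w' ≠ τ →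
    ‖m w τ - m w' τ‖ ≤ B * (dist w w' / (dist w' τ + dist w w'))

/-- Write `Km - K'm' = (K - K')m + K'(m - m')`. The product of `d^{-α}` and `δ / (d + δ)` is exactly
`bump`, which explains the form of the increment bound in `IsMult`. -/
lemma IsKernel.mul {α A B : ℝ} (hA : 0 ≤ A) (hB : 0 ≤ B) {K m : Circle → Circle → ℂ}
    (hK : IsKernel α A K) (hm : IsMult B m) :
    IsKernel α (2 * A * B) fun w τ => K w τ * m w τ := by
  refine ⟨fun w => (hK.measurable w).mul (hm.measurable w), fun w τ hw => ?_,
    fun w w' τ hw hw' => ?_⟩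
  · have hd : 0 ≤ dist w τ ^ (-α) := by positivity
    rw [norm_mul]
    calc ‖K w τ‖ * ‖m w τ‖ ≤ A * dist w τ ^ (-α) * B := by
          gcongr
          exacts [hK.bound w τ hw, hm.bound w τ hw]
      _ ≤ _ := by nlinarith [mul_nonneg (mul_nonneg hA hB) hd]
  · have h1 := hK.diff w w' τ hw hw'
    have hd' : 0 < dist w' τ := dist_pos.mpr hw'
    have hb := bump_nonneg (α := α) (δ := dist w w') dist_nonneg (dist_nonneg (x := w) (y := τ))
    set b := bump α (dist w w') (dist w τ)
    set b' := bump α (dist w w') (dist w' τ) with hb'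
    have e : dist w' τ ^ (-α) * (dist w w' / (dist w' τ + dist w w')) = b' := by
      rw [hb', bump, Real.rpow_neg hd'.le]
      have := Real.rpow_pos_of_pos hd' α
      field_simp
    calc ‖K w τ * m w τ - K w' τ * m w' τ‖
        = ‖(K w τ - K w' τ) * m w τ + K w' τ * (m w τ - m w' τ)‖ := by congr 1; ring
      _ ≤ ‖K w τ - K w' τ‖ * ‖m w τ‖ + ‖K w' τ‖ * ‖m w τ - m w' τ‖ := by
          refine (norm_add_le _ _).trans_eq ?_
          rw [norm_mul, norm_mul]
      _ ≤ A * (b + b') * B + A * dist w' τ ^ (-α) *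
          (B * (dist w w' / (dist w' τ + dist w w'))) := by
          gcongr
          exacts [(norm_nonneg _).trans h1, hm.bound w τ hw, hK.bound w' τ hw', hm.diff w w' τ hw hw']
      _ = A * (b + b') * B + A * B * b' := by rw [← e]; ring
      _ ≤ 2 * A * B * (b + b') := by nlinarith [mul_nonneg (mul_nonneg hA hB) hb]

/-- The increment of `X/Z` is at most `2κ` trivially, and at most `κ(1 + C)δ / (c d)` by the
quotient rule, with `d = dist w' τ`. Adding these bounds, multiplied by `δ` and `d`, gives the
factor `δ / (d + δ)`. -/
lemma isMult_div {c C κ : ℝ} (hc : 0 < c) (hC : 0 ≤ C) (hκ : 0 ≤ κ) {X Z : Circle → Circle → ℂ}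
    (hXm : ∀ w, Measurable (X w)) (hZm : ∀ w, Measurable (Z w))
    (hZ : ∀ w τ, c * dist w τ ≤ ‖Z w τ‖)
    (hZ' : ∀ w w' τ, ‖Z w τ - Z w' τ‖ ≤ C * dist w w')
    (hX : ∀ w τ, ‖X w τ‖ ≤ κ * ‖Z w τ‖) (hX' : ∀ w w' τ, ‖X w τ - X w' τ‖ ≤ κ * dist w w') :
    IsMult (((1 + C) / c + 2) * κ) fun w τ => X w τ / Z w τ := by
  have hb : ∀ w τ, w ≠ τ → ‖X w τ / Z w τ‖ ≤ κ := by
    intro w τ hw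
    have hd : 0 < dist w τ := dist_pos.mpr hw
    have hZ0 : 0 < ‖Z w τ‖ := (by positivity : 0 < c * dist w τ).trans_le (hZ w τ)
    rw [norm_div, div_le_iff₀ hZ0]
    exact hX w τ
  have hD : 0 ≤ (1 + C) / c := by positivity
  refine ⟨fun w => (hXm w).div (hZm w), fun w τ hw => (hb w τ hw).trans ?_,
    fun w w' τ hw hw' => ?_⟩
  · nlinarith [mul_nonneg hD hκ]
  · have hd : 0 < dist w τ := dist_pos.mpr hw
    have hd' : 0 < dist w' τ := dist_pos.mpr hw'
    have hZ0 : 0 < ‖Z w τ‖ := (by positivity : 0 < c * dist w τ).trans_le (hZ w τ)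
    have hZ0' : 0 < ‖Z w' τ‖ := (by positivity : 0 < c * dist w' τ).trans_le (hZ w' τ)
    have hz := norm_pos_iff.mp hZ0
    have hz' := norm_pos_iff.mp hZ0'
    set v := ‖X w τ / Z w τ - X w' τ / Z w' τ‖ with hv
    have h1 : v ≤ 2 * κ := by
      refine (norm_sub_le _ _).trans ?_
      linarith [hb w τ hw, hb w' τ hw']
    have h2 : v * (c * dist w' τ) ≤ κ * (1 + C) * dist w w' := by
      calc v * (c * dist w' τ) ≤ v * ‖Z w' τ‖ := by
            gcongr
            exact hZ w' τ
        _ = ‖(X w τ - X w' τ) - X w τ / Z w τ * (Z w τ - Z w' τ)‖ := by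
            rw [hv, ← norm_mul]
            congr 1
            field_simp
            ring
        _ ≤ κ * dist w w' + κ * (C * dist w w') := by
            refine (norm_sub_le _ _).trans ?_
            rw [norm_mul]
            gcongr
            exacts [hX' w w' τ, hb w τ hw, hZ' w w' τ]
        _ = _ := by ring
    have hδ := dist_nonneg (x := w) (y := w')
    rw [← mul_div_assoc, le_div_iff₀ (by positivity)]
    have h3 : v * dist w' τ ≤ κ * ((1 + C) / c) * dist w w' := by
      rw [show κ * ((1 + C) / c) * dist w w' = κ * (1 + C) * dist w w' / c by ring, le_div_iff₀ hc]
      linarith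
    nlinarith [mul_le_mul_of_nonneg_right h1 hδ]

lemma IsMult.const_mul_re {B : ℝ} {m : Circle → Circle → ℂ} (hm : IsMult B m) (c : ℝ) :
    IsMult (|c| * B) fun w τ => ((c * (m w τ).re : ℝ) : ℂ) := by
  refine ⟨fun w => ?_, fun w τ hw => ?_, fun w w' τ hw hw' => ?_⟩
  · exact Complex.measurable_ofReal.comp ((Complex.measurable_re.comp (hm.measurable w)).const_mul _)
  · rw [Complex.norm_real, norm_mul, Real.norm_eq_abs]
    gcongr
    exact (Complex.abs_re_le_norm _).trans (hm.bound w τ hw)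
  · rw [← Complex.ofReal_sub, ← mul_sub, ← Complex.sub_re, Complex.norm_real, norm_mul,
      Real.norm_eq_abs, mul_assoc]
    gcongr
    exact (Complex.abs_re_le_norm _).trans (hm.diff w w' τ hw hw')

/-! ### The second order Taylor remainder of the kernel -/

/-- The Taylor remainder of `|1 + q|^{-α}`. -/
noncomputable def taylorRem (α : ℝ) (q : ℂ) : ℝ := ‖1 + q‖ ^ (-α) - 1 + α * q.re

/-- The derivative of `(1 + x)^s - s x` vanishes at `0`, so it is `O(κ)` on `[-κ, κ]`; the mean
value inequality does the rest. -/
lemma exists_taylor_real (s : ℝ) : ∃ K : ℝ, 0 ≤ K ∧ ∃ δ > 0, ∀ κ ≤ δ, ∀ x y : ℝ, |x| ≤ κ → |y| ≤ κ →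
    |((1 + x) ^ s - s * x) - ((1 + y) ^ s - s * y)| ≤ K * κ * |x - y| := by
  have hd : ∀ x : ℝ, |x| < 1 → HasDerivAt (fun x : ℝ => (1 + x) ^ s - s * x)
      (s * (1 + x) ^ (s - 1) - s) x := by
    intro x hx
    have h1 : 1 + x ≠ 0 := by have := abs_lt.mp hx; linarith
    have h2 := ((hasDerivAt_id x).const_add 1).rpow_const (p := s) (Or.inl h1)
    have h3 := (hasDerivAt_id x).const_mul s
    convert! h2.sub h3 using 1
    simp
  have hD : HasDerivAt (fun x : ℝ => s * (1 + x) ^ (s - 1) - s)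
      (s * (1 * (s - 1) * (1 + 0) ^ (s - 1 - 1))) 0 := by
    have h1 : (1 : ℝ) + 0 ≠ 0 := by norm_num
    exact ((((hasDerivAt_id (0 : ℝ)).const_add 1).rpow_const (p := s - 1)
      (Or.inl h1)).const_mul s).sub_const s
  obtain ⟨K, hK⟩ := hD.isBigO_sub.bound
  obtain ⟨δ, hδ, hball⟩ := Metric.eventually_nhds_iff.mp hK
  refine ⟨|K|, abs_nonneg _, min (δ / 2) (1 / 2), by positivity, fun κ hκ x y hx hy => ?_⟩
  have hκ1 : κ < δ := lt_of_le_of_lt (hκ.trans (min_le_left _ _)) (by linarith)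
  have hκ2 : κ < 1 := lt_of_le_of_lt (hκ.trans (min_le_right _ _)) (by norm_num)
  have h := Convex.norm_image_sub_le_of_norm_hasDerivWithin_le
    (f := fun x : ℝ => (1 + x) ^ s - s * x) (s := Icc (-κ) κ) (C := |K| * κ)
    (fun z hz => (hd z ((abs_le.mpr hz).trans_lt hκ2)).hasDerivWithinAt)
    (fun z hz => by
      have hz' : |z| ≤ κ := abs_le.mpr hz
      have := hball (y := z) (by rw [Real.dist_eq, sub_zero]; exact hz'.trans_lt hκ1)
      simp only [add_zero, Real.one_rpow, mul_one, sub_self, sub_zero] at this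
      refine this.trans ?_
      rw [Real.norm_eq_abs]
      have h5 := le_abs_self K
      have h6 := abs_nonneg z
      calc K * |z| ≤ |K| * |z| := by gcongr
        _ ≤ _ := by gcongr)
    (convex_Icc _ _) (abs_le.mp hy) (abs_le.mp hx)
  exact h

/-- With `x = 2 Re q + |q|²` one has `|1 + q|^{-α} = (1 + x)^{-α/2}`, reducing the claim to one real
variable. Differences are estimated, and not only values, so that the remainder can serve as a
multiplier. -/
lemma exists_taylorRem (α : ℝ) : ∃ K : ℝ, 0 ≤ K ∧ ∃ δ > 0, ∀ κ ≤ δ, ∀ p q : ℂ, ‖p‖ ≤ κ → ‖q‖ ≤ κ →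
    |taylorRem α p - taylorRem α q| ≤ K * κ * ‖p - q‖ := by
  obtain ⟨K, hK, δ, hδ, h⟩ := exists_taylor_real (-(α / 2))
  -- `12 = 3 · 4`: `|x| ≤ 3κ`, and `x` has Lipschitz constant `4` in `q` when `κ ≤ 1`. The term
  -- `|α|` pays for `α/2 · |q|²`.
  refine ⟨12 * K + |α|, by positivity, min (δ / 3) 1, by positivity, fun κ hκ p q hp hq => ?_⟩
  have hκδ : 3 * κ ≤ δ := by have := hκ.trans (min_le_left _ _); linarith
  have hκ1 : κ ≤ 1 := hκ.trans (min_le_right _ _)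
  have hκ0 : 0 ≤ κ := (norm_nonneg _).trans hp
  have hsq : ∀ z : ℂ, ‖1 + z‖ ^ 2 = 1 + (2 * z.re + ‖z‖ ^ 2) := by
    intro z
    rw [← Complex.normSq_eq_norm_sq, ← Complex.normSq_eq_norm_sq, Complex.normSq_apply,
      Complex.normSq_apply]
    simp only [Complex.add_re, Complex.one_re, Complex.add_im, Complex.one_im]
    ring
  have hT : ∀ z : ℂ, taylorRem α z = ((1 + (2 * z.re + ‖z‖ ^ 2)) ^ (-(α / 2)) -
      -(α / 2) * (2 * z.re + ‖z‖ ^ 2)) - 1 - α / 2 * ‖z‖ ^ 2 := by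
    intro z
    rw [← hsq, taylorRem, ← Real.rpow_two, ← Real.rpow_mul (norm_nonneg _),
      show (2 : ℝ) * -(α / 2) = -α by ring]
    ring
  have hx : ∀ z : ℂ, ‖z‖ ≤ κ → |2 * z.re + ‖z‖ ^ 2| ≤ 3 * κ := by
    intro z hz
    have h1 := abs_le.mp ((Complex.abs_re_le_norm z).trans hz)
    have h2 : ‖z‖ ^ 2 ≤ κ := by nlinarith [norm_nonneg z]
    rw [abs_le]
    constructor <;> nlinarith [sq_nonneg ‖z‖]
  have hn : |‖p‖ ^ 2 - ‖q‖ ^ 2| ≤ 2 * κ * ‖p - q‖ := by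
    rw [sq_sub_sq, abs_mul, abs_of_nonneg (by positivity : 0 ≤ ‖p‖ + ‖q‖)]
    have := abs_norm_sub_norm_le p q
    gcongr
    linarith
  have hre : |p.re - q.re| ≤ ‖p - q‖ := by
    rw [← Complex.sub_re]; exact Complex.abs_re_le_norm _
  have hmain := h (3 * κ) hκδ _ _ (hx p hp) (hx q hq)
  have hdiff : |(2 * p.re + ‖p‖ ^ 2) - (2 * q.re + ‖q‖ ^ 2)| ≤ 4 * ‖p - q‖ := by
    rw [show (2 * p.re + ‖p‖ ^ 2) - (2 * q.re + ‖q‖ ^ 2) =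
      2 * (p.re - q.re) + (‖p‖ ^ 2 - ‖q‖ ^ 2) by ring]
    refine (abs_add_le _ _).trans ?_
    rw [abs_mul, abs_two]
    nlinarith [norm_nonneg (p - q)]
  rw [hT, hT]
  set a := (1 + (2 * p.re + ‖p‖ ^ 2)) ^ (-(α / 2)) - -(α / 2) * (2 * p.re + ‖p‖ ^ 2)
  set b := (1 + (2 * q.re + ‖q‖ ^ 2)) ^ (-(α / 2)) - -(α / 2) * (2 * q.re + ‖q‖ ^ 2)
  calc |a - 1 - α / 2 * ‖p‖ ^ 2 - (b - 1 - α / 2 * ‖q‖ ^ 2)|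
      = |(a - b) - α / 2 * (‖p‖ ^ 2 - ‖q‖ ^ 2)| := by congr 1; ring
    _ ≤ |a - b| + |α| / 2 * |‖p‖ ^ 2 - ‖q‖ ^ 2| := by
        refine (abs_sub _ _).trans_eq ?_
        rw [abs_mul, abs_div, abs_two]
    _ ≤ K * (3 * κ) * (4 * ‖p - q‖) + |α| / 2 * (2 * κ * ‖p - q‖) := by
        gcongr
        exact hmain.trans (by gcongr)
    _ = _ := by ring

end VState

namespace VState

/-! ### The interaction of two boundaries -/

/-- The difference of a point of the first boundary and a point of the second. -/
def gap (γ β : ℝ) (f g : Circle → ℂ) (w τ : Circle) : ℂ := perturb γ f w - perturb β g τ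

/-- The interaction `conj (D φ(w)) ∫ D ψ(τ) / |φ(w) - ψ(τ)|^α dτ` of the boundaries `φ = γ Id + f`
and `ψ = β Id + g`. -/
noncomputable def inter (α γ β : ℝ) (f g : Circle → ℂ) (w : Circle) : ℂ :=
  conj ((γ : ℂ) * w + tder f w) *
    kint (rieszKernel α (gap γ β f g)) (fun τ => (β : ℂ) * τ + tder g τ) w

/-- The kernel for unperturbed circles. -/
noncomputable def baseKernel (α γ β : ℝ) : Circle → Circle → ℂ :=
  rieszKernel α fun w τ => (γ : ℂ) * w - β * τ

/-- The relative perturbation of the difference of two boundary points. -/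
noncomputable def relGap (γ β : ℝ) (f g : Circle → ℂ) (w τ : Circle) : ℂ :=
  (f w - g τ) / ((γ : ℂ) * w - β * τ)

/-- The linearization of the kernel. -/
noncomputable def linKernel (α γ β : ℝ) (f g : Circle → ℂ) (w τ : Circle) : ℂ :=
  baseKernel α γ β w τ * ((-α * (relGap γ β f g w τ).re : ℝ) : ℂ)

/-- The second order remainder of the kernel. -/
noncomputable def remKernel (α γ β : ℝ) (f g : Circle → ℂ) (w τ : Circle) : ℂ :=
  baseKernel α γ β w τ * ((taylorRem α (relGap γ β f g w τ) : ℝ) : ℂ)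

/-- The linearization of the interaction. -/
noncomputable def linInter (α γ β : ℝ) (f g : Circle → ℂ) (w : Circle) : ℂ :=
  conj (tder f w) * kint (baseKernel α γ β) (fun τ => (β : ℂ) * τ) w +
    conj ((γ : ℂ) * w) * kint (baseKernel α γ β) (tder g) w +
    conj ((γ : ℂ) * w) * kint (linKernel α γ β f g) (fun τ => (β : ℂ) * τ) w

lemma continuous_const_mul_coe (β : ℝ) : Continuous fun τ : Circle => (β : ℂ) * τ :=
  continuous_const.mul continuous_circle_coe

lemma norm_const_mul_coe {β : ℝ} (hβ : 0 < β) (τ : Circle) : ‖(β : ℂ) * τ‖ = β := by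
  rw [norm_mul, Circle.norm_coe, mul_one, Complex.norm_real, Real.norm_of_nonneg hβ.le]

variable {α γ β : ℝ}

lemma norm_base_sub_le (hγ : 0 < γ) (w w' τ : Circle) :
    ‖((γ : ℂ) * w - β * τ) - ((γ : ℂ) * w' - β * τ)‖ ≤ (√(γ * β) + γ) * dist w w' := by
  rw [sub_sub_sub_cancel_right, ← mul_sub, norm_mul, ← dist_eq_norm_coe, Complex.norm_real,
    Real.norm_of_nonneg hγ.le]
  have := Real.sqrt_nonneg (γ * β)
  gcongr
  linarith

lemma exists_isKernel_base (hα : α ∈ Ioo (0 : ℝ) 1) (hγ : 0 < γ) (hβ : 0 < β) :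
    ∃ A, 0 ≤ A ∧ IsKernel α A (baseKernel α γ β) := by
  have hc : 0 < √(γ * β) := by positivity
  exact ⟨_, by positivity, isKernel_riesz hα hc (C := √(γ * β) + γ) (by linarith)
    (fun w => (continuous_const.sub (continuous_const_mul_coe β)).measurable)
    (sqrt_mul_dist_le hγ hβ) (norm_base_sub_le hγ)⟩

/-- The perturbations are compatible with constant `M`: the relative perturbation of the differences
of the boundary points is at most `M ε`. -/
def Compat (γ β M ε : ℝ) (f g : Car α) : Prop :=
  ‖f‖ ≤ ε ∧ ‖g‖ ≤ ε ∧ ∀ w τ, ‖f w - g τ‖ ≤ M * ε * ‖(γ : ℂ) * w - β * τ‖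

lemma exists_isMult_relGap (α : ℝ) (hγ : 0 < γ) (hβ : 0 < β) {M : ℝ} (hM : 0 ≤ M) :
    ∃ D, 0 ≤ D ∧ ∀ (f g : Car α) (ε : ℝ), Compat γ β M ε f g → IsMult (D * ε) (relGap γ β f g) := by
  have hc : 0 < √(γ * β) := by positivity
  -- In `M + 2`, the number `M` bounds the quotient and `2` is the Lipschitz constant of `f`
  -- relative to its norm.
  refine ⟨((1 + (√(γ * β) + γ)) / √(γ * β) + 2) * (M + 2), by positivity, fun f g ε h => ?_⟩
  obtain ⟨hf, hg, hX⟩ := h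
  have hε : 0 ≤ ε := (norm_nonneg _).trans hf
  rw [mul_assoc]
  refine isMult_div (X := fun w τ => f w - g τ) hc (by positivity) (by positivity)
    (fun w => (continuous_const.sub g.toC.continuous).measurable)
    (fun w => (continuous_const.sub (continuous_const_mul_coe β)).measurable)
    (sqrt_mul_dist_le hγ hβ) (norm_base_sub_le hγ) (fun w τ => (hX w τ).trans ?_)
    fun w w' τ => ?_
  · gcongr
    linarith
  · rw [sub_sub_sub_cancel_right]
    refine (f.norm_sub_le w w').trans ?_
    gcongr
    nlinarith [mul_nonneg hM hε]

lemma norm_relGap_le (hγ : 0 < γ) (hβ : 0 < β) {M ε : ℝ} {f g : Car α} (h : Compat γ β M ε f g)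
    {w τ : Circle} (hw : w ≠ τ) : ‖relGap γ β f g w τ‖ ≤ M * ε := by
  have hd : 0 < dist w τ := dist_pos.mpr hw
  have hc : 0 < √(γ * β) := by positivity
  have hz : 0 < ‖(γ : ℂ) * w - β * τ‖ :=
    (by positivity : 0 < √(γ * β) * dist w τ).trans_le (sqrt_mul_dist_le hγ hβ w τ)
  rw [relGap, norm_div, div_le_iff₀ hz]
  exact h.2.2 w τ

lemma exists_isKernel_lin (hα : α ∈ Ioo (0 : ℝ) 1) (hγ : 0 < γ) (hβ : 0 < β) {M : ℝ} (hM : 0 ≤ M) :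
    ∃ A, 0 ≤ A ∧ ∀ (f g : Car α) (ε : ℝ), Compat γ β M ε f g →
      IsKernel α (A * ε) (linKernel α γ β f g) := by
  obtain ⟨A, hA, hK⟩ := exists_isKernel_base hα hγ hβ
  obtain ⟨D, hD, hm⟩ := exists_isMult_relGap α hγ hβ hM
  refine ⟨2 * A * (|-α| * D), by positivity, fun f g ε h => ?_⟩
  have hε : 0 ≤ ε := (norm_nonneg _).trans h.1
  have := hK.mul hA (by positivity) ((hm f g ε h).const_mul_re (-α))
  rwa [show 2 * A * (|-α| * (D * ε)) = 2 * A * (|-α| * D) * ε by ring] at this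

lemma measurable_taylorRem : Measurable (taylorRem α) := by
  unfold taylorRem
  have := Complex.measurable_re
  fun_prop

lemma taylorRem_zero : taylorRem α 0 = 0 := by simp [taylorRem]

/-- The increments of the Taylor remainder are `O(ε)` times those of `q`, which are themselves
`O(ε)`; taking `0` as the second point gives the size as well. -/
lemma exists_isKernel_rem (hα : α ∈ Ioo (0 : ℝ) 1) (hγ : 0 < γ) (hβ : 0 < β) {M : ℝ} (hM : 0 < M) :
    ∃ A, 0 ≤ A ∧ ∃ δ > 0, ∀ (f g : Car α) (ε : ℝ), ε ≤ δ → Compat γ β M ε f g →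
      IsKernel α (A * ε ^ 2) (remKernel α γ β f g) := by
  obtain ⟨A, hA, hK⟩ := exists_isKernel_base hα hγ hβ
  obtain ⟨D, hD, hm⟩ := exists_isMult_relGap α hγ hβ hM.le
  obtain ⟨C, hC, δ, hδ, hT⟩ := exists_taylorRem α
  refine ⟨2 * A * (C * M * D), by positivity, δ / M, by positivity, fun f g ε hεδ h => ?_⟩
  have hε : 0 ≤ ε := (norm_nonneg _).trans h.1
  have hκ : M * ε ≤ δ := by rwa [mul_comm, ← le_div_iff₀ hM]
  have hq := hm f g ε h
  have hmult : IsMult (C * (M * ε) * (D * ε))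
      fun w τ => ((taylorRem α (relGap γ β f g w τ) : ℝ) : ℂ) := by
    refine ⟨fun w => Complex.measurable_ofReal.comp (measurable_taylorRem.comp (hq.measurable w)),
      fun w τ hw => ?_, fun w w' τ hw hw' => ?_⟩
    · have h1 := hT (M * ε) hκ _ 0 (norm_relGap_le hγ hβ h hw) (by simp; positivity)
      rw [taylorRem_zero, sub_zero, sub_zero] at h1
      rw [Complex.norm_real]
      refine h1.trans ?_
      gcongr
      exact hq.bound w τ hw
    · have h1 := hT (M * ε) hκ _ _ (norm_relGap_le hγ hβ h hw) (norm_relGap_le hγ hβ h hw')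
      rw [← Complex.ofReal_sub, Complex.norm_real, mul_assoc _ (D * ε)]
      refine h1.trans ?_
      gcongr
      exact hq.diff w w' τ hw hw'
  have := hK.mul hA (by positivity) hmult
  rwa [show 2 * A * (C * (M * ε) * (D * ε)) = 2 * A * (C * M * D) * ε ^ 2 by ring] at this

/-- The kernel is multiplicative under `φ(w) - ψ(τ) = (γw - βτ)(1 + q)`; off the diagonal the
division defining `q` is genuine. -/
lemma riesz_gap_eq (hγ : 0 < γ) (hβ : 0 < β) (f g : Car α) {w τ : Circle} (hw : w ≠ τ) :
    rieszKernel α (gap γ β f g) w τ =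
      baseKernel α γ β w τ + linKernel α γ β f g w τ + remKernel α γ β f g w τ := by
  have hd : 0 < dist w τ := dist_pos.mpr hw
  have hc : 0 < √(γ * β) := by positivity
  have hz : 0 < ‖(γ : ℂ) * w - β * τ‖ :=
    (by positivity : 0 < √(γ * β) * dist w τ).trans_le (sqrt_mul_dist_le hγ hβ w τ)
  have hz0 := norm_pos_iff.mp hz
  have e : gap γ β f g w τ = ((γ : ℂ) * w - β * τ) * (1 + relGap γ β f g w τ) := by
    rw [relGap, gap, perturb, perturb]
    field_simp
    ring
  rw [linKernel, remKernel, baseKernel, rieszKernel, rieszKernel, e, norm_mul,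
    Real.mul_rpow (norm_nonneg _) (norm_nonneg _), taylorRem]
  push_cast
  ring

section kint

variable {A A' B : ℝ} {K K' : Circle → Circle → ℂ} {u v : Circle → ℂ}

lemma kint_add_right (hα : α ∈ Ioo (0 : ℝ) 1) (hK : IsKernel α A K) (hu : Continuous u)
    (hv : Continuous v) (w : Circle) :
    kint K (fun τ => u τ + v τ) w = kint K u w + kint K v w := by
  obtain ⟨B, hB⟩ := isCompact_univ.exists_bound_of_continuousOn hu.continuousOn
  obtain ⟨B', hB'⟩ := isCompact_univ.exists_bound_of_continuousOn hv.continuousOn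
  rw [kint, kint, kint, ← integral_add
    (hK.integrable hα hu.measurable (fun w => hB w (mem_univ _)) w)
    (hK.integrable hα hv.measurable (fun w => hB' w (mem_univ _)) w)]
  simp only [mul_add]

lemma kint_add_left (hα : α ∈ Ioo (0 : ℝ) 1) (hK : IsKernel α A K) (hK' : IsKernel α A' K')
    (hu : Continuous u) (w : Circle) :
    kint (fun w τ => K w τ + K' w τ) u w = kint K u w + kint K' u w := by
  obtain ⟨B, hB⟩ := isCompact_univ.exists_bound_of_continuousOn hu.continuousOn
  rw [kint, kint, kint, ← integral_add
    (hK.integrable hα hu.measurable (fun w => hB w (mem_univ _)) w)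
    (hK'.integrable hα hu.measurable (fun w => hB w (mem_univ _)) w)]
  simp only [add_mul]

lemma kint_inv (hK : ∀ w τ, K w⁻¹ τ⁻¹ = conj (K w τ)) (hu : ∀ τ, u τ⁻¹ = conj (u τ)) (w : Circle) :
    kint K u w⁻¹ = conj (kint K u w) := by
  rw [kint, kint, ← integral_conj, ← integral_circ_inv]
  refine integral_congr_ae (ae_of_all _ fun τ => ?_)
  simp only [hK, hu, map_mul]

end kint

lemma IsKernel.add {A A' : ℝ} {K K' : Circle → Circle → ℂ} (hK : IsKernel α A K)
    (hK' : IsKernel α A' K') : IsKernel α (A + A') fun w τ => K w τ + K' w τ := by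
  refine ⟨fun w => (hK.measurable w).add (hK'.measurable w), fun w τ hw => ?_,
    fun w w' τ hw hw' => ?_⟩
  · rw [add_mul]
    exact (norm_add_le _ _).trans (add_le_add (hK.bound w τ hw) (hK'.bound w τ hw))
  · rw [add_sub_add_comm, add_mul]
    exact (norm_add_le _ _).trans (add_le_add (hK.diff w w' τ hw hw') (hK'.diff w w' τ hw hw'))

/-! ### Quadratic estimate of the remainder -/

lemma tder_zero : tder (0 : Circle → ℂ) = 0 := by
  funext w
  simp [tder, circleDeriv_zero]

lemma inter_zero (α γ β : ℝ) (w : Circle) : inter α γ β 0 0 w =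
    conj ((γ : ℂ) * w) * kint (baseKernel α γ β) (fun τ => (β : ℂ) * τ) w := by
  have : gap γ β 0 0 = fun (w τ : Circle) => (γ : ℂ) * w - β * τ := by
    funext w τ
    simp [gap, perturb]
  rw [inter, this, tder_zero]
  simp [baseKernel]

/-- Once the terms of order zero and one are removed, every remaining product contains the quadratic
kernel or two small factors. -/
lemma inter_sub_eq (hα : α ∈ Ioo (0 : ℝ) 1) (hγ : 0 < γ) (hβ : 0 < β) (f g : Car α)
    {A₀ A₁ A₂ : ℝ} (h0 : IsKernel α A₀ (baseKernel α γ β)) (h1 : IsKernel α A₁ (linKernel α γ β f g))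
    (h2 : IsKernel α A₂ (remKernel α γ β f g)) (w : Circle) :
    inter α γ β f g w - inter α γ β 0 0 w - linInter α γ β f g w =
      conj ((γ : ℂ) * w + tder f w) * kint (remKernel α γ β f g) (fun τ => (β : ℂ) * τ + tder g τ) w +
      conj (tder f w) * kint (baseKernel α γ β) (tder g) w +
      conj (tder f w) * kint (linKernel α γ β f g) (fun τ => (β : ℂ) * τ) w +
      conj ((γ : ℂ) * w + tder f w) * kint (linKernel α γ β f g) (tder g) w := by
  have hW0 := continuous_const_mul_coe β
  have hW1 := g.continuous_tder hα
  have hW : Continuous fun τ : Circle => (β : ℂ) * τ + tder g τ := hW0.add hW1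
  have e : kint (rieszKernel α (gap γ β f g)) (fun τ => (β : ℂ) * τ + tder g τ) w =
      kint (fun w τ => (baseKernel α γ β w τ + linKernel α γ β f g w τ) + remKernel α γ β f g w τ)
        (fun τ => (β : ℂ) * τ + tder g τ) w := by
    rw [kint, kint]
    refine integral_congr_ae ?_
    filter_upwards [ae_ne_circ w] with τ hτ
    rw [riesz_gap_eq hγ hβ f g hτ]
  rw [inter_zero, inter, linInter, e, kint_add_left hα (h0.add h1) h2 hW,
    kint_add_left hα h0 h1 hW, kint_add_right hα h0 hW0 hW1, kint_add_right hα h1 hW0 hW1, map_add]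
  ring

lemma holderBound_affine (hα : α ∈ Ioo (0 : ℝ) 1) (hγ : 0 < γ) (f : Car α) :
    HolderBound α (2 * γ + 4 * ‖f‖) fun w => (γ : ℂ) * w + tder f w :=
  (HolderBound.const_coe hα hγ.le).add (f.holderBound_tder hα)

lemma norm_affine_le (hγ : 0 < γ) (f : Car α) (w : Circle) :
    ‖(γ : ℂ) * w + tder f w‖ ≤ γ + ‖f‖ := by
  refine (norm_add_le _ _).trans ?_
  rw [norm_const_mul_coe hγ]
  gcongr
  exact f.norm_tder_le w

lemma exists_inter_sub_le (hα : α ∈ Ioo (0 : ℝ) 1) (hγ : 0 < γ) (hβ : 0 < β) {M : ℝ} (hM : 0 < M) :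
    ∃ C, 0 ≤ C ∧ ∃ δ > 0, ∀ (f g : Car α) (ε : ℝ), ε ≤ δ → Compat γ β M ε f g →
      HolderBound α (C * ε ^ 2)
        fun w => inter α γ β f g w - inter α γ β 0 0 w - linInter α γ β f g w := by
  obtain ⟨A₀, hA₀, h0⟩ := exists_isKernel_base hα hγ hβ
  obtain ⟨A₁, hA₁, h1⟩ := exists_isKernel_lin hα hγ hβ hM.le
  obtain ⟨A₂, hA₂, δ, hδ, h2⟩ := exists_isKernel_rem hα hγ hβ hM
  have hb := bumpConst_nonneg α
  set N := 4 * bumpConst α with hN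
  -- The bound `ε ≤ 1` keeps the factors `γw + Df` and `βτ + Dg` below fixed constants.
  refine ⟨2 * (2 * γ + 4) * (N * A₂ * (β + 1)) + 2 * 4 * (N * A₀) + 2 * 4 * (N * A₁ * β) +
    2 * (2 * γ + 4) * (N * A₁), by positivity, min δ 1, by positivity, fun f g ε hε h => ?_⟩
  have hε0 : 0 ≤ ε := (norm_nonneg _).trans h.1
  have hε1 : ε ≤ 1 := hε.trans (min_le_right _ _)
  have h1 := h1 f g ε h
  have h2 := h2 f g ε (hε.trans (min_le_left _ _)) h
  simp only [inter_sub_eq hα hγ hβ f g h0 h1 h2]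
  have hf1 := h.1.trans hε1
  have hg1 := h.2.1.trans hε1
  have hU : HolderBound α (2 * γ + 4) fun w => conj ((γ : ℂ) * w + tder f w) :=
    ((holderBound_affine hα hγ f).mono (by linarith)).star
  have hU1 : HolderBound α (4 * ε) fun w => conj (tder f w) :=
    ((f.holderBound_tder hα).mono (by linarith [h.1])).star
  have hW0 := continuous_const_mul_coe β
  have hW1 := g.continuous_tder hα
  have k1 := h2.holderBound hα (by positivity) (hW0.add hW1).measurable (B := β + 1)
    fun w => (norm_affine_le hβ g w).trans (by linarith)
  have k2 := h0.holderBound hα hA₀ hW1.measurable (B := ε)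
    fun w => (g.norm_tder_le w).trans h.2.1
  have k3 := h1.holderBound hα (by positivity) hW0.measurable (B := β)
    fun w => (norm_const_mul_coe hβ w).le
  have k4 := h1.holderBound hα (by positivity) hW1.measurable (B := ε)
    fun w => (g.norm_tder_le w).trans h.2.1
  refine ((((hU.mul k1).add (hU1.mul k2)).add (hU1.mul k3)).add (hU.mul k4)).mono (le_of_eq ?_)
  rw [hN]
  ring

lemma exists_linInter_le (hα : α ∈ Ioo (0 : ℝ) 1) (hγ : 0 < γ) (hβ : 0 < β) {M : ℝ} (hM : 0 < M) :
    ∃ C, 0 ≤ C ∧ ∀ (f g : Car α) (ε : ℝ), Compat γ β M ε f g →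
      HolderBound α (C * ε) (linInter α γ β f g) := by
  obtain ⟨A₀, hA₀, h0⟩ := exists_isKernel_base hα hγ hβ
  obtain ⟨A₁, hA₁, h1⟩ := exists_isKernel_lin hα hγ hβ hM.le
  have hb := bumpConst_nonneg α
  set N := 4 * bumpConst α with hN
  refine ⟨2 * 4 * (N * A₀ * β) + 2 * (2 * γ) * (N * A₀) + 2 * (2 * γ) * (N * A₁ * β),
    by positivity, fun f g ε h => ?_⟩
  have hε0 : 0 ≤ ε := (norm_nonneg _).trans h.1
  have h1 := h1 f g ε h
  have hU0 : HolderBound α (2 * γ) fun w : Circle => conj ((γ : ℂ) * w) :=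
    (HolderBound.const_coe hα hγ.le).star
  have hU1 : HolderBound α (4 * ε) fun w => conj (tder f w) :=
    ((f.holderBound_tder hα).mono (by linarith [h.1])).star
  have hW0 := continuous_const_mul_coe β
  have k1 := h0.holderBound hα hA₀ hW0.measurable (B := β) fun w => (norm_const_mul_coe hβ w).le
  have k2 := h0.holderBound hα hA₀ (g.continuous_tder hα).measurable (B := ε)
    fun w => (g.norm_tder_le w).trans h.2.1
  have k3 := h1.holderBound hα (by positivity) hW0.measurable (B := β)
    fun w => (norm_const_mul_coe hβ w).le
  refine (((hU1.mul k1).add (hU0.mul k2)).add (hU0.mul k3)).mono (le_of_eq ?_)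
  rw [hN]
  ring

/-- No expansion is needed for regularity alone: the gap bound from below suffices, so this applies
throughout the neighborhood `V`. -/
lemma exists_holderBound_inter (hα : α ∈ Ioo (0 : ℝ) 1) (hγ : 0 < γ) (hβ : 0 < β) (f g : Car α)
    {c : ℝ} (hc : 0 < c) (h : ∀ w τ, c * dist w τ ≤ ‖gap γ β f g w τ‖) :
    ∃ A, HolderBound α A (inter α γ β f g) := by
  have hcf := norm_nonneg f
  have hK := isKernel_riesz hα hc (C := c + γ + 2 * ‖f‖) (Z := gap γ β f g) (by linarith)
    (fun w => by
      have : Continuous (perturb β g) := (continuous_const_mul_coe β).add g.toC.continuous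
      exact (continuous_const.sub this).measurable) h (fun w w' τ => by
      have e : gap γ β f g w τ - gap γ β f g w' τ = (γ : ℂ) * (w - w') + (f w - f w') := by
        rw [gap, gap, perturb, perturb, perturb]; ring
      rw [e]
      refine (norm_add_le _ _).trans ?_
      rw [norm_mul, ← dist_eq_norm_coe, Complex.norm_real, Real.norm_of_nonneg hγ.le]
      have := f.norm_sub_le w w'
      nlinarith [dist_nonneg (x := w) (y := w')])
  have hW : Continuous fun τ : Circle => (β : ℂ) * τ + tder g τ :=
    (continuous_const_mul_coe β).add (g.continuous_tder hα)
  have hk := hK.holderBound hα (by positivity) hW.measurable (norm_affine_le hβ g)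
  exact ⟨_, (holderBound_affine hα hγ f).star.mul hk⟩

/-! ### Symmetry -/

lemma conj_coe_mul_inv (γ : ℝ) (w : Circle) : (γ : ℂ) * ((w⁻¹ : Circle) : ℂ) = conj ((γ : ℂ) * w) := by
  rw [map_mul, Complex.conj_ofReal, Circle.coe_inv_eq_conj]

/-- The reflection `τ ↦ τ⁻¹` preserves the measure and conjugates all differences, hence leaves the
kernel unchanged. -/
lemma inter_inv (f g : Car α) (w : Circle) : inter α γ β f g w⁻¹ = conj (inter α γ β f g w) := by
  have hp : ∀ (r : ℝ) (h : Car α) (w : Circle), perturb r h w⁻¹ = conj (perturb r h w) := by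
    intro r h w
    rw [perturb, perturb, conj_coe_mul_inv, h.apply_inv, map_add]
  rw [inter, inter, kint_inv, conj_coe_mul_inv, f.tder_inv, ← map_add, map_mul]
  · intro w τ
    rw [rieszKernel, rieszKernel, gap, gap, hp, hp, ← map_sub, Complex.norm_conj,
      Complex.conj_ofReal]
  · intro τ
    rw [conj_coe_mul_inv, g.tder_inv, ← map_add]

lemma baseKernel_inv (w τ : Circle) :
    baseKernel α γ β w⁻¹ τ⁻¹ = conj (baseKernel α γ β w τ) := by
  rw [baseKernel, rieszKernel, rieszKernel, conj_coe_mul_inv, conj_coe_mul_inv, ← map_sub,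
    Complex.norm_conj, Complex.conj_ofReal]

lemma linInter_inv (f g : Car α) (w : Circle) :
    linInter α γ β f g w⁻¹ = conj (linInter α γ β f g w) := by
  rw [linInter, linInter, kint_inv baseKernel_inv (conj_coe_mul_inv β),
    kint_inv baseKernel_inv g.tder_inv, kint_inv (K := linKernel α γ β f g) _ (conj_coe_mul_inv β),
    f.tder_inv, conj_coe_mul_inv]
  · simp only [map_add, map_mul]
  · intro w τ
    rw [linKernel, linKernel, baseKernel_inv, relGap, relGap, conj_coe_mul_inv, conj_coe_mul_inv,
      f.apply_inv, g.apply_inv, ← map_sub, ← map_sub, ← map_div₀, Complex.conj_re, map_mul,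
      Complex.conj_ofReal]

end VState

namespace VState

/-! ### Integration by parts for the Riesz potential -/

variable {α γ β : ℝ}

/-- The profile `|γ - β σ|^{-α}` of the kernel of two concentric circles. -/
noncomputable def profile (α γ β : ℝ) (σ : Circle) : ℝ := ‖(γ : ℂ) - β * σ‖ ^ (-α)

lemma integrable_profile (hα : α ∈ Ioo (0 : ℝ) 1) (hγ : 0 < γ) (hβ : 0 < β) :
    Integrable (profile α γ β) circ := integrable_norm_sub_rpow hα hγ hβ

lemma profile_nonneg (σ : Circle) : 0 ≤ profile α γ β σ := by unfold profile; positivity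

/-- That is, `|sin mθ| ≤ m |sin θ|`. It makes `Im σ · Im σ^m` vanish to second order at `σ = 1`,
compensating the factor `|γ - βσ|^{-2}` below. -/
lemma abs_im_circle_pow_le (σ : Circle) (m : ℕ) : |((σ : ℂ) ^ m).im| ≤ m * |(σ : ℂ).im| := by
  induction m with
  | zero => simp
  | succ m ih =>
    rw [pow_succ, Complex.mul_im]
    have h1 := abs_re_circle_pow_le σ m
    have h2 := abs_re_circle_pow_le σ 1
    rw [pow_one] at h2
    calc _ ≤ |((σ : ℂ) ^ m).re| * |(σ : ℂ).im| + |((σ : ℂ) ^ m).im| * |(σ : ℂ).re| := by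
          rw [← abs_mul, ← abs_mul]; exact abs_add_le _ _
      _ ≤ 1 * |(σ : ℂ).im| + m * |(σ : ℂ).im| * 1 := by gcongr
      _ = _ := by push_cast; ring

lemma mul_abs_im_le (hβ : 0 < β) (σ : Circle) : β * |(σ : ℂ).im| ≤ ‖(γ : ℂ) - β * σ‖ := by
  refine le_trans (le_of_eq ?_) (Complex.abs_im_le_norm _)
  rw [Complex.sub_im, Complex.ofReal_im, Complex.im_ofReal_mul, zero_sub, abs_neg, abs_mul,
    abs_of_pos hβ]

lemma sqrt_mul_abs_im_le (hγ : 0 < γ) (hβ : 0 < β) (σ : Circle) :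
    √(γ * β) * |(σ : ℂ).im| ≤ ‖(γ : ℂ) - β * σ‖ := by
  have h := sqrt_mul_dist_le hγ hβ 1 σ
  rw [Circle.coe_one, mul_one] at h
  refine le_trans ?_ h
  gcongr
  rw [dist_comm, dist_eq_norm_coe]
  refine le_trans (le_of_eq ?_) (Complex.abs_im_le_norm _)
  simp

lemma integrable_profile_div (hα : α ∈ Ioo (0 : ℝ) 1) (hγ : 0 < γ) (hβ : 0 < β) (m : ℕ) :
    Integrable (fun σ : Circle => profile α γ β σ / ‖(γ : ℂ) - β * σ‖ ^ 2 *
      ((σ : ℂ).im * ((σ : ℂ) ^ m).im)) circ := by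
  have hc := continuous_norm_sub_mul γ β
  have hi : ∀ k : ℕ, Measurable fun σ : Circle => ((σ : ℂ) ^ k).im := fun k =>
    (Complex.continuous_im.comp (continuous_circle_coe.pow k)).measurable
  refine Integrable.mono' ((integrable_profile hα hγ hβ).const_mul (m / β ^ 2)) ?_ ?_
  · have h1 := hi 1
    simp only [pow_one] at h1
    exact (((hc.measurable.pow_const _).div (hc.measurable.pow_const _)).mul
      (h1.mul (hi m))).aestronglyMeasurable
  · refine ae_of_all _ fun σ => ?_
    have h1 := mul_abs_im_le (γ := γ) hβ σ
    have h2 := abs_im_circle_pow_le σ m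
    have h3 : |(σ : ℂ).im * ((σ : ℂ) ^ m).im| ≤ m / β ^ 2 * ‖(γ : ℂ) - β * σ‖ ^ 2 := by
      rw [abs_mul]
      calc _ ≤ |(σ : ℂ).im| * (m * |(σ : ℂ).im|) := by gcongr
        _ = m / β ^ 2 * (β * |(σ : ℂ).im|) ^ 2 := by field_simp
        _ ≤ _ := by gcongr
    have hp := profile_nonneg (α := α) (γ := γ) (β := β) σ
    rw [norm_mul, norm_div, Real.norm_of_nonneg hp, Real.norm_of_nonneg (sq_nonneg _),
      Real.norm_eq_abs]
    rcases (norm_nonneg ((γ : ℂ) - β * σ)).eq_or_lt with h0 | h0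
    · rw [← h0]; simp; positivity
    · calc _ ≤ profile α γ β σ / ‖(γ : ℂ) - β * σ‖ ^ 2 * (m / β ^ 2 * ‖(γ : ℂ) - β * σ‖ ^ 2) := by
            gcongr
        _ = _ := by field_simp

lemma integrable_profile_mul_re (hα : α ∈ Ioo (0 : ℝ) 1) (hγ : 0 < γ) (hβ : 0 < β) (m : ℕ) :
    Integrable (fun σ : Circle => profile α γ β σ * ((σ : ℂ) ^ m).re) circ :=
  (integrable_profile hα hγ hβ).mul_bdd (c := 1)
    (continuous_re_circle_pow m).aestronglyMeasurable
    (ae_of_all _ fun σ => abs_re_circle_pow_le σ m)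

lemma coe_exp_pow (θ : ℝ) (m : ℕ) : ((Circle.exp θ : Circle) : ℂ) ^ m =
    (Real.cos (m * θ) : ℂ) + (Real.sin (m * θ) : ℂ) * Complex.I := by
  rw [Circle.coe_exp, ← Complex.exp_nat_mul, Complex.ofReal_cos, Complex.ofReal_sin,
    ← Complex.exp_mul_I]
  push_cast
  ring_nf

lemma exp_pow_re (θ : ℝ) (m : ℕ) : (((Circle.exp θ : Circle) : ℂ) ^ m).re = Real.cos (m * θ) := by
  rw [coe_exp_pow, Complex.add_re, Complex.ofReal_re, Complex.re_ofReal_mul, Complex.I_re, mul_zero,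
    add_zero]

lemma exp_pow_im (θ : ℝ) (m : ℕ) : (((Circle.exp θ : Circle) : ℂ) ^ m).im = Real.sin (m * θ) := by
  rw [coe_exp_pow, Complex.add_im, Complex.ofReal_im, Complex.im_ofReal_mul, Complex.I_im, mul_one,
    zero_add]

lemma exp_im (θ : ℝ) : ((Circle.exp θ : Circle) : ℂ).im = Real.sin θ := by
  have h := exp_pow_im θ 1
  rwa [pow_one, Nat.cast_one, one_mul] at h

lemma norm_sub_exp_sq (γ β θ : ℝ) :
    ‖(γ : ℂ) - β * (Circle.exp θ : Circle)‖ ^ 2 = γ ^ 2 + β ^ 2 - 2 * γ * β * Real.cos θ := by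
  have h1 := exp_pow_re θ 1
  rw [pow_one, Nat.cast_one, one_mul] at h1
  have h2 := Real.sin_sq_add_cos_sq θ
  rw [← Complex.normSq_eq_norm_sq, Complex.normSq_apply]
  simp only [Complex.sub_re, Complex.sub_im, Complex.re_ofReal_mul, Complex.im_ofReal_mul,
    Complex.ofReal_re, Complex.ofReal_im, h1, exp_im]
  linear_combination β ^ 2 * h2

/-- The profile has `θ`-derivative `-αγβ sin θ |γ - βe^{iθ}|^{-α-2}`; integrate the derivative of
profile times `sin mθ`. For `γ = β` the profile blows up at the ends, but the product is `O(|sin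
θ|^{1-α})` and tends to zero. -/
lemma integral_profile_by_parts (hα : α ∈ Ioo (0 : ℝ) 1) (hγ : 0 < γ) (hβ : 0 < β) (m : ℕ) :
    α * γ * β * ∫ σ : Circle, profile α γ β σ / ‖(γ : ℂ) - β * σ‖ ^ 2 *
      ((σ : ℂ).im * ((σ : ℂ) ^ m).im) ∂circ =
    m * ∫ σ : Circle, profile α γ β σ * ((σ : ℂ) ^ m).re ∂circ := by
  have hπ := Real.pi_pos
  set F : Circle → ℝ := fun σ => m * (profile α γ β σ * ((σ : ℂ) ^ m).re) -
    α * γ * β * (profile α γ β σ / ‖(γ : ℂ) - β * σ‖ ^ 2 * ((σ : ℂ).im * ((σ : ℂ) ^ m).im)) with hF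
  have hFi : Integrable F circ := ((integrable_profile_mul_re hα hγ hβ m).const_mul _).sub
    ((integrable_profile_div hα hγ hβ m).const_mul _)
  suffices h : ∫ σ, F σ ∂circ = 0 by
    rw [hF, integral_sub ((integrable_profile_mul_re hα hγ hβ m).const_mul _)
      ((integrable_profile_div hα hγ hβ m).const_mul _), integral_const_mul,
      integral_const_mul] at h
    linarith
  set Φ : ℝ → ℝ := fun θ => profile α γ β (Circle.exp θ) * Real.sin (m * θ) with hΦ
  have hbound : ∀ θ, ‖Φ θ‖ ≤ m * √(γ * β) ^ (-α) * |Real.sin θ| ^ (1 - α) := by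
    intro θ
    have h1 : |Real.sin (m * θ)| ≤ m * |Real.sin θ| := by
      rw [← exp_pow_im, ← exp_im]; exact abs_im_circle_pow_le _ _
    rw [hΦ, norm_mul, Real.norm_of_nonneg (profile_nonneg _), Real.norm_eq_abs]
    rcases (abs_nonneg (Real.sin θ)).eq_or_lt with h0 | h0
    · rw [← h0, mul_zero] at h1
      rw [le_antisymm h1 (abs_nonneg _), mul_zero]
      positivity
    · have hc : 0 < √(γ * β) := by positivity
      have h2 := sqrt_mul_abs_im_le hγ hβ (Circle.exp θ)
      rw [exp_im] at h2
      have h3 : profile α γ β (Circle.exp θ) ≤ (√(γ * β) * |Real.sin θ|) ^ (-α) :=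
        Real.rpow_le_rpow_of_nonpos (by positivity) h2 (by linarith [hα.1])
      calc _ ≤ (√(γ * β) * |Real.sin θ|) ^ (-α) * (m * |Real.sin θ|) := by gcongr
        _ = _ := by
          rw [Real.mul_rpow hc.le h0.le, show 1 - α = -α + 1 by ring, Real.rpow_add_one h0.ne']
          ring
  have hlim : ∀ (θ₀ : ℝ), Real.sin θ₀ = 0 → Tendsto Φ (𝓝 θ₀) (𝓝 0) := by
    intro θ₀ h0
    refine squeeze_zero_norm hbound ?_
    have hc : Continuous fun θ : ℝ => m * √(γ * β) ^ (-α) * |Real.sin θ| ^ (1 - α) :=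
      continuous_const.mul ((Real.continuous_sin.abs).rpow_const
        fun _ => Or.inr (by linarith [hα.2]))
    have := hc.tendsto θ₀
    rwa [h0, abs_zero, Real.zero_rpow (by linarith [hα.2] : 1 - α ≠ 0), mul_zero] at this
  have hderiv : ∀ θ ∈ Ioo 0 (2 * π), HasDerivAt Φ (F (Circle.exp θ)) θ := by
    intro θ hθ
    set s : ℝ → ℝ := fun θ => γ ^ 2 + β ^ 2 - 2 * γ * β * Real.cos θ with hs
    -- Only the end points have `cos θ = 1`, so the profile is differentiable inside even when `γ =
    -- β`.
    have hcos : Real.cos θ < 1 := by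
      refine lt_of_le_of_ne (Real.cos_le_one θ) fun h => ?_
      obtain ⟨k, hk⟩ := (Real.cos_eq_one_iff θ).mp h
      have h1 : (0 : ℝ) < k := by
        have := hθ.1; rw [← hk] at this
        exact pos_of_mul_pos_left this (by positivity)
      have h2 : (k : ℝ) < 1 := by
        have := hθ.2; rw [← hk] at this
        have h3 : (k : ℝ) * (2 * π) < 1 * (2 * π) := by linarith
        exact lt_of_mul_lt_mul_right h3 (by positivity)
      have h1' : (0 : ℤ) < k := by exact_mod_cast h1
      have h2' : k < (1 : ℤ) := by exact_mod_cast h2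
      omega
    have hspos : 0 < s θ := by
      have : 0 < 2 * γ * β * (1 - Real.cos θ) := by
        have : 0 < 1 - Real.cos θ := by linarith
        positivity
      nlinarith [sq_nonneg (γ - β)]
    have hprof : ∀ θ, profile α γ β (Circle.exp θ) = s θ ^ (-(α / 2)) := by
      intro θ
      rw [profile, hs]
      simp only
      rw [← norm_sub_exp_sq, ← Real.rpow_two, ← Real.rpow_mul (norm_nonneg _)]
      congr 1
      ring
    have hsd : HasDerivAt s (2 * γ * β * Real.sin θ) θ := by
      have := ((Real.hasDerivAt_cos θ).const_mul (2 * γ * β)).const_sub (γ ^ 2 + β ^ 2)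
      convert! this using 1
      ring
    have hsin : HasDerivAt (fun θ : ℝ => Real.sin (m * θ)) (Real.cos (m * θ) * m) θ := by
      have := ((hasDerivAt_id θ).const_mul (m : ℝ)).sin
      simpa using this
    have hd := (hsd.rpow_const (p := -(α / 2)) (Or.inl hspos.ne')).mul hsin
    have e : Φ = (fun y => s y ^ (-(α / 2))) * fun θ : ℝ => Real.sin (m * θ) := by
      funext θ
      rw [hΦ]
      simp only [hprof, Pi.mul_apply]
    rw [e]
    convert! hd using 1
    simp only [hF]
    rw [hprof, norm_sub_exp_sq, exp_pow_re, exp_pow_im, exp_im, Real.rpow_sub_one hspos.ne']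
    change _ - α * γ * β * (s θ ^ (-(α / 2)) / s θ * _) = _
    ring
  have hint : IntervalIntegrable (fun θ => F (Circle.exp θ)) volume 0 (2 * π) := by
    rw [intervalIntegrable_iff_integrableOn_Ioc_of_le (by positivity)]
    simpa using (integrable_circ_iff 0 hFi.aestronglyMeasurable).mp hFi
  rw [integral_circ, intervalIntegral.integral_eq_sub_of_hasDerivAt_of_tendsto (by positivity) hderiv
    hint ((hlim 0 Real.sin_zero).mono_left nhdsWithin_le_nhds)
    ((hlim (2 * π) Real.sin_two_pi).mono_left nhdsWithin_le_nhds)]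
  simp

end VState

namespace VState

/-! ### Fourier coefficients of the linearized interaction -/

variable {α γ β : ℝ}

lemma conj_zpow_circle (τ : Circle) (k : ℤ) : conj ((τ : ℂ) ^ k) = (τ : ℂ) ^ (-k) := by
  rw [map_zpow₀, ← Circle.coe_inv_eq_conj, Circle.coe_inv, inv_zpow']

lemma inv_zpow_circle (τ : Circle) (k : ℤ) : ((τ⁻¹ : Circle) : ℂ) ^ k = conj ((τ : ℂ) ^ k) := by
  rw [conj_zpow_circle, Circle.coe_inv, inv_zpow']

/-- The pairing of a function on the circle with `w^{n+1} - w̄^{n+1}`. -/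
noncomputable def pairing (n : ℕ) (u : Circle → ℂ) : ℂ :=
  ∫ w, u w * ((w : ℂ) ^ ((n : ℤ) + 1) - (w : ℂ) ^ (-((n : ℤ) + 1))) ∂circ

lemma continuous_test (n : ℕ) :
    Continuous fun w : Circle => (w : ℂ) ^ ((n : ℤ) + 1) - (w : ℂ) ^ (-((n : ℤ) + 1)) :=
  (continuous_circle_zpow _).sub (continuous_circle_zpow _)

lemma norm_test_le (n : ℕ) (w : Circle) :
    ‖(w : ℂ) ^ ((n : ℤ) + 1) - (w : ℂ) ^ (-((n : ℤ) + 1))‖ ≤ 2 := by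
  refine (norm_sub_le _ _).trans ?_
  rw [norm_circle_zpow, norm_circle_zpow]
  norm_num

lemma integrable_mul_zpow_circ {u : Circle → ℂ} (hu : Continuous u) (k : ℤ) :
    Integrable (fun w : Circle => u w * (w : ℂ) ^ k) circ :=
  integrable_circ_of_continuous (hu.mul (continuous_circle_zpow k))

lemma pairing_add {u v : Circle → ℂ} (hu : Continuous u) (hv : Continuous v) (n : ℕ) :
    pairing n (fun w => u w + v w) = pairing n u + pairing n v := by
  simp only [pairing, add_mul]
  exact integral_add (integrable_circ_of_continuous (hu.mul (continuous_test n)))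
    (integrable_circ_of_continuous (hv.mul (continuous_test n)))

lemma pairing_eq_sub {u : Circle → ℂ} (hu : Continuous u) (n : ℕ) :
    pairing n u = (∫ w, u w * (w : ℂ) ^ ((n : ℤ) + 1) ∂circ) -
      ∫ w, u w * (w : ℂ) ^ (-((n : ℤ) + 1)) ∂circ := by
  simp only [pairing, mul_sub]
  exact integral_sub (integrable_mul_zpow_circ hu _) (integrable_mul_zpow_circ hu _)

/-- The symmetry identifies the Fourier coefficients of `conj u` with the reflected ones of `u`, so
the sine coefficients of `Im u` come from pairing `u` itself. -/
lemma sineCoeff_im {u : Circle → ℂ} (hu : Continuous u) (hs : ∀ w, u w⁻¹ = conj (u w)) (n : ℕ) :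
    (sineCoeff (fun w => (u w).im) (n + 1) : ℂ) = pairing n u := by
  have hodd : ∀ w, (u w⁻¹).im = -(u w).im := fun w => by rw [hs, Complex.conj_im]
  have hi : Continuous fun w => (u w).im := Complex.continuous_im.comp hu
  rw [sineCoeff_eq hi hodd, pairing_eq_sub hu]
  have h1 : ∫ w, conj (u w) * (w : ℂ) ^ (-((n : ℤ) + 1)) ∂circ =
      ∫ w, u w * (w : ℂ) ^ ((n : ℤ) + 1) ∂circ := by
    rw [← integral_circ_inv]
    refine integral_congr_ae (ae_of_all _ fun w => ?_)
    simp only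
    rw [hs, Complex.conj_conj, inv_zpow_circle, conj_zpow_circle, neg_neg]
  have h2 : ∀ w : Circle, ((u w).im : ℂ) * (w : ℂ) ^ (-((n + 1 : ℕ) : ℤ)) = (2 * Complex.I)⁻¹ *
      (u w * (w : ℂ) ^ (-((n : ℤ) + 1)) - conj (u w) * (w : ℂ) ^ (-((n : ℤ) + 1))) := by
    intro w
    rw [← sub_mul, Complex.sub_conj]
    have := Complex.I_ne_zero
    push_cast
    field_simp
  simp only [h2]
  rw [integral_const_mul, integral_sub (integrable_mul_zpow_circ hu _) (integrable_mul_zpow_circ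
    (u := fun w => conj (u w)) (Complex.continuous_conj.comp hu) _), h1]
  have := Complex.I_ne_zero
  field_simp
  ring

lemma integral_eq_ofReal_integral_re {h : Circle → ℂ} (hi : Integrable h circ)
    (hs : ∀ σ, h σ⁻¹ = conj (h σ)) : ∫ σ, h σ ∂circ = ((∫ σ, (h σ).re ∂circ : ℝ) : ℂ) := by
  have h1 : conj (∫ σ, h σ ∂circ) = ∫ σ, h σ ∂circ := by
    rw [← integral_conj, ← integral_circ_inv h]
    simp only [hs]
  have h2 := integral_re hi
  rw [← Complex.conj_eq_iff_re.mp h1]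
  exact_mod_cast h2.symm

lemma profile_inv (σ : Circle) : profile α γ β σ⁻¹ = profile α γ β σ := by
  rw [profile, conj_coe_mul_inv, profile, ← Complex.norm_conj (_ - _), map_sub, Complex.conj_ofReal,
    Complex.conj_conj]

/-- The real Fourier coefficients of the profile. -/
noncomputable def profileCoeff (α γ β : ℝ) (n : ℕ) : ℝ :=
  ∫ σ : Circle, profile α γ β σ * ((σ : ℂ) ^ n).re ∂circ

lemma integrable_profile_mul_zpow (hα : α ∈ Ioo (0 : ℝ) 1) (hγ : 0 < γ) (hβ : 0 < β) (k : ℤ) :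
    Integrable (fun σ : Circle => (profile α γ β σ : ℂ) * (σ : ℂ) ^ k) circ :=
  integrable_mul_zpow (integrable_profile hα hγ hβ).ofReal k

lemma integral_profile_mul_zpow (hα : α ∈ Ioo (0 : ℝ) 1) (hγ : 0 < γ) (hβ : 0 < β) (n : ℕ) :
    ∫ σ : Circle, (profile α γ β σ : ℂ) * (σ : ℂ) ^ (-(n : ℤ)) ∂circ = profileCoeff α γ β n := by
  rw [integral_eq_ofReal_integral_re (integrable_profile_mul_zpow hα hγ hβ _), profileCoeff]
  · congr 2
    funext σ
    rw [Complex.re_ofReal_mul, ← conj_zpow_circle, Complex.conj_re, zpow_natCast]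
  · intro σ
    rw [profile_inv, inv_zpow_circle, map_mul, Complex.conj_ofReal]

lemma integral_profile_mul_coe (hα : α ∈ Ioo (0 : ℝ) 1) (hγ : 0 < γ) (hβ : 0 < β) :
    ∫ σ : Circle, (profile α γ β σ : ℂ) * (σ : ℂ) ∂circ = profileCoeff α γ β 1 := by
  rw [← integral_profile_mul_zpow hα hγ hβ, ← integral_circ_inv]
  refine integral_congr_ae (ae_of_all _ fun σ => ?_)
  simp only
  rw [profile_inv, Circle.coe_inv, Nat.cast_one, zpow_neg_one]

lemma base_mul_coe (w σ : Circle) :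
    (γ : ℂ) * w - β * ((w * σ : Circle) : ℂ) = w * (γ - β * σ) := by
  rw [Circle.coe_mul]; ring

lemma baseKernel_mul (w σ : Circle) : baseKernel α γ β w (w * σ) = (profile α γ β σ : ℂ) := by
  rw [baseKernel, rieszKernel, base_mul_coe, norm_mul, Circle.norm_coe, one_mul, profile]

lemma kint_eq_integral_mul (K : Circle → Circle → ℂ) (u : Circle → ℂ) (w : Circle) :
    kint K u w = ∫ σ, K w (w * σ) * u (w * σ) ∂circ := by
  rw [kint, ← integral_mul_left_eq_self _ w]

lemma integral_comp_mul_zpow (u : Circle → ℂ) (σ : Circle) (k : ℤ) :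
    ∫ w, u (w * σ) * (w : ℂ) ^ k ∂circ = (σ : ℂ) ^ (-k) * ∫ w, u w * (w : ℂ) ^ k ∂circ := by
  rw [← integral_mul_left_eq_self _ σ⁻¹, ← integral_const_mul]
  refine integral_congr_ae (ae_of_all _ fun w => ?_)
  simp only
  rw [mul_comm σ⁻¹ w, inv_mul_cancel_right, Circle.coe_mul, Circle.coe_inv, mul_zpow, inv_zpow']
  ring

lemma integral_conj_mul_zpow (u : Circle → ℂ) (k : ℤ) :
    ∫ w, conj (u w) * (w : ℂ) ^ k ∂circ = conj (∫ w, u w * (w : ℂ) ^ (-k) ∂circ) := by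
  rw [← integral_conj]
  refine integral_congr_ae (ae_of_all _ fun w => ?_)
  simp only
  rw [map_mul, conj_zpow_circle, neg_neg]

section coefficients

variable {f g : Car α} {a c : ℕ → ℝ}

/-- The first terms of the coefficients sequences do not matter. -/
def cut (a : ℕ → ℝ) (n : ℕ) : ℝ := if 0 < n then a n else 0

lemma integral_mul_zpow_natCast {f : Circle → ℂ}
    (ha : ∀ w : Circle, HasSum (fun n : ℕ => (a (n + 1) : ℂ) * conj (w : ℂ) ^ (n + 1)) (f w))
    (n : ℕ) : ∫ τ, f τ * (τ : ℂ) ^ (n : ℤ) ∂circ = cut a n := by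
  rw [integral_mul_zpow_of_hasSum ha, cut]
  by_cases h : 0 < n
  · rw [if_pos (by exact_mod_cast h), if_pos h, Int.toNat_natCast]
  · rw [if_neg (by exact_mod_cast h), if_neg h, Complex.ofReal_zero]

lemma integral_mul_zpow_neg {f : Circle → ℂ}
    (ha : ∀ w : Circle, HasSum (fun n : ℕ => (a (n + 1) : ℂ) * conj (w : ℂ) ^ (n + 1)) (f w))
    {k : ℤ} (hk : k ≤ 0) : ∫ τ, f τ * (τ : ℂ) ^ k ∂circ = 0 := by
  rw [integral_mul_zpow_of_hasSum ha, if_neg (by omega)]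

/-- By rotation the base kernel maps `βτ` to a multiple of `w`, so this term is a multiple of `w
conj(Df)`; only the power `w^{-(n+1)}` of the test function contributes. -/
lemma pairing_first (hα : α ∈ Ioo (0 : ℝ) 1) (hγ : 0 < γ) (hβ : 0 < β)
    (ha : ∀ w : Circle, HasSum (fun n : ℕ => (a (n + 1) : ℂ) * conj (w : ℂ) ^ (n + 1)) (f w))
    (n : ℕ) :
    pairing n (fun w => conj (tder f w) * kint (baseKernel α γ β) (fun τ => (β : ℂ) * τ) w) =
      n * β * profileCoeff α γ β 1 * cut a n := by
  have hk : ∀ w, kint (baseKernel α γ β) (fun τ => (β : ℂ) * τ) w =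
      β * profileCoeff α γ β 1 * w := by
    intro w
    rw [kint_eq_integral_mul, ← integral_profile_mul_coe hα hγ hβ, ← integral_const_mul,
      ← integral_mul_const]
    refine integral_congr_ae (ae_of_all _ fun σ => ?_)
    simp only
    rw [baseKernel_mul, Circle.coe_mul]
    ring
  have hc : Continuous fun w => conj (tder f w) := Complex.continuous_conj.comp (f.continuous_tder hα)
  rw [pairing_eq_sub]
  · have e : ∀ k : ℤ, ∫ w, conj (tder f w) * kint (baseKernel α γ β) (fun τ => (β : ℂ) * τ) w *
        (w : ℂ) ^ k ∂circ = β * profileCoeff α γ β 1 * ((k + 1) *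
          conj (∫ w, f w * (w : ℂ) ^ (-(k + 1)) ∂circ)) := by
      intro k
      have h1 := integral_conj_mul_zpow (tder f) (k + 1)
      rw [integral_tder_mul_zpow f.contDiff] at h1
      rw [map_mul] at h1
      have h2 : conj (-((-(k + 1) : ℤ) : ℂ)) = (k : ℂ) + 1 := by simp
      rw [h2] at h1
      rw [← h1, ← integral_const_mul]
      refine integral_congr_ae (ae_of_all _ fun w => ?_)
      simp only
      rw [hk, zpow_add_one₀ (Circle.coe_ne_zero w)]
      ring
    rw [e, e, integral_mul_zpow_neg ha (by omega),
      show -(-((n : ℤ) + 1) + 1) = (n : ℤ) by ring, integral_mul_zpow_natCast ha]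
    simp only [Complex.conj_ofReal, map_zero]
    push_cast
    ring
  · simp only [hk]
    exact hc.mul (continuous_const.mul continuous_circle_coe)

lemma integrable_profile_prod (hα : α ∈ Ioo (0 : ℝ) 1) (hγ : 0 < γ) (hβ : 0 < β)
    {F : Circle → Circle → ℂ} (hF : Measurable (Function.uncurry F)) {B : ℝ}
    (hB : ∀ w σ, ‖F w σ‖ ≤ B) :
    Integrable (Function.uncurry fun w σ => (profile α γ β σ : ℂ) * F w σ) (circ.prod circ) := by
  have h1 : Integrable (fun q : Circle × Circle => (profile α γ β q.2 : ℂ)) (circ.prod circ) := by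
    have h0 : Integrable (fun σ : Circle => (profile α γ β σ : ℂ)) circ :=
      (integrable_profile hα hγ hβ).ofReal
    exact h0.comp_snd circ
  exact h1.mul_bdd (c := B) hF.aestronglyMeasurable (ae_of_all _ fun q => hB q.1 q.2)

/-- Put `τ = wσ` and integrate in `w` first: this isolates one coefficient of `g` times `σ^{-n}`,
and the remaining integral is a coefficient of the profile. -/
lemma pairing_second (hα : α ∈ Ioo (0 : ℝ) 1) (hγ : 0 < γ) (hβ : 0 < β)
    (hc : ∀ w : Circle, HasSum (fun n : ℕ => (c (n + 1) : ℂ) * conj (w : ℂ) ^ (n + 1)) (g w))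
    (n : ℕ) :
    pairing n (fun w => conj ((γ : ℂ) * w) * kint (baseKernel α γ β) (tder g) w) =
      -(n * γ * profileCoeff α γ β n * cut c n) := by
  have hgc := g.continuous_tder hα
  set F : Circle → Circle → ℂ := fun w σ => γ * (w : ℂ) ^ (-1 : ℤ) * tder g (w * σ) *
    ((w : ℂ) ^ ((n : ℤ) + 1) - (w : ℂ) ^ (-((n : ℤ) + 1))) with hF
  have hFm : Continuous (Function.uncurry F) := by
    have h1 : Continuous fun q : Circle × Circle => tder g (q.1 * q.2) :=
      hgc.comp (continuous_fst.mul continuous_snd)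
    exact ((continuous_const.mul ((continuous_circle_zpow (-1)).comp continuous_fst)).mul h1).mul
      ((continuous_test n).comp continuous_fst)
  obtain ⟨B, hB⟩ := isCompact_univ.exists_bound_of_continuousOn hFm.continuousOn
  have hFi := integrable_profile_prod hα hγ hβ hFm.measurable (B := B)
    fun w σ => hB (w, σ) (mem_univ _)
  have hin : ∀ σ : Circle, ∫ w, F w σ ∂circ = -(n * γ * cut c n) * (σ : ℂ) ^ (-(n : ℤ)) := by
    intro σ
    have hi : ∀ k : ℤ, Integrable (fun w : Circle => tder g (w * σ) * (w : ℂ) ^ k) circ := fun k =>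
      integrable_circ_of_continuous ((hgc.comp (continuous_mul_const σ)).mul
        (continuous_circle_zpow k))
    have e : ∀ w : Circle, F w σ = γ * (tder g (w * σ) * (w : ℂ) ^ (n : ℤ) -
        tder g (w * σ) * (w : ℂ) ^ (-((n : ℤ) + 2))) := by
      intro w
      have hw := Circle.coe_ne_zero w
      rw [hF]
      simp only
      rw [show (n : ℤ) = -1 + ((n : ℤ) + 1) by ring, zpow_add₀ hw (-1),
        show -(-1 + ((n : ℤ) + 1) + 2) = -1 + -((n : ℤ) + 1) by ring, zpow_add₀ hw (-1)]
      ring_nf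
    simp only [e]
    rw [integral_const_mul, integral_sub (hi _) (hi _), integral_comp_mul_zpow,
      integral_comp_mul_zpow, integral_tder_mul_zpow g.contDiff, integral_tder_mul_zpow g.contDiff,
      integral_mul_zpow_natCast hc, integral_mul_zpow_neg hc (by omega)]
    push_cast
    ring
  calc _ = ∫ w, ∫ σ, (profile α γ β σ : ℂ) * F w σ ∂circ ∂circ := by
        rw [pairing]
        refine integral_congr_ae (ae_of_all _ fun w => ?_)
        simp only
        rw [kint_eq_integral_mul, ← integral_const_mul, ← integral_mul_const]
        refine integral_congr_ae (ae_of_all _ fun σ => ?_)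
        simp only [hF]
        rw [baseKernel_mul, map_mul, Complex.conj_ofReal, ← Circle.coe_inv_eq_conj, Circle.coe_inv,
          zpow_neg_one]
        ring
    _ = ∫ σ, ∫ w, (profile α γ β σ : ℂ) * F w σ ∂circ ∂circ := integral_integral_swap hFi
    _ = _ := by
        simp only [integral_const_mul, hin]
        have e : ∀ σ : Circle, (profile α γ β σ : ℂ) * (-(n * γ * cut c n) * (σ : ℂ) ^ (-(n : ℤ))) =
            -(n * γ * cut c n) * (profile α γ β σ * (σ : ℂ) ^ (-(n : ℤ))) := fun σ => by ring
        simp only [e]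
        rw [integral_const_mul, integral_profile_mul_zpow hα hγ hβ]
        ring

end coefficients

end VState

namespace VState

/-! ### The kernel part of the linearization -/

variable {α γ β : ℝ} {f g : Car α} {a c : ℕ → ℝ}

lemma relGap_mul (f g : Circle → ℂ) (w σ : Circle) : relGap γ β f g w (w * σ) =
    (f w - g (w * σ)) * (w : ℂ) ^ (-1 : ℤ) * ((γ : ℂ) - β * σ)⁻¹ := by
  rw [relGap, base_mul_coe, zpow_neg_one, div_eq_mul_inv, mul_inv]
  ring

lemma integral_relGap_mul_zpow (f g : Car α) (σ : Circle) (k : ℤ) :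
    ∫ w, relGap γ β f g w (w * σ) * (w : ℂ) ^ k ∂circ =
      ((∫ w, f w * (w : ℂ) ^ (k - 1) ∂circ) -
        (σ : ℂ) ^ (-(k - 1)) * ∫ w, g w * (w : ℂ) ^ (k - 1) ∂circ) * ((γ : ℂ) - β * σ)⁻¹ := by
  have hgc : Continuous fun w => g (w * σ) := g.toC.continuous.comp (continuous_mul_const σ)
  rw [← integral_comp_mul_zpow, ← integral_sub (integrable_mul_zpow_circ f.toC.continuous _)
    (integrable_mul_zpow_circ hgc _), ← integral_mul_const]
  refine integral_congr_ae (ae_of_all _ fun w => ?_)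
  simp only
  rw [relGap_mul, sub_eq_add_neg k 1, zpow_add₀ (Circle.coe_ne_zero w)]
  ring

lemma continuous_relGap_mul (f g : Car α) (σ : Circle) :
    Continuous fun w => relGap γ β f g w (w * σ) := by
  simp only [relGap_mul]
  exact ((f.toC.continuous.sub (g.toC.continuous.comp (continuous_mul_const σ))).mul
    (continuous_circle_zpow _)).mul continuous_const

/-- The symbol of the relative gap. -/
noncomputable def gapSymbol (γ β : ℝ) (a c : ℕ → ℝ) (n : ℕ) (σ : Circle) : ℂ :=
  ((cut a n : ℂ) - (σ : ℂ) ^ (-(n : ℤ)) * cut c n) * ((γ : ℂ) - β * σ)⁻¹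

lemma gapSymbol_inv (n : ℕ) (σ : Circle) :
    gapSymbol γ β a c n σ⁻¹ = conj (gapSymbol γ β a c n σ) := by
  rw [gapSymbol, gapSymbol, inv_zpow_circle, Circle.coe_inv_eq_conj]
  simp only [map_mul, map_sub, map_inv₀, Complex.conj_ofReal]

/-- Clearing the denominator with the conjugate of `γ - βσ` gives the form to which the integration
by parts applies. -/
lemma gapSymbol_im (n : ℕ) (σ : Circle) : (gapSymbol γ β a c n σ).im =
    (cut a n * (β * (σ : ℂ).im) + cut c n * (γ * ((σ : ℂ) ^ n).im - β * ((σ : ℂ) ^ (n + 1)).im)) /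
      ‖(γ : ℂ) - β * σ‖ ^ 2 := by
  have h : gapSymbol γ β a c n σ = ((cut a n : ℂ) - conj ((σ : ℂ) ^ n) * cut c n) *
      (γ - β * conj (σ : ℂ)) * ((‖(γ : ℂ) - β * σ‖ ^ 2)⁻¹ : ℝ) := by
    rw [gapSymbol, Complex.inv_def, Complex.normSq_eq_norm_sq, ← conj_zpow_circle, zpow_natCast]
    simp only [map_mul, map_sub, Complex.conj_ofReal]
    ring
  rw [h, Complex.im_mul_ofReal, div_eq_mul_inv, pow_succ (σ : ℂ)]
  congr 1
  simp only [Complex.mul_im, Complex.mul_re, Complex.sub_re, Complex.sub_im, Complex.conj_re,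
    Complex.conj_im, Complex.ofReal_re, Complex.ofReal_im]
  ring

/-- For fixed `σ`, `q(w, wσ)` has only negative frequencies in `w`. Hence `q` and `conj q` pair to
the symbol and to minus its conjugate, and the real part gives `i` times the imaginary part. -/
lemma integral_re_relGap
    (ha : ∀ w : Circle, HasSum (fun n : ℕ => (a (n + 1) : ℂ) * conj (w : ℂ) ^ (n + 1)) (f w))
    (hc : ∀ w : Circle, HasSum (fun n : ℕ => (c (n + 1) : ℂ) * conj (w : ℂ) ^ (n + 1)) (g w))
    (n : ℕ) (σ : Circle) :
    ∫ w, ((relGap γ β f g w (w * σ)).re : ℂ) *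
      ((w : ℂ) ^ ((n : ℤ) + 1) - (w : ℂ) ^ (-((n : ℤ) + 1))) ∂circ =
      Complex.I * (gapSymbol γ β a c n σ).im := by
  set Y : Circle → ℂ := fun w => relGap γ β f g w (w * σ) with hY
  have hYc : Continuous Y := continuous_relGap_mul f g σ
  have hYc' : Continuous fun w => conj (Y w) := Complex.continuous_conj.comp hYc
  have h1 : ∫ w, Y w * (w : ℂ) ^ ((n : ℤ) + 1) ∂circ = gapSymbol γ β a c n σ := by
    rw [hY, integral_relGap_mul_zpow, add_sub_cancel_right, integral_mul_zpow_natCast ha,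
      integral_mul_zpow_natCast hc, gapSymbol]
  have h2 : ∫ w, Y w * (w : ℂ) ^ (-((n : ℤ) + 1)) ∂circ = 0 := by
    rw [hY, integral_relGap_mul_zpow, integral_mul_zpow_neg ha (by omega),
      integral_mul_zpow_neg hc (by omega)]
    simp
  have h3 := pairing_eq_sub hYc n
  have h4 := pairing_eq_sub hYc' n
  rw [integral_conj_mul_zpow, integral_conj_mul_zpow, neg_neg, h1, h2, map_zero] at h4
  rw [h1, h2] at h3
  have h5 := pairing_add hYc hYc' n
  rw [h3, h4, sub_zero, zero_sub, ← sub_eq_add_neg, Complex.sub_conj] at h5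
  have h6 : ∀ w, Y w + conj (Y w) = 2 * ((Y w).re : ℂ) := fun w => by
    rw [Complex.add_conj]; push_cast; ring
  simp only [pairing, h6, mul_assoc] at h5
  rw [integral_const_mul] at h5
  push_cast at h5
  linear_combination h5 / 2

/-- Three cases of the integration by parts, with `m = 1`, `n` and `n + 1`. -/
lemma integrable_profile_gapSymbol (hα : α ∈ Ioo (0 : ℝ) 1) (hγ : 0 < γ) (hβ : 0 < β) (n : ℕ) :
    Integrable (fun σ : Circle => profile α γ β σ * (gapSymbol γ β a c n σ).im * (σ : ℂ).im) circ ∧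
    α * γ * β * ∫ σ : Circle, profile α γ β σ * (gapSymbol γ β a c n σ).im * (σ : ℂ).im ∂circ =
      cut a n * (β * profileCoeff α γ β 1) + cut c n * (γ * (n * profileCoeff α γ β n) -
        β * ((n + 1) * profileCoeff α γ β (n + 1))) := by
  set q : ℕ → Circle → ℝ := fun m σ => profile α γ β σ / ‖(γ : ℂ) - β * σ‖ ^ 2 *
    ((σ : ℂ).im * ((σ : ℂ) ^ m).im) with hq
  have hi : ∀ m, Integrable (q m) circ := integrable_profile_div hα hγ hβ
  have e : (fun σ : Circle => profile α γ β σ * (gapSymbol γ β a c n σ).im * (σ : ℂ).im) =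
      fun σ => cut a n * β * q 1 σ + (cut c n * γ * q n σ - cut c n * β * q (n + 1) σ) := by
    funext σ
    rw [gapSymbol_im, hq]
    simp only [pow_one]
    ring
  have i1 := (hi 1).const_mul (cut a n * β)
  have i2 := (hi n).const_mul (cut c n * γ)
  have i3 := (hi (n + 1)).const_mul (cut c n * β)
  rw [e]
  refine ⟨i1.add (i2.sub i3), ?_⟩
  have h : ∀ m : ℕ, α * γ * β * ∫ σ, q m σ ∂circ = m * profileCoeff α γ β m :=
    integral_profile_by_parts hα hγ hβ
  have h1 := h 1
  have h2 := h n
  have h3 := h (n + 1)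
  have i4 : Integrable (fun σ => cut c n * γ * q n σ - cut c n * β * q (n + 1) σ) circ := i2.sub i3
  rw [integral_add i1 i4, integral_sub i2 i3, integral_const_mul, integral_const_mul,
    integral_const_mul]
  push_cast at h1 h3
  linear_combination cut a n * β * h1 + cut c n * γ * h2 - cut c n * β * h3

lemma pairing_third (hα : α ∈ Ioo (0 : ℝ) 1) (hγ : 0 < γ) (hβ : 0 < β)
    (ha : ∀ w : Circle, HasSum (fun n : ℕ => (a (n + 1) : ℂ) * conj (w : ℂ) ^ (n + 1)) (f w))
    (hc : ∀ w : Circle, HasSum (fun n : ℕ => (c (n + 1) : ℂ) * conj (w : ℂ) ^ (n + 1)) (g w))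
    {B : ℝ} (hB : ∀ w τ, ‖relGap γ β f g w τ‖ ≤ B) (n : ℕ) :
    pairing n (fun w => conj ((γ : ℂ) * w) *
      kint (linKernel α γ β f g) (fun τ => (β : ℂ) * τ) w) =
      ((cut a n * (β * profileCoeff α γ β 1) + cut c n * (γ * (n * profileCoeff α γ β n) -
        β * ((n + 1) * profileCoeff α γ β (n + 1))) : ℝ) : ℂ) := by
  have hB0 : 0 ≤ B := (norm_nonneg _).trans (hB 1 1)
  set F : Circle → Circle → ℂ := fun w σ => -(α * γ * β) * σ *
    (((relGap γ β f g w (w * σ)).re : ℂ) *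
      ((w : ℂ) ^ ((n : ℤ) + 1) - (w : ℂ) ^ (-((n : ℤ) + 1)))) with hF
  have hFm : Measurable (Function.uncurry F) := by
    have h1 : Continuous fun q : Circle × Circle => g (q.1 * q.2) :=
      g.toC.continuous.comp (continuous_fst.mul continuous_snd)
    have h2 : Continuous fun q : Circle × Circle => f q.1 := f.toC.continuous.comp continuous_fst
    have h3 : Continuous fun q : Circle × Circle => (q.1 : ℂ) ^ (-1 : ℤ) :=
      (continuous_circle_zpow (-1)).comp continuous_fst
    have h4 : Continuous fun q : Circle × Circle => (γ : ℂ) - β * (q.2 : ℂ) :=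
      continuous_const.sub ((continuous_const_mul_coe β).comp continuous_snd)
    have h5 : Measurable fun q : Circle × Circle => relGap γ β f g q.1 (q.1 * q.2) := by
      simp only [relGap_mul]
      exact ((h2.sub h1).mul h3).measurable.mul h4.measurable.inv
    have h6 : Continuous fun q : Circle × Circle => (-(α * γ * β) * (q.2 : ℂ) : ℂ) :=
      continuous_const.mul (continuous_circle_coe.comp continuous_snd)
    exact h6.measurable.mul ((Complex.measurable_ofReal.comp (Complex.measurable_re.comp h5)).mul
      ((continuous_test n).comp continuous_fst).measurable)
  have hFi := integrable_profile_prod hα hγ hβ hFm (B := ‖(-(α * γ * β) : ℂ)‖ * (B * 2))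
    fun w σ => by
      rw [hF]
      simp only
      rw [norm_mul, norm_mul, Circle.norm_coe, mul_one, norm_mul, Complex.norm_real]
      have h1 : ‖(relGap γ β f g w (w * σ)).re‖ ≤ B := (Complex.abs_re_le_norm _).trans (hB _ _)
      have h2 := norm_test_le n w
      gcongr
  have hin : ∀ σ : Circle, ∫ w, F w σ ∂circ =
      -(α * γ * β) * σ * (Complex.I * (gapSymbol γ β a c n σ).im) := by
    intro σ
    rw [← integral_re_relGap ha hc, ← integral_const_mul]
  set h : Circle → ℂ := fun σ => (profile α γ β σ : ℂ) *
    (-(α * γ * β) * σ * (Complex.I * (gapSymbol γ β a c n σ).im)) with hh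
  have hout : ∀ σ, ∫ w, (profile α γ β σ : ℂ) * F w σ ∂circ = h σ := by
    intro σ
    rw [integral_const_mul, hin]
  have hhi : Integrable h circ := by
    have := hFi.integral_prod_right
    refine this.congr (ae_of_all _ fun σ => ?_)
    exact hout σ
  calc _ = ∫ w, ∫ σ, (profile α γ β σ : ℂ) * F w σ ∂circ ∂circ := by
        rw [pairing]
        refine integral_congr_ae (ae_of_all _ fun w => ?_)
        simp only
        rw [kint_eq_integral_mul, ← integral_const_mul, ← integral_mul_const]
        refine integral_congr_ae (ae_of_all _ fun σ => ?_)
        simp only [hF]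
        rw [linKernel, baseKernel_mul, map_mul, Complex.conj_ofReal, ← Circle.coe_inv_eq_conj,
          Circle.coe_inv, Circle.coe_mul]
        have hw := Circle.coe_ne_zero w
        push_cast
        field_simp
    _ = ∫ σ, ∫ w, (profile α γ β σ : ℂ) * F w σ ∂circ ∂circ := integral_integral_swap hFi
    _ = ∫ σ, h σ ∂circ := by simp only [hout]
    -- By reflection symmetry the integral is real; then `Re(-iσ) = Im σ` brings in the second sine.
    _ = ((∫ σ, (h σ).re ∂circ : ℝ) : ℂ) := by
        refine integral_eq_ofReal_integral_re hhi fun σ => ?_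
        rw [hh]
        simp only
        rw [profile_inv, gapSymbol_inv, Circle.coe_inv_eq_conj]
        simp only [map_mul, map_neg, Complex.conj_ofReal, Complex.conj_I, Complex.conj_im]
        push_cast
        ring
    _ = _ := by
        rw [← (integrable_profile_gapSymbol hα hγ hβ n).2, ← integral_const_mul]
        congr 2
        funext σ
        have : h σ = ((α * γ * β * (profile α γ β σ * (gapSymbol γ β a c n σ).im) : ℝ) : ℂ) *
            (-Complex.I * σ) := by
          rw [hh]; push_cast; ring
        rw [this, Complex.re_ofReal_mul]
        simp
        ring

/-- The terms `nγ P_n c_n` of the second and third parts cancel, and what remains has the common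
factor `n + 1`. -/
lemma pairing_linInter (hα : α ∈ Ioo (0 : ℝ) 1) (hγ : 0 < γ) (hβ : 0 < β)
    (ha : ∀ w : Circle, HasSum (fun n : ℕ => (a (n + 1) : ℂ) * conj (w : ℂ) ^ (n + 1)) (f w))
    (hc : ∀ w : Circle, HasSum (fun n : ℕ => (c (n + 1) : ℂ) * conj (w : ℂ) ^ (n + 1)) (g w))
    {M ε : ℝ} (hM : 0 ≤ M) (h : Compat γ β M ε f g) (n : ℕ) :
    pairing n (linInter α γ β f g) = (((n + 1) * β *
      (profileCoeff α γ β 1 * cut a n - profileCoeff α γ β (n + 1) * cut c n) : ℝ) : ℂ) := by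
  have hε : 0 ≤ ε := (norm_nonneg _).trans h.1
  obtain ⟨A₀, hA₀, h0⟩ := exists_isKernel_base hα hγ hβ
  obtain ⟨A₁, hA₁, h1⟩ := exists_isKernel_lin hα hγ hβ hM
  have hK := h1 f g ε h
  have kc : ∀ {A : ℝ} {K : Circle → Circle → ℂ}, 0 ≤ A → IsKernel α A K → ∀ {u : Circle → ℂ},
      Continuous u → Continuous (kint K u) := by
    intro A K hA hK u hu
    obtain ⟨B, hB⟩ := isCompact_univ.exists_bound_of_continuousOn hu.continuousOn
    exact (hK.holderBound hα hA hu.measurable fun w => hB w (mem_univ _)).continuous hα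
  have hcoe := continuous_const_mul_coe β
  have hcγ : Continuous fun w : Circle => conj ((γ : ℂ) * w) :=
    Complex.continuous_conj.comp (continuous_const_mul_coe γ)
  have c1 : Continuous fun w => conj (tder f w) * kint (baseKernel α γ β) (fun τ => (β : ℂ) * τ) w :=
    (Complex.continuous_conj.comp (f.continuous_tder hα)).mul (kc hA₀ h0 hcoe)
  have c2 : Continuous fun w : Circle => conj ((γ : ℂ) * w) * kint (baseKernel α γ β) (tder g) w :=
    hcγ.mul (kc hA₀ h0 (g.continuous_tder hα))
  have c3 : Continuous fun w : Circle => conj ((γ : ℂ) * w) *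
      kint (linKernel α γ β f g) (fun τ => (β : ℂ) * τ) w :=
    hcγ.mul (kc (by positivity) hK hcoe)
  -- Where the denominator vanishes the quotient is `0` by convention, so the bound needs no
  -- exception.
  have hB : ∀ w τ, ‖relGap γ β f g w τ‖ ≤ M * ε := by
    intro w τ
    rw [relGap, norm_div]
    exact div_le_of_le_mul₀ (norm_nonneg _) (by positivity) (h.2.2 w τ)
  have c4 : Continuous fun w : Circle =>
      conj (tder f w) * kint (baseKernel α γ β) (fun τ => (β : ℂ) * τ) w +
      conj ((γ : ℂ) * w) * kint (baseKernel α γ β) (tder g) w := c1.add c2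
  unfold linInter
  rw [pairing_add c4 c3, pairing_add c1 c2, pairing_first hα hγ hβ ha,
    pairing_second hα hγ hβ hc, pairing_third hα hγ hβ ha hc hB]
  push_cast
  ring

end VState

namespace VState

/-! ### The functional and its linearization -/

/-- The complex quantity whose imaginary part is the functional at the boundary `γ Id + f`. -/
noncomputable def flux (α b Ω γ : ℝ) (f₁ f₂ f : Circle → ℂ) (w : Circle) : ℂ :=
  Ω * (((γ : ℂ) * w + f w) * conj ((γ : ℂ) * w + tder f w)) +
    Cα α * (inter α γ b f f₂ w - inter α γ 1 f f₁ w)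

/-- The linearization of `flux`. -/
noncomputable def linFlux (α b Ω γ : ℝ) (f₁ f₂ f : Circle → ℂ) (w : Circle) : ℂ :=
  Ω * ((γ : ℂ) * w * conj (tder f w) + conj ((γ : ℂ) * w) * f w) +
    Cα α * (linInter α γ b f f₂ w - linInter α γ 1 f f₁ w)

variable {α b Ω γ β : ℝ}

lemma S_eq {g : Circle → ℂ} (hg : ContDiff ℝ 1 (lift g)) (f : Circle → ℂ) (w : Circle) :
    S α (perturb β g) (perturb γ f) w = Cα α *
      kint (rieszKernel α (gap γ β f g)) (fun τ => (β : ℂ) * τ + tder g τ) w := by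
  rw [S, mint_eq, kint]
  congr 1
  refine integral_congr_ae (ae_of_all _ fun τ => ?_)
  simp only
  rw [← tder_perturb hg, tder, rieszKernel, gap, Real.rpow_neg (norm_nonneg _), Complex.ofReal_inv]
  ring

/-- Because `w̄ conj(φ') = conj(wφ')`, only tangential derivatives occur. -/
lemma F_eq (f₁ f₂ f : Car α) (w : Circle) :
    F α Ω (perturb 1 f₁) (perturb b f₂) (perturb γ f) w = (flux α b Ω γ f₁ f₂ f w).im := by
  have h : conj (w : ℂ) * conj (circleDeriv (perturb γ f) w) =
      conj ((γ : ℂ) * w + tder f w) := by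
    rw [← map_mul, ← tder_perturb f.contDiff, tder]
  rw [F, mul_assoc, h, S_eq f₂.contDiff, S_eq f₁.contDiff, flux, inter, inter, perturb]
  congr 1
  ring

lemma flux_inv (f₁ f₂ f : Car α) (w : Circle) :
    flux α b Ω γ f₁ f₂ f w⁻¹ = conj (flux α b Ω γ f₁ f₂ f w) := by
  rw [flux, inter_inv, inter_inv, conj_coe_mul_inv, f.apply_inv, f.tder_inv, flux]
  simp only [map_add, map_mul, map_sub, Complex.conj_ofReal]

lemma linFlux_inv (f₁ f₂ f : Car α) (w : Circle) :
    linFlux α b Ω γ f₁ f₂ f w⁻¹ = conj (linFlux α b Ω γ f₁ f₂ f w) := by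
  rw [linFlux, linInter_inv, linInter_inv, conj_coe_mul_inv, f.apply_inv, f.tder_inv, linFlux]
  simp only [map_add, map_mul, map_sub, Complex.conj_ofReal]

section linearity

lemma kint_const_mul_right (K : Circle → Circle → ℂ) (r : ℂ) (u : Circle → ℂ) (w : Circle) :
    kint K (fun τ => r * u τ) w = r * kint K u w := by
  rw [kint, kint, ← integral_const_mul]
  simp only [mul_left_comm]

lemma linInter_add (hα : α ∈ Ioo (0 : ℝ) 1) (hγ : 0 < γ) (hβ : 0 < β) {f g f' g' : Car α} {A A' : ℝ}
    (h : IsKernel α A (linKernel α γ β f g)) (h' : IsKernel α A' (linKernel α γ β f' g'))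
    (w : Circle) : linInter α γ β (f + f' : Car α) (g + g' : Car α) w =
      linInter α γ β f g w + linInter α γ β f' g' w := by
  obtain ⟨A₀, -, h0⟩ := exists_isKernel_base hα hγ hβ
  have e : linKernel α γ β (f + f' : Car α) (g + g' : Car α) =
      fun w τ => linKernel α γ β f g w τ + linKernel α γ β f' g' w τ := by
    funext w τ
    have : relGap γ β (f + f' : Car α) (g + g' : Car α) w τ =
        relGap γ β f g w τ + relGap γ β f' g' w τ := by
      simp only [relGap, Car.toC_add, ContinuousMap.coe_add, Pi.add_apply]
      ring
    rw [linKernel, this, linKernel, linKernel, Complex.add_re]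
    push_cast
    ring
  rw [linInter, e, Car.tder_add, Car.tder_add, kint_add_left hα h h' (continuous_const_mul_coe β)]
  have e2 : tder g + tder g' = fun τ => tder g τ + tder g' τ := rfl
  rw [e2, kint_add_right hα h0 (g.continuous_tder hα) (g'.continuous_tder hα), linInter, linInter,
    Pi.add_apply, map_add]
  ring

lemma linInter_smul (r : ℝ) (f g : Car α) (w : Circle) :
    linInter α γ β (r • f : Car α) (r • g : Car α) w = r * linInter α γ β f g w := by
  have e : linKernel α γ β (r • f : Car α) (r • g : Car α) =
      fun w τ => r * linKernel α γ β f g w τ := by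
    funext w τ
    have : relGap γ β (r • f : Car α) (r • g : Car α) w τ = r * relGap γ β f g w τ := by
      simp only [relGap, Car.toC_smul, ContinuousMap.coe_smul, Pi.smul_apply, Complex.real_smul]
      ring
    rw [linKernel, this, linKernel, Complex.re_ofReal_mul]
    push_cast
    ring
  have e1 : kint (fun w τ => r * linKernel α γ β f g w τ) (fun τ => (β : ℂ) * τ) w =
      r * kint (linKernel α γ β f g) (fun τ => (β : ℂ) * τ) w := by
    rw [kint, kint, ← integral_const_mul]
    simp only [mul_assoc]
  have e2 : r • tder g = fun τ => (r : ℂ) * tder g τ := rfl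
  rw [linInter, e, e1, Car.tder_smul, Car.tder_smul, e2, kint_const_mul_right _ _ (tder g),
    linInter,
    Pi.smul_apply, Complex.real_smul, map_mul, Complex.conj_ofReal]
  ring

end linearity

/-! ### Fourier coefficients of the linearization -/

section coefficients

variable {f₁ f₂ f : Car α} {a a₁ a₂ : ℕ → ℝ}

lemma pairing_const_mul (r : ℂ) (u : Circle → ℂ) (n : ℕ) :
    pairing n (fun w => r * u w) = r * pairing n u := by
  rw [pairing, pairing, ← integral_const_mul]
  simp only [mul_assoc]

/-- The first product contributes `n` and the second `1` to the factor `n + 1`. -/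
lemma pairing_rotation (hα : α ∈ Ioo (0 : ℝ) 1)
    (ha : ∀ w : Circle, HasSum (fun n : ℕ => (a (n + 1) : ℂ) * conj (w : ℂ) ^ (n + 1)) (f w))
    (n : ℕ) :
    pairing n (fun w => (γ : ℂ) * w * conj (tder f w) + conj ((γ : ℂ) * w) * f w) =
      γ * (n + 1) * cut a n := by
  have hc1 : Continuous fun w : Circle => (γ : ℂ) * w * conj (tder f w) :=
    (continuous_const_mul_coe γ).mul (Complex.continuous_conj.comp (f.continuous_tder hα))
  have hc2 : Continuous fun w : Circle => conj ((γ : ℂ) * w) * f w :=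
    (Complex.continuous_conj.comp (continuous_const_mul_coe γ)).mul f.toC.continuous
  have e1 : ∀ k : ℤ, ∫ w : Circle, (γ : ℂ) * w * conj (tder f w) * (w : ℂ) ^ k ∂circ =
      γ * ((k + 1) * conj (∫ w, f w * (w : ℂ) ^ (-(k + 1)) ∂circ)) := by
    intro k
    have h1 := integral_conj_mul_zpow (tder f) (k + 1)
    rw [integral_tder_mul_zpow f.contDiff, map_mul] at h1
    have h2 : conj (-((-(k + 1) : ℤ) : ℂ)) = (k : ℂ) + 1 := by simp
    rw [h2] at h1
    rw [← h1, ← integral_const_mul]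
    refine integral_congr_ae (ae_of_all _ fun w => ?_)
    simp only
    rw [zpow_add_one₀ (Circle.coe_ne_zero w)]
    ring
  have e2 : ∀ k : ℤ, ∫ w : Circle, conj ((γ : ℂ) * w) * f w * (w : ℂ) ^ k ∂circ =
      γ * ∫ w, f w * (w : ℂ) ^ (k - 1) ∂circ := by
    intro k
    rw [← integral_const_mul]
    refine integral_congr_ae (ae_of_all _ fun w => ?_)
    simp only
    rw [zpow_sub_one₀ (Circle.coe_ne_zero w), map_mul, Complex.conj_ofReal,
      ← Circle.coe_inv_eq_conj, Circle.coe_inv]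
    ring
  rw [pairing_add hc1 hc2, pairing_eq_sub hc1, pairing_eq_sub hc2, e1, e1, e2, e2,
    integral_mul_zpow_neg ha (k := -((n : ℤ) + 1 + 1)) (by omega),
    integral_mul_zpow_neg ha (k := -((n : ℤ) + 1) - 1) (by omega),
    show -(-((n : ℤ) + 1) + 1) = (n : ℤ) by ring, add_sub_cancel_right,
    integral_mul_zpow_natCast ha]
  simp only [Complex.conj_ofReal, map_zero]
  push_cast
  ring

lemma pairing_linFlux (hα : α ∈ Ioo (0 : ℝ) 1) (hγ : 0 < γ) (hb : 0 < b)
    (ha : ∀ w : Circle, HasSum (fun n : ℕ => (a (n + 1) : ℂ) * conj (w : ℂ) ^ (n + 1)) (f w))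
    (ha₁ : ∀ w : Circle, HasSum (fun n : ℕ => (a₁ (n + 1) : ℂ) * conj (w : ℂ) ^ (n + 1)) (f₁ w))
    (ha₂ : ∀ w : Circle, HasSum (fun n : ℕ => (a₂ (n + 1) : ℂ) * conj (w : ℂ) ^ (n + 1)) (f₂ w))
    {M ε : ℝ} (hM : 0 < M) (h₁ : Compat γ 1 M ε f f₁) (h₂ : Compat γ b M ε f f₂) (n : ℕ) :
    pairing n (linFlux α b Ω γ f₁ f₂ f) = (((n + 1) * (γ * Ω * cut a n +
      b * (kappa α γ b 1 * cut a n - kappa α γ b (n + 1) * cut a₂ n) -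
      (kappa α γ 1 1 * cut a n - kappa α γ 1 (n + 1) * cut a₁ n)) : ℝ) : ℂ) := by
  obtain ⟨C₁, -, hC₁⟩ := exists_linInter_le hα hγ one_pos hM
  obtain ⟨C₂, -, hC₂⟩ := exists_linInter_le hα hγ hb hM
  have c1 := (hC₁ f f₁ ε h₁).continuous hα
  have c2 := (hC₂ f f₂ ε h₂).continuous hα
  have hc : Continuous fun w : Circle =>
      (Ω : ℂ) * ((γ : ℂ) * w * conj (tder f w) + conj ((γ : ℂ) * w) * f w) :=
    continuous_const.mul (((continuous_const_mul_coe γ).mul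
      (Complex.continuous_conj.comp (f.continuous_tder hα))).add
      ((Complex.continuous_conj.comp (continuous_const_mul_coe γ)).mul f.toC.continuous))
  have hk : ∀ (β : ℝ) (m : ℕ), kappa α γ β m = Cα α * profileCoeff α γ β m := by
    intro β m
    simp only [kappa, profileCoeff, profile, mul_comm]
  have e : linFlux α b Ω γ f₁ f₂ f = fun w =>
      (Ω : ℂ) * ((γ : ℂ) * w * conj (tder f w) + conj ((γ : ℂ) * w) * f w) +
      Cα α * (linInter α γ b f f₂ w + (-1) * linInter α γ 1 f f₁ w) := by
    funext w
    rw [linFlux]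
    ring
  have c3 : Continuous fun w => (-1) * linInter α γ 1 f f₁ w := continuous_const.mul c1
  have c4 : Continuous fun w =>
      (Cα α : ℂ) * (linInter α γ b f f₂ w + (-1) * linInter α γ 1 f f₁ w) :=
    continuous_const.mul (c2.add c3)
  rw [e, pairing_add hc c4, pairing_const_mul, pairing_const_mul,
    pairing_add c2 c3, pairing_const_mul, pairing_rotation hα ha,
    pairing_linInter hα hγ hb ha ha₂ hM.le h₂, pairing_linInter hα hγ one_pos ha ha₁ hM.le h₁]
  simp only [hk]
  push_cast
  ring

end coefficients

end VState

namespace VState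

/-! ### Hölder bounds and differentiability of one component -/

variable {α b Ω γ : ℝ}

lemma H.toC_sub (f g : H α) : (f - g).toC = f.toC - g.toC := rfl

lemma HolderBound.congr {u v : Circle → ℂ} {A : ℝ} (hu : HolderBound α A u) (h : ∀ w, u w = v w) :
    HolderBound α A v :=
  (funext h : u = v) ▸ hu

lemma HolderBound.const_coe_add (hα : α ∈ Ioo (0 : ℝ) 1) (hγ : 0 < γ) {u : Circle → ℂ} {A : ℝ}
    (hu : HolderBound α A u) : HolderBound α (2 * γ + A) fun w : Circle => (γ : ℂ) * w + u w :=
  (HolderBound.const_coe hα hγ.le).add hu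

lemma exists_holderBound_flux (hα : α ∈ Ioo (0 : ℝ) 1) (hb : 0 < b) (hγ : 0 < γ)
    (f₁ f₂ f : Car α) {c : ℝ} (hc : 0 < c) (h₁ : ∀ w τ, c * dist w τ ≤ ‖gap γ 1 f f₁ w τ‖)
    (h₂ : ∀ w τ, c * dist w τ ≤ ‖gap γ b f f₂ w τ‖) :
    ∃ A, HolderBound α A (flux α b Ω γ f₁ f₂ f) := by
  obtain ⟨A₁, hA₁⟩ := exists_holderBound_inter hα hγ one_pos f f₁ hc h₁
  obtain ⟨A₂, hA₂⟩ := exists_holderBound_inter hα hγ hb f f₂ hc h₂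
  exact ⟨_, ((((f.holderBound hα).const_coe_add hα hγ).mul
    ((f.holderBound_tder hα).const_coe_add hα hγ).star).const_mul Ω).add
    ((hA₂.sub hA₁).const_mul (Cα α))⟩

lemma exists_holderBound_linFlux (Ω : ℝ) (hα : α ∈ Ioo (0 : ℝ) 1) (hb : 0 < b) (hγ : 0 < γ) {M : ℝ}
    (hM : 0 < M) : ∃ C, 0 ≤ C ∧ ∀ (f₁ f₂ f : Car α) (ε : ℝ), Compat γ 1 M ε f f₁ →
      Compat γ b M ε f f₂ → HolderBound α (C * ε) (linFlux α b Ω γ f₁ f₂ f) := by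
  obtain ⟨C₁, h₁, hC₁⟩ := exists_linInter_le hα hγ one_pos hM
  obtain ⟨C₂, h₂, hC₂⟩ := exists_linInter_le hα hγ hb hM
  refine ⟨‖(Ω : ℂ)‖ * (2 * (2 * γ) * 4 + 2 * (2 * γ) * 4) + ‖(Cα α : ℂ)‖ * (C₂ + C₁), by positivity,
    fun f₁ f₂ f ε k₁ k₂ => ?_⟩
  have hr := HolderBound.const_coe hα hγ.le
  have h := (((hr.mul (f.holderBound_tder hα).star).add (hr.star.mul (f.holderBound hα))).const_mul
    Ω).add (((hC₂ f f₂ ε k₂).sub (hC₁ f f₁ ε k₁)).const_mul (Cα α))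
  refine h.mono ?_
  have hf := k₁.1
  calc _ = ‖(Ω : ℂ)‖ * (2 * (2 * γ) * 4 + 2 * (2 * γ) * 4) * ‖f‖ +
        ‖(Cα α : ℂ)‖ * (C₂ + C₁) * ε := by ring
    _ ≤ ‖(Ω : ℂ)‖ * (2 * (2 * γ) * 4 + 2 * (2 * γ) * 4) * ε +
        ‖(Cα α : ℂ)‖ * (C₂ + C₁) * ε := by gcongr
    _ = _ := by ring

lemma exists_flux_sub_le (Ω : ℝ) (hα : α ∈ Ioo (0 : ℝ) 1) (hb : 0 < b) (hγ : 0 < γ) {M : ℝ}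
    (hM : 0 < M) : ∃ C, 0 ≤ C ∧ ∃ δ > 0, ∀ (f₁ f₂ f : Car α) (ε : ℝ), ε ≤ δ →
      Compat γ 1 M ε f f₁ → Compat γ b M ε f f₂ → HolderBound α (C * ε ^ 2) fun w =>
        flux α b Ω γ f₁ f₂ f w - flux α b Ω γ 0 0 0 w - linFlux α b Ω γ f₁ f₂ f w := by
  obtain ⟨C₁, h₁, δ₁, hδ₁, hC₁⟩ := exists_inter_sub_le hα hγ one_pos hM
  obtain ⟨C₂, h₂, δ₂, hδ₂, hC₂⟩ := exists_inter_sub_le hα hγ hb hM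
  -- The rotation term has the exact remainder `Ω f conj(Df)`; both factors have Hölder bound
  -- `4‖f‖`, and `32 = 2 · 4 · 4`.
  refine ⟨‖(Ω : ℂ)‖ * 32 + ‖(Cα α : ℂ)‖ * (C₂ + C₁), by positivity, min δ₁ δ₂, lt_min hδ₁ hδ₂,
    fun f₁ f₂ f ε hε k₁ k₂ => ?_⟩
  have h := (((f.holderBound hα).mul (f.holderBound_tder hα).star).const_mul
    Ω).add (((hC₂ f f₂ ε (hε.trans (min_le_right _ _)) k₂).sub
      (hC₁ f f₁ ε (hε.trans (min_le_left _ _)) k₁)).const_mul (Cα α))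
  have hf := k₁.1
  have hle : ‖(Ω : ℂ)‖ * (2 * (4 * ‖f‖) * (4 * ‖f‖)) +
      ‖(Cα α : ℂ)‖ * (C₂ * ε ^ 2 + C₁ * ε ^ 2) ≤
      (‖(Ω : ℂ)‖ * 32 + ‖(Cα α : ℂ)‖ * (C₂ + C₁)) * ε ^ 2 := by
    calc _ = ‖(Ω : ℂ)‖ * 32 * ‖f‖ ^ 2 + ‖(Cα α : ℂ)‖ * (C₂ + C₁) * ε ^ 2 := by ring
      _ ≤ ‖(Ω : ℂ)‖ * 32 * ε ^ 2 + ‖(Cα α : ℂ)‖ * (C₂ + C₁) * ε ^ 2 := by gcongr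
      _ = _ := by ring
  refine (h.mono hle).congr fun w => ?_
  rw [flux, flux, linFlux, tder_zero]
  simp only [Pi.zero_apply, map_add, add_zero]
  ring

lemma linFlux_add (hα : α ∈ Ioo (0 : ℝ) 1) (hb : 0 < b) (hγ : 0 < γ) {M : ℝ} (hM : 0 < M)
    {f₁ f₂ f g₁ g₂ g : Car α} {ε ε' : ℝ} (h₁ : Compat γ 1 M ε f f₁) (h₂ : Compat γ b M ε f f₂)
    (k₁ : Compat γ 1 M ε' g g₁) (k₂ : Compat γ b M ε' g g₂) (w : Circle) :
    linFlux α b Ω γ (f₁ + g₁ : Car α) (f₂ + g₂ : Car α) (f + g : Car α) w =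
      linFlux α b Ω γ f₁ f₂ f w + linFlux α b Ω γ g₁ g₂ g w := by
  obtain ⟨A, -, hA⟩ := exists_isKernel_lin hα hγ one_pos hM.le
  obtain ⟨A', -, hA'⟩ := exists_isKernel_lin hα hγ hb hM.le
  rw [linFlux, linInter_add hα hγ hb (hA' _ _ _ h₂) (hA' _ _ _ k₂),
    linInter_add hα hγ one_pos (hA _ _ _ h₁) (hA _ _ _ k₁), Car.tder_add, Pi.add_apply, Car.toC_add,
    ContinuousMap.add_apply, map_add, linFlux, linFlux]
  ring

lemma linFlux_smul (r : ℝ) (f₁ f₂ f : Car α) (w : Circle) :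
    linFlux α b Ω γ (r • f₁ : Car α) (r • f₂ : Car α) (r • f : Car α) w =
      r * linFlux α b Ω γ f₁ f₂ f w := by
  rw [linFlux, linInter_smul, linInter_smul, Car.tder_smul, Pi.smul_apply, Car.toC_smul,
    ContinuousMap.smul_apply, Complex.real_smul, Complex.real_smul, map_mul, Complex.conj_ofReal,
    linFlux]
  ring

/-- One component of the functional is differentiable at the origin. -/
lemma hasFDerivAt_toH_flux (Ω : ℝ) (hα : α ∈ Ioo (0 : ℝ) 1) (hb : 0 < b) (hγ : 0 < γ) {M : ℝ}
    (hM : 0 < M) (p : (Car α × Car α) →ₗ[ℝ] Car α)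
    (h₁ : ∀ f, Compat γ 1 M ‖f‖ (p f) f.1) (h₂ : ∀ f, Compat γ b M ‖f‖ (p f) f.2)
    (hG : ∀ᶠ f : Car α × Car α in 𝓝 0, ∀ w, toH α (fun w => (flux α b Ω γ f.1 f.2 (p f) w).im) w =
      ((flux α b Ω γ f.1 f.2 (p f) w).im : ℂ)) :
    ∃ D : (Car α × Car α) →L[ℝ] H α,
      (∀ f w, D f w = ((linFlux α b Ω γ f.1 f.2 (p f) w).im : ℂ)) ∧
      HasFDerivAt (fun f => toH α fun w => (flux α b Ω γ f.1 f.2 (p f) w).im) D 0 := by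
  obtain ⟨C, hC, hlin⟩ := exists_holderBound_linFlux Ω hα hb hγ hM
  have hex : ∀ f : Car α × Car α, ∃ u : H α, ∀ w,
      u w = (((linFlux α b Ω γ f.1 f.2 (p f) w).im : ℝ) : ℂ) := fun f =>
    exists_H hα (hlin f.1 f.2 (p f) ‖f‖ (h₁ f) (h₂ f)).im fun w => by
      rw [linFlux_inv, Complex.conj_im]
  -- An element of `H` is determined by its values, so linearity of this choice can be checked
  -- pointwise.
  choose D₀ hD₀ using hex
  let D₁ : (Car α × Car α) →ₗ[ℝ] H α :=
    { toFun := D₀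
      map_add' := fun f g => H.ext fun w => by
        rw [H.toC_add, ContinuousMap.add_apply, hD₀, hD₀, hD₀, map_add, Prod.fst_add, Prod.snd_add,
          linFlux_add hα hb hγ hM (h₁ f) (h₂ f) (h₁ g) (h₂ g), Complex.add_im, Complex.ofReal_add]
      map_smul' := fun r f => H.ext fun w => by
        rw [RingHom.id_apply, H.toC_smul, ContinuousMap.smul_apply, hD₀, hD₀, map_smul,
          Prod.smul_fst, Prod.smul_snd, linFlux_smul, Complex.im_ofReal_mul, Complex.real_smul,
          Complex.ofReal_mul] }
  have hbd : ∀ f, ‖D₁ f‖ ≤ 2 * C * ‖f‖ := fun f => by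
    rw [mul_assoc]
    refine H.norm_le hα ((hlin f.1 f.2 (p f) ‖f‖ (h₁ f) (h₂ f)).im.congr fun w => ?_)
    exact (hD₀ f w).symm
  refine ⟨D₁.mkContinuous (2 * C) hbd, hD₀, ?_⟩
  obtain ⟨K, hK, δ, hδ, hrem⟩ := exists_flux_sub_le Ω hα hb hγ hM
  refine HasFDerivAt.of_isLittleO ?_
  have hO : (fun f : Car α × Car α => toH α (fun w => (flux α b Ω γ f.1 f.2 (p f) w).im) -
      toH α (fun w => (flux α b Ω γ (0 : Car α × Car α).1 (0 : Car α × Car α).2 (p 0) w).im) -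
      D₁.mkContinuous (2 * C) hbd (f - 0)) =O[𝓝 0] fun f => ‖f‖ ^ 2 := by
    refine Asymptotics.IsBigO.of_bound (2 * K) ?_
    have hs : ∀ᶠ f : Car α × Car α in 𝓝 0, ‖f‖ ≤ δ := by
      filter_upwards [Metric.ball_mem_nhds (0 : Car α × Car α) hδ] with f hf
      exact (mem_ball_zero_iff.mp hf).le
    filter_upwards [hG, hs] with f hf hfδ
    rw [norm_pow, norm_norm, mul_assoc]
    refine H.norm_le hα ((hrem f.1 f.2 (p f) ‖f‖ hfδ (h₁ f) (h₂ f)).im.congr fun w => ?_)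
    -- The value at the origin is also a `toH`; the neighborhood hypothesis identifies it too.
    have e0 := hG.self_of_nhds w
    rw [map_zero, Prod.fst_zero, Prod.snd_zero, Car.toC_zero, ContinuousMap.coe_zero] at e0
    rw [sub_zero, H.toC_sub, H.toC_sub, ContinuousMap.sub_apply, ContinuousMap.sub_apply, hf,
      map_zero, Prod.fst_zero, Prod.snd_zero, Car.toC_zero, ContinuousMap.coe_zero, e0,
      LinearMap.mkContinuous_apply]
    refine Eq.trans ?_ (congrArg _ (hD₀ f w).symm)
    push_cast [Complex.sub_im]
    rfl
  refine hO.trans_isLittleO ?_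
  have : (fun f : Car α × Car α => ‖f‖ ^ 2) =o[𝓝 0] fun f : Car α × Car α => ‖f‖ ^ 1 :=
    (Asymptotics.isLittleO_pow_pow one_lt_two).comp_tendsto (tendsto_norm_zero)
  simp only [pow_one] at this
  simpa using this.of_norm_right

end VState

namespace VState

/-! ### The geometry of the neighborhood and the series of the differential -/

variable {α b Ω γ β : ℝ}

lemma Compat.mono {M M' ε : ℝ} {f g : Car α} (h : Compat γ β M ε f g) (hM : M ≤ M') :
    Compat γ β M' ε f g := by
  have hε : 0 ≤ ε := (norm_nonneg _).trans h.1
  exact ⟨h.1, h.2.1, fun w τ => (h.2.2 w τ).trans (by gcongr)⟩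

/-- On coinciding circles the gap is `β` times the chord, so the Lipschitz bound of `f` is needed.
-/
lemma compat_self (hβ : 0 < β) {f : Car α} {ε : ℝ} (h : ‖f‖ ≤ ε) : Compat β β (2 / β) ε f f := by
  refine ⟨h, h, fun w τ => (f.norm_sub_le w τ).trans (le_of_le_of_eq
    (b := 2 * ε * dist w τ) (by gcongr) ?_)⟩
  rw [← mul_sub, norm_mul, Complex.norm_real, Real.norm_of_nonneg hβ.le, ← dist_eq_norm_coe]
  field_simp

lemma abs_sub_le_norm (γ β : ℝ) (w τ : Circle) (hγ : 0 ≤ γ) (hβ : 0 ≤ β) :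
    |γ - β| ≤ ‖(γ : ℂ) * w - β * τ‖ := by
  have h := abs_norm_sub_norm_le ((γ : ℂ) * w) (β * τ)
  rwa [norm_mul, norm_mul, Circle.norm_coe, Circle.norm_coe, mul_one, mul_one, Complex.norm_real,
    Complex.norm_real, Real.norm_of_nonneg hγ, Real.norm_of_nonneg hβ] at h

/-- Distinct circles are at least `|γ - β|` apart, so sup norms suffice. -/
lemma compat_of_ne (hγ : 0 ≤ γ) (hβ : 0 ≤ β) (hne : γ ≠ β) {f g : Car α} {ε : ℝ} (hf : ‖f‖ ≤ ε)
    (hg : ‖g‖ ≤ ε) : Compat γ β (2 / |γ - β|) ε f g := by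
  have h0 : 0 < |γ - β| := abs_pos.mpr (sub_ne_zero.mpr hne)
  have hε : 0 ≤ ε := (norm_nonneg _).trans hf
  refine ⟨hf, hg, fun w τ => ?_⟩
  calc ‖f w - g τ‖ ≤ ‖f w‖ + ‖g τ‖ := norm_sub_le _ _
    _ ≤ ε + ε := add_le_add ((f.norm_apply_le w).trans hf) ((g.norm_apply_le τ).trans hg)
    _ = 2 / |γ - β| * ε * |γ - β| := by field_simp; ring
    _ ≤ _ := by gcongr; exact abs_sub_le_norm γ β w τ hγ hβ

lemma gap_eq (f g : Circle → ℂ) (w τ : Circle) :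
    gap γ β f g w τ = ((γ : ℂ) * w - β * τ) + (f w - g τ) := by
  rw [gap, perturb, perturb]; ring

lemma le_norm_gap_self (hβ : 0 < β) {f : Car α} {ρ : ℝ} (h : ‖f‖ ≤ ρ) (w τ : Circle) :
    (β - 2 * ρ) * dist w τ ≤ ‖gap β β f f w τ‖ := by
  have h1 : ‖(β : ℂ) * w - β * τ‖ = β * dist w τ := by
    rw [← mul_sub, norm_mul, Complex.norm_real, Real.norm_of_nonneg hβ.le, ← dist_eq_norm_coe]
  have h2 : ‖f w - f τ‖ ≤ 2 * ρ * dist w τ := (f.norm_sub_le w τ).trans (by gcongr)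
  have h3 := norm_sub_le_norm_add ((β : ℂ) * w - β * τ) (f w - f τ)
  rw [gap_eq]
  linarith

/-- The gap is at least `|γ - β| - 2ρ`; since a chord is at most `2`, half of this times the chord
is still a lower bound. -/
lemma le_norm_gap_of_ne (hγ : 0 ≤ γ) (hβ : 0 ≤ β) {f g : Car α} {ρ : ℝ}
    (hρ : 2 * ρ ≤ |γ - β|) (hf : ‖f‖ ≤ ρ) (hg : ‖g‖ ≤ ρ) (w τ : Circle) :
    (|γ - β| / 2 - ρ) * dist w τ ≤ ‖gap γ β f g w τ‖ := by
  have h1 := abs_sub_le_norm γ β w τ hγ hβ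
  have h2 : ‖f w - g τ‖ ≤ 2 * ρ := (norm_sub_le _ _).trans
    (by linarith [(f.norm_apply_le w).trans hf, (g.norm_apply_le τ).trans hg])
  have h3 := norm_sub_le_norm_add ((γ : ℂ) * w - β * τ) (f w - g τ)
  have h4 := dist_circle_le_two w τ
  have h5 : (|γ - β| / 2 - ρ) * dist w τ ≤ (|γ - β| / 2 - ρ) * 2 := by gcongr; linarith
  rw [gap_eq]
  linarith

/-- The first coefficient vanishes, and the others can be shifted. -/
lemma tendsto_shift_sine_series (hα : α ∈ Ioo (0 : ℝ) 1) {u : Circle → ℂ} {A : ℝ}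
    (hu : HolderBound α A u) (hs : ∀ w, u w⁻¹ = conj (u w)) {m : ℕ → ℝ}
    (hm : ∀ n : ℕ, pairing n u = (((n + 1) * m n : ℝ) : ℂ)) (hm0 : m 0 = 0) (w : Circle) :
    Tendsto (fun N : ℕ => Complex.I / 2 * ∑ n ∈ Finset.Icc 1 N, ((n : ℂ) + 1) * (m n : ℂ) *
      ((w : ℂ) ^ (n + 1) - conj (w : ℂ) ^ (n + 1))) atTop (𝓝 ((u w).im : ℂ)) := by
  have h := tendsto_sine_series hα hu.im (fun w => by rw [hs, Complex.conj_im]) w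
  have hc : ∀ n : ℕ, (sineCoeff (fun w => (u w).im) (n + 1) : ℂ) = ((n : ℂ) + 1) * m n := fun n => by
    rw [sineCoeff_im (hu.continuous hα) hs, hm]
    push_cast
    rfl
  -- The shifted partial sum up to `N` is the sine sum up to `N + 1`; its extra first term vanishes
  -- because `m 0 = 0`.
  refine ((tendsto_add_atTop_iff_nat 1).mpr h).congr fun N => ?_
  congr 1
  induction N with
  | zero =>
    have := hc 0
    rw [hm0] at this
    simp [this]
  | succ N ih =>
    rw [Finset.sum_Icc_succ_top (by omega), ih, Finset.sum_Icc_succ_top (by omega), hc]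

/-! ### From Fourier coefficients to the entries of the matrix -/

lemma kappa_comm (n : ℕ) : kappa α γ β n = kappa α β γ n := by
  have h : ∀ σ : Circle, ‖(γ : ℂ) - β * σ‖ = ‖(β : ℂ) - γ * σ‖ := fun σ => by
    have h1 := norm_sub_sq_circle γ β 1 σ
    have h2 := norm_sub_sq_circle β γ 1 σ
    rw [Circle.coe_one, mul_one] at h1 h2
    rw [← sq_eq_sq₀ (norm_nonneg _) (norm_nonneg _), h1, h2]
    ring
  simp only [kappa, h]

/-- The kernel is homogeneous of degree `-α`; with the factor `b` of the linearization this produces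
`b ^ (1 - α)` in front of `Θ`. -/
lemma kappa_self (hb : 0 < b) (n : ℕ) : kappa α b b n = b ^ (-α) * kappa α 1 1 n := by
  have h : ∀ σ : Circle, ((σ : ℂ) ^ n).re * ‖(b : ℂ) - b * σ‖ ^ (-α) =
      b ^ (-α) * (((σ : ℂ) ^ n).re * ‖((1 : ℝ) : ℂ) - (1 : ℝ) * σ‖ ^ (-α)) := fun σ => by
    rw [show (b : ℂ) - b * σ = b * (((1 : ℝ) : ℂ) - (1 : ℝ) * σ) by push_cast; ring, norm_mul,
      Complex.norm_real, Real.norm_of_nonneg hb.le, Real.mul_rpow hb.le (norm_nonneg _)]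
    ring
  simp only [kappa, h]
  rw [integral_const_mul]
  ring

lemma Λ_one (hα : α ∈ Ioo (0 : ℝ) 1) (n : ℕ) : Λ α n 1 = kappa α 1 1 n := by
  rw [Λ, integral_besselIntegrand hα one_pos, div_one, one_mul]

lemma mul_Λ (hα : α ∈ Ioo (0 : ℝ) 1) (hb : 0 < b) (n : ℕ) : b * Λ α n b = kappa α b 1 n := by
  rw [Λ, integral_besselIntegrand hα hb, ← mul_assoc, mul_one_div_cancel hb.ne', one_mul]

lemma M_mulVec_zero (hα : α ∈ Ioo (0 : ℝ) 1) (hb : 0 < b) (n : ℕ) (x y : ℝ) :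
    (M α b Ω n *ᵥ ![x, y]) 0 = 1 * Ω * x +
      b * (kappa α 1 b 1 * x - kappa α 1 b n * y) -
      (kappa α 1 1 1 * x - kappa α 1 1 n * x) := by
  rw [kappa_comm (γ := 1) (β := b), kappa_comm (γ := 1) (β := b), ← mul_Λ hα hb, ← mul_Λ hα hb,
    ← Λ_one hα, ← Λ_one hα]
  simp [M, Θ, Matrix.mulVec, dotProduct, Fin.sum_univ_two]
  ring

lemma M_mulVec_one (hα : α ∈ Ioo (0 : ℝ) 1) (hb : 0 < b) (n : ℕ) (x y : ℝ) :
    (M α b Ω n *ᵥ ![x, y]) 1 = b * Ω * y +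
      b * (kappa α b b 1 * y - kappa α b b n * y) -
      (kappa α b 1 1 * y - kappa α b 1 n * x) := by
  rw [kappa_self hb, kappa_self hb, ← mul_Λ hα hb, ← mul_Λ hα hb, ← Λ_one hα, ← Λ_one hα]
  have : b ^ (1 - α) = b * b ^ (-α) := by
    rw [sub_eq_add_neg, Real.rpow_add hb, Real.rpow_one]
  simp [M, Θ, Matrix.mulVec, dotProduct, Fin.sum_univ_two, this]
  ring

/-! ### The neighborhood `V` and the two components -/

lemma mem_V {f : Car α × Car α} : f ∈ V α b ↔ ‖f.1‖ < radius b ∧ ‖f.2‖ < radius b := by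
  rw [V, mem_prod, mem_ball_zero_iff, mem_ball_zero_iff]

lemma radius_le (b : ℝ) : 4 * radius b ≤ b ∧ 4 * radius b ≤ 1 - b := by
  have h1 := min_le_left b (1 - b)
  have h2 := min_le_right b (1 - b)
  constructor <;> rw [radius] <;> linarith

lemma V_mem_nhds (hb : b ∈ Ioo (0 : ℝ) 1) : V α b ∈ 𝓝 (0 : Car α × Car α) := by
  have hr : 0 < radius b := by
    have := lt_min hb.1 (sub_pos.mpr hb.2)
    rw [radius]; linarith
  exact prod_mem_nhds (Metric.ball_mem_nhds _ hr) (Metric.ball_mem_nhds _ hr)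

lemma toH_flux_apply (hα : α ∈ Ioo (0 : ℝ) 1) (hb : 0 < b) (hγ : 0 < γ) {f₁ f₂ f : Car α} {c : ℝ}
    (hc : 0 < c) (h₁ : ∀ w τ, c * dist w τ ≤ ‖gap γ 1 f f₁ w τ‖)
    (h₂ : ∀ w τ, c * dist w τ ≤ ‖gap γ b f f₂ w τ‖) (w : Circle) :
    toH α (fun w => (flux α b Ω γ f₁ f₂ f w).im) w = ((flux α b Ω γ f₁ f₂ f w).im : ℂ) := by
  obtain ⟨A, hA⟩ := exists_holderBound_flux (Ω := Ω) hα hb hγ f₁ f₂ f hc h₁ h₂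
  exact toH_apply (exists_H hα hA.im fun w => by rw [flux_inv, Complex.conj_im]) w

lemma toH_flux_outer (hα : α ∈ Ioo (0 : ℝ) 1) (hb : b ∈ Ioo (0 : ℝ) 1) {f : Car α × Car α}
    (hf : f ∈ V α b) (w : Circle) : toH α (fun w => (flux α b Ω 1 f.1 f.2 f.1 w).im) w =
      ((flux α b Ω 1 f.1 f.2 f.1 w).im : ℂ) := by
  obtain ⟨h1, h2⟩ := mem_V.mp hf
  obtain ⟨r1, r2⟩ := radius_le b
  have e : |1 - b| = 1 - b := abs_of_pos (by linarith [hb.2])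
  -- The radius `ρ` satisfies `4ρ ≤ 1 - b`, so the gap between the boundaries has the constant `(1 -
  -- b)/2 - ρ ≥ (1 - b)/4`; the self-gap constant `1 - 2ρ` is larger.
  refine toH_flux_apply hα hb.1 one_pos (c := (1 - b) / 4) (by linarith [hb.2])
    (fun w τ => le_trans ?_ (le_norm_gap_self one_pos h1.le w τ))
    (fun w τ => le_trans ?_ (le_norm_gap_of_ne zero_le_one hb.1.le (by linarith [hb.2]) h1.le h2.le w τ)) w
  · gcongr
    linarith [hb.1]
  · gcongr
    linarith

lemma toH_flux_inner (hα : α ∈ Ioo (0 : ℝ) 1) (hb : b ∈ Ioo (0 : ℝ) 1) {f : Car α × Car α}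
    (hf : f ∈ V α b) (w : Circle) : toH α (fun w => (flux α b Ω b f.1 f.2 f.2 w).im) w =
      ((flux α b Ω b f.1 f.2 f.2 w).im : ℂ) := by
  obtain ⟨h1, h2⟩ := mem_V.mp hf
  obtain ⟨r1, r2⟩ := radius_le b
  have e : |b - 1| = 1 - b := by rw [abs_sub_comm]; exact abs_of_pos (by linarith [hb.2])
  -- For the inner boundary the self-gap constant is `b - 2ρ ≥ b/2`, so `b` also enters the minimum.
  refine toH_flux_apply hα hb.1 hb.1 (c := min b (1 - b) / 4)
    (by have := lt_min hb.1 (sub_pos.mpr hb.2); linarith)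
    (fun w τ => le_trans ?_ (le_norm_gap_of_ne hb.1.le zero_le_one (by linarith [hb.2]) h2.le h1.le w τ))
    (fun w τ => le_trans ?_ (le_norm_gap_self hb.1 h2.le w τ)) w
  · gcongr
    linarith [min_le_right b (1 - b)]
  · gcongr
    linarith [min_le_left b (1 - b), hb.1]

lemma G_eq (f : Car α × Car α) : G α b Ω f = (toH α fun w => (flux α b Ω 1 f.1 f.2 f.1 w).im,
    toH α fun w => (flux α b Ω b f.1 f.2 f.2 w).im) := by
  have h1 : G₁ α b Ω f.1 f.2 = fun w => (flux α b Ω 1 f.1 f.2 f.1 w).im := funext fun w => F_eq _ _ _ w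
  have h2 : G₂ α b Ω f.1 f.2 = fun w => (flux α b Ω b f.1 f.2 f.2 w).im := funext fun w => F_eq _ _ _ w
  rw [G, h1, h2]

lemma exists_compat (hb : b ∈ Ioo (0 : ℝ) 1) : ∃ M : ℝ, 0 < M ∧ ∀ f : Car α × Car α,
    (Compat 1 1 M ‖f‖ f.1 f.1 ∧ Compat 1 b M ‖f‖ f.1 f.2) ∧
    (Compat b 1 M ‖f‖ f.2 f.1 ∧ Compat b b M ‖f‖ f.2 f.2) := by
  have hb0 := hb.1
  have hb1 : 0 < 1 - b := sub_pos.mpr hb.2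
  have e : |1 - b| = 1 - b := abs_of_pos hb1
  have e' : |b - 1| = 1 - b := by rw [abs_sub_comm, e]
  have p1 : 0 < 2 / b := by positivity
  have p2 : 0 < 2 / (1 - b) := by positivity
  refine ⟨2 + 2 / b + 2 / (1 - b), by positivity, fun f => ?_⟩
  have h1 : ‖f.1‖ ≤ ‖f‖ := norm_fst_le f
  have h2 : ‖f.2‖ ≤ ‖f‖ := norm_snd_le f
  refine ⟨⟨(compat_self one_pos h1).mono ?_, (compat_of_ne zero_le_one hb0.le hb.2.ne' h1 h2).mono ?_⟩,
    (compat_of_ne hb0.le zero_le_one hb.2.ne h2 h1).mono ?_, (compat_self hb0 h2).mono ?_⟩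
  · rw [div_one]; linarith
  · rw [e]; linarith
  · rw [e']; linarith
  · linarith

/-- The functional is differentiable at the origin, with differential the linearized flux. -/
lemma exists_hasFDerivAt_G (Ω : ℝ) (hα : α ∈ Ioo (0 : ℝ) 1) (hb : b ∈ Ioo (0 : ℝ) 1) :
    ∃ D : (Car α × Car α) →L[ℝ] H α × H α, HasFDerivAt (G α b Ω) D 0 ∧
      ∀ f w, (D f).1 w = ((linFlux α b Ω 1 f.1 f.2 f.1 w).im : ℂ) ∧
        (D f).2 w = ((linFlux α b Ω b f.1 f.2 f.2 w).im : ℂ) := by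
  obtain ⟨M, hM, hcomp⟩ := exists_compat (α := α) hb
  obtain ⟨D₁, hD₁, hd₁⟩ := hasFDerivAt_toH_flux Ω hα hb.1 one_pos hM (LinearMap.fst ℝ _ _)
    (fun f => (hcomp f).1.1) (fun f => (hcomp f).1.2)
    (by filter_upwards [V_mem_nhds hb] with f hf w using toH_flux_outer hα hb hf w)
  obtain ⟨D₂, hD₂, hd₂⟩ := hasFDerivAt_toH_flux Ω hα hb.1 hb.1 hM (LinearMap.snd ℝ _ _)
    (fun f => (hcomp f).2.1) (fun f => (hcomp f).2.2)
    (by filter_upwards [V_mem_nhds hb] with f hf w using toH_flux_inner hα hb hf w)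
  refine ⟨D₁.prod D₂, ?_, fun f w => ⟨hD₁ f w, hD₂ f w⟩⟩
  exact (hd₁.prodMk hd₂).congr_of_eventuallyEq (Eventually.of_forall G_eq)

lemma tendsto_partialSum_zero (hα : α ∈ Ioo (0 : ℝ) 1) (hb : b ∈ Ioo (0 : ℝ) 1) {h₁ h₂ : Car α}
    {a c : ℕ → ℝ}
    (ha : ∀ w : Circle, HasSum (fun n : ℕ => (a (n + 1) : ℂ) * conj (w : ℂ) ^ (n + 1)) (h₁ w))
    (hc : ∀ w : Circle, HasSum (fun n : ℕ => (c (n + 1) : ℂ) * conj (w : ℂ) ^ (n + 1)) (h₂ w))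
    (w : Circle) : Tendsto (partialSum α b Ω a c 0 w) atTop
      (𝓝 ((linFlux α b Ω 1 h₁ h₂ h₁ w).im : ℂ)) := by
  obtain ⟨M, hM, hcomp⟩ := exists_compat (α := α) hb
  obtain ⟨C, -, hC⟩ := exists_holderBound_linFlux Ω hα hb.1 one_pos hM
  obtain ⟨k₁, k₂⟩ := (hcomp (h₁, h₂)).1
  -- The sequence `m` is read off from `pairing_linFlux`; it vanishes at `0` because `cut` discards
  -- the irrelevant values `a 0` and `c 0`.
  have h := tendsto_shift_sine_series hα (hC h₁ h₂ h₁ _ k₁ k₂) (linFlux_inv h₁ h₂ h₁)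
    (m := fun n => _) (fun n => pairing_linFlux hα one_pos hb.1 ha ha hc hM k₁ k₂ n)
    (by simp [cut]) w
  refine h.congr fun N => ?_
  rw [partialSum]
  congr 1
  refine Finset.sum_congr rfl fun n hn => ?_
  have hn : 0 < n := (Finset.mem_Icc.mp hn).1
  rw [M_mulVec_zero hα hb.1, cut, cut, if_pos hn, if_pos hn]

lemma tendsto_partialSum_one (hα : α ∈ Ioo (0 : ℝ) 1) (hb : b ∈ Ioo (0 : ℝ) 1) {h₁ h₂ : Car α}
    {a c : ℕ → ℝ}
    (ha : ∀ w : Circle, HasSum (fun n : ℕ => (a (n + 1) : ℂ) * conj (w : ℂ) ^ (n + 1)) (h₁ w))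
    (hc : ∀ w : Circle, HasSum (fun n : ℕ => (c (n + 1) : ℂ) * conj (w : ℂ) ^ (n + 1)) (h₂ w))
    (w : Circle) : Tendsto (partialSum α b Ω a c 1 w) atTop
      (𝓝 ((linFlux α b Ω b h₁ h₂ h₂ w).im : ℂ)) := by
  obtain ⟨M, hM, hcomp⟩ := exists_compat (α := α) hb
  obtain ⟨C, -, hC⟩ := exists_holderBound_linFlux Ω hα hb.1 hb.1 hM
  obtain ⟨k₁, k₂⟩ := (hcomp (h₁, h₂)).2
  have h := tendsto_shift_sine_series hα (hC h₁ h₂ h₂ _ k₁ k₂) (linFlux_inv h₁ h₂ h₂)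
    (m := fun n => _) (fun n => pairing_linFlux hα hb.1 hb.1 hc ha hc hM k₁ k₂ n)
    (by simp [cut]) w
  refine h.congr fun N => ?_
  rw [partialSum]
  congr 1
  refine Finset.sum_congr rfl fun n hn => ?_
  have hn : 0 < n := (Finset.mem_Icc.mp hn).1
  rw [M_mulVec_one hα hb.1, cut, cut, if_pos hn, if_pos hn]

end VState

theorem mainTheorem4 (α b Ω : ℝ) (hα : α ∈ Set.Ioo (0 : ℝ) 1) (hb : b ∈ Set.Ioo (0 : ℝ) 1) :
    -- the integrals defining `Λ_n(b)` and `Λ_n(1)` converge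
    (∀ n : ℕ, 1 ≤ n →
      MeasureTheory.IntegrableOn (VState.besselIntegrand α n b) (Set.Ioi 0) ∧
      MeasureTheory.IntegrableOn (VState.besselIntegrand α n 1) (Set.Ioi 0)) ∧
    -- `G(Ω, ·)` is well defined from `V` to `Y`, and Fréchet differentiable at `(0, 0)`
    (∀ f ∈ VState.V α b, ∀ w : Circle,
      (VState.G α b Ω f).1 w = (VState.G₁ α b Ω f.1 f.2 w : ℂ) ∧
      (VState.G α b Ω f).2 w = (VState.G₂ α b Ω f.1 f.2 w : ℂ)) ∧
    DifferentiableAt ℝ (VState.G α b Ω) (0, 0) ∧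
    -- its differential at `(0, 0)` is the matrix Fourier multiplier
    (∀ (h₁ h₂ : VState.Car α) (a c : ℕ → ℝ),
      (∀ w : Circle, HasSum (fun n : ℕ =>
        (a (n + 1) : ℂ) * (starRingEnd ℂ) (w : ℂ) ^ (n + 1)) (h₁ w)) →
      (∀ w : Circle, HasSum (fun n : ℕ =>
        (c (n + 1) : ℂ) * (starRingEnd ℂ) (w : ℂ) ^ (n + 1)) (h₂ w)) →
      ∀ w : Circle,
        Filter.Tendsto (VState.partialSum α b Ω a c 0 w) Filter.atTop
          (nhds ((fderiv ℝ (VState.G α b Ω) (0, 0) (h₁, h₂)).1 w)) ∧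
        Filter.Tendsto (VState.partialSum α b Ω a c 1 w) Filter.atTop
          (nhds ((fderiv ℝ (VState.G α b Ω) (0, 0) (h₁, h₂)).2 w))) ∧
    -- the determinant of the matrices
    (∀ n : ℕ, 2 ≤ n →
      (VState.M α b Ω n).det =
        (Ω - VState.Θ α n + b ^ 2 * VState.Λ α 1 b) *
          (b * Ω + b ^ (1 - α) * VState.Θ α n - b * VState.Λ α 1 b) +
        b ^ 3 * VState.Λ α n b ^ 2) := by
  refine ⟨fun n _ => ⟨VState.integrableOn_besselIntegrand hα hb.1 n,
    VState.integrableOn_besselIntegrand hα one_pos n⟩, fun f hf w => ?_, ?_, ?_, fun n _ => ?_⟩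
  · have h1 : VState.G₁ α b Ω f.1 f.2 w = (VState.flux α b Ω 1 f.1 f.2 f.1 w).im :=
      VState.F_eq _ _ _ w
    have h2 : VState.G₂ α b Ω f.1 f.2 w = (VState.flux α b Ω b f.1 f.2 f.2 w).im :=
      VState.F_eq _ _ _ w
    rw [VState.G_eq, h1, h2]
    exact ⟨VState.toH_flux_outer hα hb hf w, VState.toH_flux_inner hα hb hf w⟩
  · obtain ⟨D, hD, -⟩ := VState.exists_hasFDerivAt_G Ω hα hb
    exact hD.differentiableAt
  · intro h₁ h₂ a c ha hc w
    obtain ⟨D, hD, hDw⟩ := VState.exists_hasFDerivAt_G Ω hα hb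
    have e : fderiv ℝ (VState.G α b Ω) (0, 0) = D := hD.fderiv
    obtain ⟨e1, e2⟩ := hDw (h₁, h₂) w
    rw [e, e1, e2]
    exact ⟨VState.tendsto_partialSum_zero hα hb ha hc w,
      VState.tendsto_partialSum_one hα hb ha hc w⟩
  · rw [VState.M, Matrix.det_fin_two]
    simp only [Matrix.of_apply, Matrix.cons_val_zero, Matrix.cons_val_one, Matrix.cons_val']
    simp
    ring
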